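/- **Problem.** Consider $\min_{x\in\mathbb R^n} f_0(x)=g(x)+h(x)$ subject to $Ax=b$ and $f_i(x)\le 0$ ($i\in[m]$), with $A\in\mathbb R^{l\times n}$, $f=(f_1,\dots,f_m)$. Write $X=\mathrm{dom}(h)$, $D=\mathrm{diam}(X)$, $p=(y,z)$, $\|p\|^2=\|y\|^2+\|z\|^2$ and, for a parameter $\gamma_2\ge1$, $X_+=\{u+\sqrt{\gamma_2}(u-v):u,v\in X\}\supseteq X$ (the region of the extrapolated points of the method). A pair $(x,p)$ is $\varepsilon$-KKT if $x\in X$, $z\ge0$, $(\|Ax-b\|^2+\|[f(x)]_+\|^2)^{1/2}\le\varepsilon$, $\mathrm{dist}(0,\nabla g(x)+\partial h(x)+A^\top y+\sum_iz_i\nabla f_i(x))\le\varepsilon$ and $\sum_i|z_if_i(x)|\le\varepsilon$; $x$ is an $\varepsilon$-KKT point if such a $p$ exists. **Assumptions.** (1) $h$ is closed convex and $X$ is bounded; $g$ is differentiable and the $f_i$ are convex and differentiable on $\mathbb R^n$. There are constants $L_0,L_i\ge0$ and $B_i$ such that $\nabla g$ is $L_0$-Lipschitz on $X_+$, $\nabla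 f_i$ is $L_i$-Lipschitz on $X_+$, and $\max\{|f_i|,\|\nabla f_i\|\}\le B_i$ on $X_+$. (2) Some $x_{\rm feas}\in\mathrm{int}\,X$ satisfies $Ax_{\rm feas}=b$ and $f_i(x_{\rm feas})<0$ for all $i$. (3) $g+\frac\rho2\|\cdot\|^2$ is convex, $\rho>0$. (4) $\partial h(x)\subseteq\mathcal N_X(x)+\mathcal B_M$ for $x\in X$ ($M\ge0$), $A$ has full row rank, and $\max\{|f_0(x)|,\|\nabla g(x)\|\}\le B_0$ for $x\in X$. **The method (HiAPeM).** Inputs: tolerance $\varepsilon$, $\beta_0>0$, $\sigma>1$, $\rho$, $\gamma>1$, $\gamma_1>1$, $\gamma_2\ge1$, $\rho\le L_{\min}\le L_0+2\rho+\beta_0L_c$, integers $N_1\ge2$ and $N_0\ge\frac{N_1}{\gamma-1}$, $x^0\in X$, $\widehat\varepsilon_1,\widehat\varepsilon_2$. Let $$\mathcal G^c_{\beta,p}(x)=g(x)+\rho\|x-c\|^2+y^\top(Ax-b)+\tfrac\beta2\|Ax-b\|^2+\tfrac1{2\beta}\big(\|[z+\beta f(x)]_+\|^2-\|z\|^2\big),$$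 $U_\beta(p,x)=(y+\beta(Ax-b),[z+\beta f(x)]_+)$, and let the $c$-subproblem be the given problem with objective $f_0+\rho\|\cdot-c\|^2$. *AdapAPG$(G,w,\delta)$.* Let $P_{L}(v)=\arg\min_x\langle\nabla G(v),x\rangle+\frac L2\|x-v\|^2+h(x)$ and call $L$ accepted at $(v,x)$ if $G(x)\le G(v)+\langle\nabla G(v),x-v\rangle+\frac L2\|x-v\|^2$. From $L=L_{\min}$ repeat $L\leftarrow\gamma_1L$, $x=P_L(w)$ until $L$ is accepted at $(w,x)$; set $x^0=x^{-1}=x$, $\alpha_{-1}=1$ and let $L_0'$ be this $L$. For $k=0,1,\dots$: try $L=L_k',\gamma_1L_k',\gamma_1^2L_k',\dots$ with $\alpha_k=\sqrt{\rho/L}$, $v=x^k+\frac{\alpha_k(1-\alpha_{k-1})}{\alpha_{k-1}(1+\alpha_k)}(x^k-x^{k-1})$, $x^{k+1}=P_L(v)$ until $L$ is accepted at $(v,x^{k+1})$; return $x^{k+1}$ if $\mathrm{dist}(0,\nabla G(x^{k+1})+\partial h(x^{k+1}))\le\delta$, else set $L_{k+1}'=\max\{L_{\min},L/\gamma_2\}$.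 Evaluations are counted as follows: two (value and gradient at $w$) per call, one (value of $G$ at the trial point) per trial of the first search, three (value and gradient at $v$, value at the trial point) per trial of the later searches. *iALM$(\eta,c)$.* Start from any $x\in X$, $p=0$, $\beta=\beta_0$. Repeat: $u=$ AdapAPG$(\mathcal G^c_{\beta,p},x,\sqrt{\frac{\sigma-1}{\sigma+1}}\frac\eta2\min\{1,\sqrt\rho\})$, $p'=U_\beta(p,u)$; return $(\beta,u,p')$ if $\max\{\frac{\|p\|+\|p'\|}\beta,\sum_i|z_i'f_i(u)|\}\le\eta$; else $(x,p,\beta)\leftarrow(u,p',\sigma\beta)$. *PenMM$(\eta,\beta_{\rm in},c,\bar p)$.* Start from $x=c$, $p=\bar p$, $\beta=\beta_{\rm in}$. While $(x,p)$ is not $\eta$-KKT for the $c$-subproblem: $x\leftarrow$ AdapAPG$(\mathcal G^c_{\beta,\bar p},x,\eta\min\{1,\sqrt\rho\})$, $p\leftarrow U_\beta(\bar p,x)$, $\beta\leftarrow\sigma\beta$. Return $(x,p)$ and the last $\beta$ used ($\beta_{\rm in}$ if none was used). *HiAPeM.* After every subroutine call with centre $x^k$ and result $(\beta_k,x^{k+1},p^{k+1})$,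 stop with output $(x^{k+1},p^{k+1})$ if $\|x^{k+1}-x^k\|\le\frac\varepsilon{4\rho}$. For $k=0,\dots,N_0-1$ call iALM$(\frac{\widehat\varepsilon_1}2,x^k)$. Then set $s=1$, $k=N_0$, $K_1=N_0+N_1$, $\bar\beta=\beta_{k-1}$, $\bar p=p^k$. While $(x^k,p^k)$ is not $\varepsilon$-KKT: call PenMM$(\frac{\widehat\varepsilon_2}2,\bar\beta,x^k,\bar p)$, set $\bar\beta=\beta_k$, $k\leftarrow k+1$; if now $k=K_s-1$, call iALM$(\frac{\widehat\varepsilon_1}2,x^k)$, set $k\leftarrow K_s$, $\bar\beta=\beta_{k-1}$, $\bar p=p^k$, $K_{s+1}=K_s+\lceil\gamma^sN_1\rceil$, $s\leftarrow s+1$. When the while condition fails, output $(x^k,p^k)$. **Constants.** With terms of absent constraints ($l=0$ or $m=0$) omitted, let $$M_y=\tfrac{\sqrt{\lambda_{\max}(AA^\top)}}{\lambda_{\min}(AA^\top)}(B_0+2\rho D+M)\Big(1+\tfrac D{\mathrm{dist}(x_{\rm feas},\partial X)}+\tfrac{D\max_iB_i}{\min_i|f_i(x_{\rm feas})|}\Big),\quad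 M_z=\tfrac{D(B_0+\rho D+M)}{\min_i|f_i(x_{\rm feas})|},$$ ($\partial X$ the boundary of $X$), $M_p=\sqrt{M_y^2+M_z^2}$, $\widehat M=2M_p+\sqrt\sigma\max\{\frac{\sqrt5}2M_p,\sqrt{M_p},\frac1{2\sqrt2}\}$, $\theta=\min\{1,\frac1{\sqrt\rho}\}$, $\Lambda=(\sum_iL_i^2)^{1/2}$, $L_c=\|A^\top A\|+\sum_iB_i(B_i+L_i)$, $\tau=1+\lceil\log_{\gamma_1}\gamma_2\rceil$, $$\widehat C=\max\{\tfrac{16\sqrt2(3M_p^2+2\widehat M^2)}\theta,\tfrac{16\sqrt2(M_p+\widehat M)}\theta,4\},\quad \widetilde C=\max\{\tfrac{96\rho(\gamma-1)}{N_1\log\gamma}(\tfrac12+\tfrac D2+\tfrac{9\widehat M}4+\tfrac{\widehat C\sigma}4),\varepsilon e\},$$ $K_s=N_0+\sum_{j=0}^{s-1}\lceil\gamma^jN_1\rceil$, and let $S$ be the least integer $\ge 0$ with $$K_S\ge N_0+N_1\tfrac{\gamma^S-1}{\gamma-1}\ge\tfrac{96\rho B_0}{\varepsilon^2}+\tfrac{48\rho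 N_0(\frac D2+\widehat M)}\varepsilon,\qquad\gamma^S\ge2\tfrac{\widetilde C}\varepsilon\log\tfrac{\widetilde C}\varepsilon.$$ Let $\bar\varepsilon_1=\sqrt{\frac{\sigma-1}{\sigma+1}}\frac\varepsilon4\min\{1,\sqrt\rho\}$, $\bar\varepsilon_2=\frac\varepsilon{4\sqrt2}\min\{\sqrt\rho,\frac1{\sqrt\rho}\}$, $\widehat C_\varepsilon=\max\{\frac{20M_p^2}{\beta_0\varepsilon},\frac{16M_p}{\beta_0\varepsilon},\frac4{\beta_0}\}$, $\bar\beta=\max\{\frac{16\sqrt2(3M_p^2+2\widehat M^2)}{\varepsilon\theta},\frac{16\sqrt2(M_p+\widehat M)}{\varepsilon\theta},8\}$, $K_{\rm iALM}=\lceil\log_\sigma\widehat C_\varepsilon\rceil+1$, $K_{\rm PenMM}=\lceil\log_\sigma\frac{\bar\beta}{\beta_0}\rceil+1$, $\kappa=\frac{L_0+2\rho+2M_p\Lambda}\rho$, $$\widehat L_\varepsilon=L_0+2\rho+\beta_0\sigma L_c\widehat C_\varepsilon+\Lambda\big(2M_p+\tfrac\varepsilon{2\sqrt2}\sqrt{\beta_0\widehat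 C_\varepsilon}\big),\quad\bar L=L_0+2\rho+L_c\sigma\bar\beta+\widehat M\Lambda,$$ $$\widetilde C_\varepsilon=\tfrac{\sqrt{\beta_0L_c\sigma^2\widehat C_\varepsilon}}{\sqrt\rho(\sqrt\sigma-1)}+\Big(\Lambda\tfrac{\varepsilon\sqrt{\beta_0}}{\sqrt{2\sigma}}\Big)^{1/2}\tfrac{\sigma^{1/2}\widehat C_\varepsilon^{1/4}}{\sqrt\rho(\sigma^{1/4}-1)},\quad\alpha_K=K_{\rm PenMM}\big(\sqrt{2\rho}+\sqrt{L_0+\widehat M\Lambda}\big)+\tfrac{\sigma\sqrt{\bar\beta L_c}}{\sqrt\sigma-1},$$ $\widehat E=\lceil\log_{\gamma_1}\frac{\widehat L_\varepsilon}\rho\rceil$, $\bar E=\lceil\log_{\gamma_1}\frac{\bar L}\rho\rceil$, $\ell(L,\delta)=\max\Big\{1,\log\frac{2(1+\gamma_1)LD\sqrt{\gamma_1L/\rho+1}}\delta\Big\}$, $$T_{\rm iALM}=6\tau\sqrt{\gamma_1}(\sqrt\kappa K_{\rm iALM}+\widetilde C_\varepsilon)\,\ell(\widehat L_\varepsilon,\bar\varepsilon_1)+(3\widehat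 E+3)K_{\rm iALM},$$ $$T_{\rm PenMM}=6\tau\alpha_K\sqrt{\tfrac{\gamma_1}\rho}\,\ell(\bar L,\bar\varepsilon_2)+(3\bar E+3)K_{\rm PenMM}.$$ **Theorem.** Let Assumptions (1)–(4) and the above conditions on the inputs hold. Let $\varepsilon\in(0,\frac12]$ with $\widehat C_\varepsilon\ge1$ (for instance if $\beta_0\le4$), and take $\widehat\varepsilon_1=\varepsilon$ and $\widehat\varepsilon_2=\frac\varepsilon{2\sqrt2}\min\{1,\frac1{\sqrt\rho}\}$. Then, for every $x^0\in X$ and every choice of the initial points in $X$ of the iALM calls, HiAPeM terminates, its output $(x,p)$ is $\varepsilon$-KKT (so $x$ is an $\varepsilon$-KKT point of the problem), and it uses at most $$T_{\rm total}=(N_0+S)\lceil T_{\rm iALM}\rceil+(K_S-N_0-S)\lceil T_{\rm PenMM}\rceil$$ evaluations of gradients and function values. Moreover, with the problem and all other inputs fixed, $T_{\rm total}=O(\varepsilon^{-5/2}|\log\varepsilon|)$ as $\varepsilon\to0^+$. -/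

import Mathlib

open scoped Matrix InnerProductSpace Topology

noncomputable section

namespace HiAPeM

/-- Euclidean space of dimension `n`. -/
abbrev Vec (n : ℕ) := EuclideanSpace ℝ (Fin n)

/-- Dual variables `p = (y, z)`. -/
abbrev Dual (l m : ℕ) := Vec l × Vec m

/-- The Euclidean norm of `p = (y, z)` (the norm of the product type is the maximum norm). -/
def dualNorm {l m : ℕ} (p : Dual l m) : ℝ := Real.sqrt (‖p.1‖ ^ 2 + ‖p.2‖ ^ 2)

/-- Componentwise positive part `[v]₊`. -/
def posVec {m : ℕ} (v : Vec m) : Vec m := WithLp.toLp 2 (fun i => max (v i) 0)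

/-- The program `min g x + h x` subject to `A x = b`, `f i x ≤ 0`.  The extended-valued function
`h` is given by its effective domain `X` and by its finite values on `X`; the values of the
function `h` outside `X` play no role. -/
structure NLP (n l m : ℕ) where
  g : Vec n → ℝ
  X : Set (Vec n)
  h : Vec n → ℝ
  A : Matrix (Fin l) (Fin n) ℝ
  b : Vec l
  f : Fin m → Vec n → ℝ

/-- Subdifferential at `x` of the convex function equal to `h` on `X` and to `+∞` elsewhere. -/
def subdiff {n : ℕ} (X : Set (Vec n)) (h : Vec n → ℝ) (x : Vec n) : Set (Vec n) :=
  {v | x ∈ X ∧ ∀ u ∈ X, h x + ⟪v, u - x⟫_ℝ ≤ h u}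

/-- Normal cone of `X` at `x`. -/
def normalCone {n : ℕ} (X : Set (Vec n)) (x : Vec n) : Set (Vec n) :=
  {w | x ∈ X ∧ ∀ u ∈ X, ⟪w, u - x⟫_ℝ ≤ 0}

/-- The points `u + √γ₂ (u - v)` with `u, v ∈ X`: the region (containing `X`) in which the
extrapolated points of the accelerated proximal gradient method lie. -/
def extrapSet {n : ℕ} (X : Set (Vec n)) (γ₂ : ℝ) : Set (Vec n) :=
  {w | ∃ u ∈ X, ∃ v ∈ X, w = u + Real.sqrt γ₂ • (u - v)}

namespace NLP

variable {n l m : ℕ}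

/-- `A x - b`. -/
def res (P : NLP n l m) (x : Vec n) : Vec l := Matrix.toEuclideanLin P.A x - P.b

/-- `(f 1 x, …, f m x)`. -/
def fvec (P : NLP n l m) (x : Vec n) : Vec m := WithLp.toLp 2 (fun i => P.f i x)

/-- Smooth part of the classical augmented Lagrangian with penalty `β` and multipliers `p`;
adding `h` to it gives the augmented Lagrangian itself. -/
def augSmooth (P : NLP n l m) (β : ℝ) (p : Dual l m) (x : Vec n) : ℝ :=
  P.g x + ⟪p.1, P.res x⟫_ℝ + β / 2 * ‖P.res x‖ ^ 2
    + 1 / (2 * β) * (‖posVec (p.2 + β • P.fvec x)‖ ^ 2 - ‖p.2‖ ^ 2)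

/-- The proximal point subproblem with objective `g + h + ρ ‖x - c‖ ^ 2`. -/
def prox (P : NLP n l m) (ρ : ℝ) (c : Vec n) : NLP n l m :=
  { P with g := fun x => P.g x + ρ * ‖x - c‖ ^ 2 }

/-- `x` is an `ε`-KKT point and `p = (y, z)` is a multiplier that witnesses it.  Here
`∂(g + h) = ∇g + ∂h`.  The distance from `0` to `∂(g + h)(x) + Aᵀ y + ∑ zᵢ ∇fᵢ(x)` is a minimum
over a closed convex set; it is `≤ ε` iff some element of the set has norm `≤ ε` (in particular
the empty set is not within distance `ε`). -/
def IsKKTPair (P : NLP n l m) (ε : ℝ) (x : Vec n) (p : Dual l m) : Prop :=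
  x ∈ P.X ∧ (∀ i, 0 ≤ p.2 i) ∧
  Real.sqrt (‖P.res x‖ ^ 2 + ‖posVec (P.fvec x)‖ ^ 2) ≤ ε ∧
  (∃ v ∈ subdiff P.X P.h x,
    ‖gradient P.g x + v + Matrix.toEuclideanLin P.Aᵀ p.1
      + ∑ i, p.2 i • gradient (P.f i) x‖ ≤ ε) ∧
  ∑ i, |p.2 i * P.f i x| ≤ ε

/-- `x` is an `ε`-KKT point. -/
def IsKKTPoint (P : NLP n l m) (ε : ℝ) (x : Vec n) : Prop :=
  ∃ p : Dual l m, P.IsKKTPair ε x p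

/-- Multiplier update `(y + β (A x - b), [z + β f(x)]₊)`. -/
def dualStep (P : NLP n l m) (β : ℝ) (p : Dual l m) (x : Vec n) : Dual l m :=
  (p.1 + β • P.res x, posVec (p.2 + β • P.fvec x))

end NLP

/-! ### The adaptive accelerated proximal gradient method for `G + H`,
where `H` equals `h` on `X` and `+∞` elsewhere.

All procedures are big-step relations: the last arguments are the values returned and the number
of evaluations of the smooth part `G` and of its gradient.  A call that does not terminate is
related to nothing. -/

section APG

variable {n : ℕ}

/-- `x` minimizes `⟨∇G(y), ·⟩ + (L / 2) ‖· - y‖ ^ 2 + H`. -/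
def IsProxStep (G : Vec n → ℝ) (X : Set (Vec n)) (h : Vec n → ℝ) (y : Vec n) (L : ℝ)
    (x : Vec n) : Prop :=
  x ∈ X ∧ IsMinOn (fun u => ⟪gradient G y, u⟫_ℝ + L / 2 * ‖u - y‖ ^ 2 + h u) X x

/-- The test that ends a line search. -/
def Descent (G : Vec n → ℝ) (y : Vec n) (L : ℝ) (x : Vec n) : Prop :=
  G x ≤ G y + ⟪gradient G y, x - y⟫_ℝ + L / 2 * ‖x - y‖ ^ 2

/-- `dist(0, ∇G(x) + ∂H(x)) ≤ ε`. -/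
def Stationary (G : Vec n → ℝ) (X : Set (Vec n)) (h : Vec n → ℝ) (ε : ℝ) (x : Vec n) : Prop :=
  ∃ v ∈ subdiff X h x, ‖gradient G x + v‖ ≤ ε

/-- The initial line search from `w`, entered with estimate `L`, returns the final estimate and
point.  Each trial costs one evaluation, the value of `G` at the trial point. -/
inductive InitSearch (G : Vec n → ℝ) (X : Set (Vec n)) (h : Vec n → ℝ) (γ₁ : ℝ) (w : Vec n) :
    ℝ → ℝ → Vec n → ℕ → Prop
  | accept {L : ℝ} {x : Vec n} (hx : IsProxStep G X h w (γ₁ * L) x)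
      (hd : Descent G w (γ₁ * L) x) : InitSearch G X h γ₁ w L (γ₁ * L) x 1
  | reject {L L' : ℝ} {x x' : Vec n} {c : ℕ} (hx : IsProxStep G X h w (γ₁ * L) x)
      (hd : ¬ Descent G w (γ₁ * L) x) (hr : InitSearch G X h γ₁ w (γ₁ * L) L' x' c) :
      InitSearch G X h γ₁ w L L' x' (c + 1)

/-- The extrapolated point from the iterates `x`, `x'` (current, previous). -/
def extrap (x x' : Vec n) (α' α : ℝ) : Vec n :=
  x + (α * (1 - α') / (α' * (1 + α))) • (x - x')

/-- The accelerated line search with iterates `x`, `x'` (current, previous) and previous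
parameter `α'`; the first explicit argument of the relation is the estimate of the next trial.
It returns the new iterate, the accepted estimate and the new parameter.  Each trial costs three
evaluations: the gradient and the value of `G` at the extrapolated point, and the value of `G` at
the trial point. -/
inductive LineSearch (G : Vec n → ℝ) (X : Set (Vec n)) (h : Vec n → ℝ) (μ γ₁ : ℝ)
    (x x' : Vec n) (α' : ℝ) : ℝ → Vec n → ℝ → ℝ → ℕ → Prop
  | accept {L : ℝ} {u : Vec n}
      (hu : IsProxStep G X h (extrap x x' α' (Real.sqrt (μ / L))) L u)
      (hd : Descent G (extrap x x' α' (Real.sqrt (μ / L))) L u) :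
      LineSearch G X h μ γ₁ x x' α' L u L (Real.sqrt (μ / L)) 3
  | reject {L M α : ℝ} {u u' : Vec n} {c : ℕ}
      (hu : IsProxStep G X h (extrap x x' α' (Real.sqrt (μ / L))) L u)
      (hd : ¬ Descent G (extrap x x' α' (Real.sqrt (μ / L))) L u)
      (hr : LineSearch G X h μ γ₁ x x' α' (L * γ₁) u' M α c) :
      LineSearch G X h μ γ₁ x x' α' L u' M α (c + 3)

/-- The main loop, entered with current and previous iterates, estimate and previous
parameter. -/
inductive APGLoop (G : Vec n → ℝ) (X : Set (Vec n)) (h : Vec n → ℝ) (μ ε Lmin γ₁ γ₂ : ℝ) :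
    Vec n → Vec n → ℝ → ℝ → Vec n → ℕ → Prop
  | halt {x x' u : Vec n} {L α' M α : ℝ} {c : ℕ}
      (hl : LineSearch G X h μ γ₁ x x' α' L u M α c) (hs : Stationary G X h ε u) :
      APGLoop G X h μ ε Lmin γ₁ γ₂ x x' L α' u c
  | next {x x' u out : Vec n} {L α' M α : ℝ} {c c' : ℕ}
      (hl : LineSearch G X h μ γ₁ x x' α' L u M α c) (hs : ¬ Stationary G X h ε u)
      (hr : APGLoop G X h μ ε Lmin γ₁ γ₂ u x (max Lmin (M / γ₂)) α out c') :
      APGLoop G X h μ ε Lmin γ₁ γ₂ x x' L α' out (c + c')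

/-- The whole method started at `w`.  The two extra evaluations are the value and the gradient of
`G` at `w`. -/
inductive AdapAPG (G : Vec n → ℝ) (X : Set (Vec n)) (h : Vec n → ℝ) (w : Vec n)
    (μ ε Lmin γ₁ γ₂ : ℝ) : Vec n → ℕ → Prop
  | run {L : ℝ} {x out : Vec n} {c c' : ℕ} (hi : InitSearch G X h γ₁ w Lmin L x c)
      (hl : APGLoop G X h μ ε Lmin γ₁ γ₂ x x L 1 out c') :
      AdapAPG G X h w μ ε Lmin γ₁ γ₂ out (2 + c + c')

end APG

/-! ### The two subroutines and the hybrid method -/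

/-- Inputs of the hybrid method other than the tolerances. -/
structure Params where
  β₀ : ℝ
  σ : ℝ
  ρ : ℝ
  γ : ℝ
  γ₁ : ℝ
  γ₂ : ℝ
  Lmin : ℝ
  N₀ : ℕ
  N₁ : ℕ

variable {n l m : ℕ}

/-- Loop of the inexact augmented Lagrangian method with tolerance `ε` on a (strongly convex)
program `Q`, entered with the current primal point, multipliers and penalty parameter.  It returns
penalty parameter, primal point, multipliers, and the number of evaluations. -/
inductive IALMLoop (Q : NLP n l m) (q : Params) (ε : ℝ) :
    Vec n → Dual l m → ℝ → ℝ → Vec n → Dual l m → ℕ → Prop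
  | halt {x u : Vec n} {p : Dual l m} {β : ℝ} {c : ℕ}
      (ha : AdapAPG (Q.augSmooth β p) Q.X Q.h x q.ρ
        (Real.sqrt ((q.σ - 1) / (q.σ + 1)) * (ε / 2) * min 1 (Real.sqrt q.ρ))
        q.Lmin q.γ₁ q.γ₂ u c)
      (he : max ((dualNorm p + dualNorm (Q.dualStep β p u)) / β)
        (∑ i, |(Q.dualStep β p u).2 i * Q.f i u|) ≤ ε) :
      IALMLoop Q q ε x p β β u (Q.dualStep β p u) c
  | next {x u xo : Vec n} {p po : Dual l m} {β βo : ℝ} {c c' : ℕ}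
      (ha : AdapAPG (Q.augSmooth β p) Q.X Q.h x q.ρ
        (Real.sqrt ((q.σ - 1) / (q.σ + 1)) * (ε / 2) * min 1 (Real.sqrt q.ρ))
        q.Lmin q.γ₁ q.γ₂ u c)
      (he : ¬ max ((dualNorm p + dualNorm (Q.dualStep β p u)) / β)
        (∑ i, |(Q.dualStep β p u).2 i * Q.f i u|) ≤ ε)
      (hr : IALMLoop Q q ε u (Q.dualStep β p u) (q.σ * β) βo xo po c') :
      IALMLoop Q q ε x p β βo xo po (c + c')

/-- The inexact augmented Lagrangian method for the proximal subproblem with centre `xbar`,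
started from the primal point `x₀`, zero multipliers and penalty parameter `β₀`. -/
def IALM (P : NLP n l m) (q : Params) (ε : ℝ) (x₀ xbar : Vec n)
    (βo : ℝ) (xo : Vec n) (po : Dual l m) (c : ℕ) : Prop :=
  IALMLoop (P.prox q.ρ xbar) q ε x₀ 0 q.β₀ βo xo po c

/-- Loop of the penalty method with fixed estimated multipliers `pbar`.  State: current primal
point, multipliers, the penalty parameter to be returned, the penalty parameter used next. -/
inductive PenLoop (Q : NLP n l m) (q : Params) (ε : ℝ) (pbar : Dual l m) :
    Vec n → Dual l m → ℝ → ℝ → ℝ → Vec n → Dual l m → ℕ → Prop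
  | done {x : Vec n} {p : Dual l m} {β' β : ℝ} (hk : Q.IsKKTPair ε x p) :
      PenLoop Q q ε pbar x p β' β β' x p 0
  | step {x u xo : Vec n} {p po : Dual l m} {β' β βo : ℝ} {c c' : ℕ}
      (hk : ¬ Q.IsKKTPair ε x p)
      (ha : AdapAPG (Q.augSmooth β pbar) Q.X Q.h x q.ρ (ε * min 1 (Real.sqrt q.ρ))
        q.Lmin q.γ₁ q.γ₂ u c)
      (hr : PenLoop Q q ε pbar u (Q.dualStep β pbar u) β (q.σ * β) βo xo po c') :
      PenLoop Q q ε pbar x p β' β βo xo po (c + c')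

/-- The penalty method with estimated multipliers for the proximal subproblem with centre
`xbar`. -/
def PenMM (P : NLP n l m) (q : Params) (ε β : ℝ) (xbar : Vec n) (pbar : Dual l m)
    (βo : ℝ) (xo : Vec n) (po : Dual l m) (c : ℕ) : Prop :=
  PenLoop (P.prox q.ρ xbar) q ε pbar xbar pbar β β βo xo po c

/-- The stages of the hybrid method.  State: stage `s`, last index `K = K_s` of the stage,
iteration `k`, primal point, multipliers, penalty parameter and estimated multipliers of the
stage.  `init k` is the (freely chosen) initial primal point of the call of the inexact augmented
Lagrangian method in iteration `k`. -/
inductive StageLoop (P : NLP n l m) (q : Params) (ε ε₁ ε₂ : ℝ) (init : ℕ → Vec n) :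
    ℕ → ℕ → ℕ → Vec n → Dual l m → ℝ → Dual l m → Vec n → Dual l m → ℕ → Prop
  | done {s K k : ℕ} {x : Vec n} {p pbar : Dual l m} {β : ℝ} (hk : P.IsKKTPair ε x p) :
      StageLoop P q ε ε₁ ε₂ init s K k x p β pbar x p 0
  | penStop {s K k c : ℕ} {x u : Vec n} {p pbar pu : Dual l m} {β βu : ℝ}
      (hk : ¬ P.IsKKTPair ε x p)
      (hp : PenMM P q (ε₂ / 2) β x pbar βu u pu c)
      (hs : ‖u - x‖ ≤ ε / (4 * q.ρ)) :
      StageLoop P q ε ε₁ ε₂ init s K k x p β pbar u pu c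
  | penNext {s K k c c' : ℕ} {x u xo : Vec n} {p pbar pu po : Dual l m} {β βu : ℝ}
      (hk : ¬ P.IsKKTPair ε x p)
      (hp : PenMM P q (ε₂ / 2) β x pbar βu u pu c)
      (hs : ¬ ‖u - x‖ ≤ ε / (4 * q.ρ))
      (he : k + 2 ≠ K)
      (hr : StageLoop P q ε ε₁ ε₂ init s K (k + 1) u pu βu pbar xo po c') :
      StageLoop P q ε ε₁ ε₂ init s K k x p β pbar xo po (c + c')
  | ialmStop {s K k c c' : ℕ} {x u w : Vec n} {p pbar pu pw : Dual l m} {β βu βw : ℝ}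
      (hk : ¬ P.IsKKTPair ε x p)
      (hp : PenMM P q (ε₂ / 2) β x pbar βu u pu c)
      (hs : ¬ ‖u - x‖ ≤ ε / (4 * q.ρ))
      (he : k + 2 = K)
      (hi : IALM P q (ε₁ / 2) (init (k + 1)) u βw w pw c')
      (ht : ‖w - u‖ ≤ ε / (4 * q.ρ)) :
      StageLoop P q ε ε₁ ε₂ init s K k x p β pbar w pw (c + c')
  | ialmNext {s K k c c' c'' : ℕ} {x u w xo : Vec n} {p pbar pu pw po : Dual l m}
      {β βu βw : ℝ}
      (hk : ¬ P.IsKKTPair ε x p)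
      (hp : PenMM P q (ε₂ / 2) β x pbar βu u pu c)
      (hs : ¬ ‖u - x‖ ≤ ε / (4 * q.ρ))
      (he : k + 2 = K)
      (hi : IALM P q (ε₁ / 2) (init (k + 1)) u βw w pw c')
      (ht : ¬ ‖w - u‖ ≤ ε / (4 * q.ρ))
      (hr : StageLoop P q ε ε₁ ε₂ init (s + 1) (K + ⌈q.γ ^ s * q.N₁⌉₊) K w pw βw pw xo po c'') :
      StageLoop P q ε ε₁ ε₂ init s K k x p β pbar xo po (c + c' + c'')

/-- The initial stage of `N₀` calls of the inexact augmented Lagrangian method, entered in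
iteration `k < N₀` at the point `x`; it continues with the stages. -/
inductive InitStage (P : NLP n l m) (q : Params) (ε ε₁ ε₂ : ℝ) (init : ℕ → Vec n) :
    ℕ → Vec n → Vec n → Dual l m → ℕ → Prop
  | halt {k c : ℕ} {x u : Vec n} {pu : Dual l m} {βu : ℝ}
      (hi : IALM P q (ε₁ / 2) (init k) x βu u pu c)
      (hs : ‖u - x‖ ≤ ε / (4 * q.ρ)) :
      InitStage P q ε ε₁ ε₂ init k x u pu c
  | next {k c c' : ℕ} {x u xo : Vec n} {pu po : Dual l m} {βu : ℝ}
      (hi : IALM P q (ε₁ / 2) (init k) x βu u pu c)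
      (hs : ¬ ‖u - x‖ ≤ ε / (4 * q.ρ))
      (he : k + 1 < q.N₀)
      (hr : InitStage P q ε ε₁ ε₂ init (k + 1) u xo po c') :
      InitStage P q ε ε₁ ε₂ init k x xo po (c + c')
  | stages {k c c' : ℕ} {x u xo : Vec n} {pu po : Dual l m} {βu : ℝ}
      (hi : IALM P q (ε₁ / 2) (init k) x βu u pu c)
      (hs : ¬ ‖u - x‖ ≤ ε / (4 * q.ρ))
      (he : k + 1 = q.N₀)
      (hr : StageLoop P q ε ε₁ ε₂ init 1 (q.N₀ + q.N₁) q.N₀ u pu βu pu xo po c') :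
      InitStage P q ε ε₁ ε₂ init k x xo po (c + c')

/-- `Run P q ε ε₁ ε₂ init x₀ xo po c`: the hybrid method, started at `x₀`, stops with output
`(xo, po)` after `c` evaluations. -/
def Run (P : NLP n l m) (q : Params) (ε ε₁ ε₂ : ℝ) (init : ℕ → Vec n) (x₀ xo : Vec n)
    (po : Dual l m) (c : ℕ) : Prop :=
  InitStage P q ε ε₁ ε₂ init 0 x₀ xo po c

/-! ### Assumptions -/

/-- Constants of the problem: `L₀`, `L i` Lipschitz constants of the gradients, `B₀`, `B i`
bounds, `M` the radius in the condition on the subdifferential of `h`, and a Slater point. -/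
structure Consts (n m : ℕ) where
  L₀ : ℝ
  L : Fin m → ℝ
  B₀ : ℝ
  B : Fin m → ℝ
  M : ℝ
  xfeas : Vec n

/-- Composite structure and smooth constraints, with the constants `L₀`, `L i`, `B i`. -/
structure IsComposite (P : NLP n l m) (C : Consts n m) (q : Params) : Prop where
  h_convex : ConvexOn ℝ P.X P.h
  h_closed : IsClosed {w : Vec n × ℝ | w.1 ∈ P.X ∧ P.h w.1 ≤ w.2}
  bounded : Bornology.IsBounded P.X
  g_diff : Differentiable ℝ P.g
  f_convex : ∀ i, ConvexOn ℝ Set.univ (P.f i)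
  f_diff : ∀ i, Differentiable ℝ (P.f i)
  L₀_nonneg : 0 ≤ C.L₀
  L_nonneg : ∀ i, 0 ≤ C.L i
  g_lip : ∀ x ∈ extrapSet P.X q.γ₂, ∀ u ∈ extrapSet P.X q.γ₂,
    ‖gradient P.g x - gradient P.g u‖ ≤ C.L₀ * ‖x - u‖
  f_lip : ∀ i, ∀ x ∈ extrapSet P.X q.γ₂, ∀ u ∈ extrapSet P.X q.γ₂,
    ‖gradient (P.f i) x - gradient (P.f i) u‖ ≤ C.L i * ‖x - u‖
  f_bound : ∀ i, ∀ x ∈ extrapSet P.X q.γ₂, max |P.f i x| ‖gradient (P.f i) x‖ ≤ C.B i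

/-- Slater's condition. -/
structure IsSlater (P : NLP n l m) (x : Vec n) : Prop where
  mem : x ∈ interior P.X
  eq : P.res x = 0
  lt : ∀ i, P.f i x < 0

/-- `ρ`-weak convexity of the smooth part of the objective. -/
def IsWeaklyConvex (P : NLP n l m) (ρ : ℝ) : Prop :=
  ConvexOn ℝ Set.univ (fun x => P.g x + ρ / 2 * ‖x‖ ^ 2)

/-- `∂h ⊆ N_X + (ball of radius M)` on `X`, `A` has full row rank, and `B₀` bounds the objective
and the gradient of its smooth part on `X`. -/
structure IsUniformlyBounded (P : NLP n l m) (C : Consts n m) : Prop where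
  M_nonneg : 0 ≤ C.M
  subdiff_sub : ∀ x ∈ P.X, ∀ v ∈ subdiff P.X P.h x, ∃ w ∈ normalCone P.X x, ‖v - w‖ ≤ C.M
  full_rank : P.A.rank = l
  obj_bound : ∀ x ∈ P.X, max |P.g x + P.h x| ‖gradient P.g x‖ ≤ C.B₀

/-! ### The constants of the complexity bound -/

/-- Diameter of the domain of `h`. -/
def diamD (P : NLP n l m) : ℝ := Metric.diam P.X

/-- Largest eigenvalue of `A Aᵀ` (`0` if `A` has no rows). -/
def lamMax (P : NLP n l m) : ℝ :=
  ⨆ i, (Matrix.isHermitian_mul_conjTranspose_self P.A).eigenvalues i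

/-- Smallest eigenvalue of `A Aᵀ` (`0` if `A` has no rows). -/
def lamMin (P : NLP n l m) : ℝ :=
  ⨅ i, (Matrix.isHermitian_mul_conjTranspose_self P.A).eigenvalues i

/-- `min |f i|` at the Slater point.  If `m = 0` this is `0`, and so are the quotients by it below,
which is the convention that terms of the inequality constraints are absent. -/
def slaterGap (P : NLP n l m) (C : Consts n m) : ℝ := ⨅ i, |P.f i C.xfeas|

/-- Bound on the multipliers of the equality constraints (`0` if `l = 0`). -/
def My (P : NLP n l m) (C : Consts n m) (q : Params) : ℝ :=
  Real.sqrt (lamMax P) / lamMin P * (C.B₀ + 2 * q.ρ * diamD P + C.M)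
    * (1 + diamD P / Metric.infDist C.xfeas (frontier P.X)
        + diamD P * (⨆ i, C.B i) / slaterGap P C)

/-- Bound on the multipliers of the inequality constraints (`0` if `m = 0`). -/
def Mz (P : NLP n l m) (C : Consts n m) (q : Params) : ℝ :=
  diamD P * (C.B₀ + q.ρ * diamD P + C.M) / slaterGap P C

def Mp (P : NLP n l m) (C : Consts n m) (q : Params) : ℝ :=
  Real.sqrt (My P C q ^ 2 + Mz P C q ^ 2)

/-- `M̂`. -/
def Mhat (P : NLP n l m) (C : Consts n m) (q : Params) : ℝ :=
  2 * Mp P C q + Real.sqrt q.σ *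
    max (Real.sqrt 5 / 2 * Mp P C q) (max (Real.sqrt (Mp P C q)) (1 / (2 * Real.sqrt 2)))

/-- `Ĉ`. -/
def Chat (P : NLP n l m) (C : Consts n m) (q : Params) : ℝ :=
  max (16 * Real.sqrt 2 * (3 * Mp P C q ^ 2 + 2 * Mhat P C q ^ 2) / min 1 (1 / Real.sqrt q.ρ))
    (max (16 * Real.sqrt 2 * (Mp P C q + Mhat P C q) / min 1 (1 / Real.sqrt q.ρ)) 4)

/-- `C̃`. -/
def Ctil (P : NLP n l m) (C : Consts n m) (q : Params) (ε : ℝ) : ℝ :=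
  max (96 * q.ρ * (q.γ - 1) / (q.N₁ * Real.log q.γ)
      * (1 / 2 + diamD P / 2 + 9 * Mhat P C q / 4 + Chat P C q * q.σ / 4))
    (ε * Real.exp 1)

/-- `K_s = N₀ + N₁ + ⌈γ N₁⌉ + … + ⌈γ ^ (s - 1) N₁⌉`. -/
def stageEnd (q : Params) (s : ℕ) : ℕ := q.N₀ + ∑ j ∈ Finset.range s, ⌈q.γ ^ j * q.N₁⌉₊

/-- The condition on the number of stages. -/
def StageCond (P : NLP n l m) (C : Consts n m) (q : Params) (ε : ℝ) (S : ℕ) : Prop :=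
  (q.N₀ + q.N₁ * ((q.γ ^ S - 1) / (q.γ - 1)) : ℝ) ≤ stageEnd q S ∧
  96 * q.ρ * C.B₀ / ε ^ 2 + 48 * q.ρ * q.N₀ * (diamD P / 2 + Mhat P C q) / ε
    ≤ (q.N₀ + q.N₁ * ((q.γ ^ S - 1) / (q.γ - 1)) : ℝ) ∧
  2 * (Ctil P C q ε / ε) * Real.log (Ctil P C q ε / ε) ≤ q.γ ^ S

/-- `S`, the least number that satisfies the condition. -/
def stageNum (P : NLP n l m) (C : Consts n m) (q : Params) (ε : ℝ) : ℕ :=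
  sInf {S : ℕ | StageCond P C q ε S}

/-- `√(L₁² + ⋯ + L_m²)`. -/
def Lsum (C : Consts n m) : ℝ := Real.sqrt (∑ i, C.L i ^ 2)

/-- `L_c = ‖Aᵀ A‖ + ∑ Bᵢ (Bᵢ + Lᵢ)` with the spectral norm. -/
def Lc (P : NLP n l m) (C : Consts n m) : ℝ :=
  ‖Matrix.toEuclideanCLM (𝕜 := ℝ) (P.Aᵀ * P.A)‖ + ∑ i, C.B i * (C.B i + C.L i)

/-- `1 + ⌈log_{γ₁} γ₂⌉`: bound on the average number of line search trials per iteration. -/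
def trials (q : Params) : ℝ := 1 + ⌈Real.logb q.γ₁ q.γ₂⌉

/-- `Ĉ_ε`. -/
def ChatEps (P : NLP n l m) (C : Consts n m) (q : Params) (ε : ℝ) : ℝ :=
  max (20 * Mp P C q ^ 2 / (q.β₀ * ε)) (max (16 * Mp P C q / (q.β₀ * ε)) (4 / q.β₀))

/-- `K_iALM`. -/
def Kialm (P : NLP n l m) (C : Consts n m) (q : Params) (ε : ℝ) : ℤ :=
  ⌈Real.logb q.σ (ChatEps P C q ε)⌉ + 1

/-- `κ`. -/
def kappa (P : NLP n l m) (C : Consts n m) (q : Params) : ℝ :=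
  (C.L₀ + 2 * q.ρ + 2 * Mp P C q * Lsum C) / q.ρ

/-- `L̂_ε`. -/
def LhatEps (P : NLP n l m) (C : Consts n m) (q : Params) (ε : ℝ) : ℝ :=
  C.L₀ + 2 * q.ρ + q.β₀ * q.σ * Lc P C * ChatEps P C q ε
    + Lsum C * (2 * Mp P C q
        + ε / (2 * Real.sqrt 2) * Real.sqrt (q.β₀ * ChatEps P C q ε))

/-- `C̃_ε`. -/
def CtilEps (P : NLP n l m) (C : Consts n m) (q : Params) (ε : ℝ) : ℝ :=
  Real.sqrt (q.β₀ * Lc P C * q.σ ^ 2 * ChatEps P C q ε)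
      / (Real.sqrt q.ρ * (Real.sqrt q.σ - 1))
    + Real.sqrt (Lsum C * (ε * Real.sqrt q.β₀ / Real.sqrt (2 * q.σ)))
      * (Real.sqrt q.σ * ChatEps P C q ε ^ (1 / 4 : ℝ)
        / (Real.sqrt q.ρ * (q.σ ^ (1 / 4 : ℝ) - 1)))

/-- The stationarity tolerance in the calls of the inexact augmented Lagrangian method. -/
def epsBar₁ (q : Params) (ε : ℝ) : ℝ :=
  Real.sqrt ((q.σ - 1) / (q.σ + 1)) * (ε / 4) * min 1 (Real.sqrt q.ρ)

/-- The stationarity tolerance in the calls of the penalty method. -/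
def epsBar₂ (q : Params) (ε : ℝ) : ℝ :=
  ε / (4 * Real.sqrt 2) * min (Real.sqrt q.ρ) (1 / Real.sqrt q.ρ)

/-- The maximum of `1` and `log (2 (1 + γ₁) Λ D √(γ₁ Λ / ρ + 1) / δ)`. -/
def logTerm (P : NLP n l m) (q : Params) (Λ δ : ℝ) : ℝ :=
  max 1 (Real.log
    (2 * (1 + q.γ₁) * Λ * diamD P * Real.sqrt (q.γ₁ * Λ / q.ρ + 1) / δ))

/-- `T_iALM`. -/
def Tialm (P : NLP n l m) (C : Consts n m) (q : Params) (ε : ℝ) : ℝ :=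
  6 * trials q * Real.sqrt q.γ₁
      * (Real.sqrt (kappa P C q) * Kialm P C q ε + CtilEps P C q ε)
      * logTerm P q (LhatEps P C q ε) (epsBar₁ q ε)
    + (3 * ⌈Real.logb q.γ₁ (LhatEps P C q ε / q.ρ)⌉ + 3) * Kialm P C q ε

/-- `β̄`. -/
def betaBar (P : NLP n l m) (C : Consts n m) (q : Params) (ε : ℝ) : ℝ :=
  max (16 * Real.sqrt 2 * (3 * Mp P C q ^ 2 + 2 * Mhat P C q ^ 2)
      / (ε * min 1 (1 / Real.sqrt q.ρ)))
    (max (16 * Real.sqrt 2 * (Mp P C q + Mhat P C q) / (ε * min 1 (1 / Real.sqrt q.ρ))) 8)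

/-- `K_PenMM`. -/
def Kpen (P : NLP n l m) (C : Consts n m) (q : Params) (ε : ℝ) : ℤ :=
  ⌈Real.logb q.σ (betaBar P C q ε / q.β₀)⌉ + 1

/-- `L̄`. -/
def Lbar (P : NLP n l m) (C : Consts n m) (q : Params) (ε : ℝ) : ℝ :=
  C.L₀ + 2 * q.ρ + Lc P C * q.σ * betaBar P C q ε + Mhat P C q * Lsum C

/-- `α_K`. -/
def alphaK (P : NLP n l m) (C : Consts n m) (q : Params) (ε : ℝ) : ℝ :=
  Kpen P C q ε * Real.sqrt (2 * q.ρ)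
    + Kpen P C q ε * Real.sqrt (C.L₀ + Mhat P C q * Lsum C)
    + q.σ * Real.sqrt (betaBar P C q ε * Lc P C) / (Real.sqrt q.σ - 1)

/-- `T_PenMM`. -/
def Tpen (P : NLP n l m) (C : Consts n m) (q : Params) (ε : ℝ) : ℝ :=
  6 * trials q * alphaK P C q ε * Real.sqrt (q.γ₁ / q.ρ)
      * logTerm P q (Lbar P C q ε) (epsBar₂ q ε)
    + (3 * ⌈Real.logb q.γ₁ (Lbar P C q ε / q.ρ)⌉ + 3) * Kpen P C q ε

/-- `T_total = (N₀ + S) ⌈T_iALM⌉ + (K_S - N₀ - S) ⌈T_PenMM⌉`. -/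
def Ttotal (P : NLP n l m) (C : Consts n m) (q : Params) (ε : ℝ) : ℤ :=
  ((q.N₀ : ℤ) + stageNum P C q ε) * ⌈Tialm P C q ε⌉
    + ((stageEnd q (stageNum P C q ε) : ℤ) - q.N₀ - stageNum P C q ε) * ⌈Tpen P C q ε⌉

end HiAPeM

end

/-!
The objective is made strongly convex by the proximal term, so each call of a subroutine solves
(approximately) a convex program with a saddle point whose multipliers are bounded by Slater's
condition.  The proof combines three ingredients.

*Inner solver.*  For a `μ`-strongly convex smooth part whose gradient is `L`-Lipschitz on the
extrapolation region, the energy `F(x) - F* + (μ/2) ‖z - x*‖²` contracts by the factor `1 - √(μ/M)`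
in an iteration with accepted estimate `M ≤ γ₁ L`.  The stationarity residual is bounded by the
energy, and the trials of the line searches are amortized by the evolution of the estimate; together
this is `ApgModel.adapAPG_spec`.

*Subroutines.*  An inexact multiplier step is an inexact proximal point step for the dual problem
(`Setting.dual_contraction`), so the distance of the multipliers to those of a saddle point
(`Setting.exists_saddle`) is controlled.  As `‖p' - p‖ / β` bounds the infeasibility, and with
`‖p'‖` the complementarity, both subroutines stop once the penalty parameter is of order `1/ε`.
The condition numbers grow geometrically along the calls of the inner solver, so that the square
roots of them sum up to a multiple of the last one (`Setting.ialm_spec`, `Setting.penMM_spec`).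

*Outer loop.*  Within a stage the estimated multipliers are fixed, and an iteration that does not
stop moves the centre by more than `ε/(4ρ)`, which decreases the objective plus penalty terms by
`3ε²/(64ρ)`.  The penalty terms themselves may grow with the penalty parameter, but the increase
telescopes over the stage (`Setting.StageInv`, `NLP.penalty_sub_le`), so that a whole stage loses only
`O(ε)`.  The lengths of the stages grow geometrically, hence after `S` stages the decrease exceeds
the variation of the objective plus all losses (`Setting.budget_lt`); the method stops before.
Counting the calls gives the bound `T_total`, and the minimality of `S` gives
`γ ^ S = O(ε⁻²)`, hence the order of the bound (`Setting.Ttotal_isBigO`).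
-/

open scoped Matrix InnerProductSpace Topology

namespace HiAPeM

/-! ### Differentiable convex functions and proximal steps -/

section ConvexTools

variable {n : ℕ}

lemma hasDerivAt_comp_line {φ : Vec n → ℝ} (hd : Differentiable ℝ φ) (x d : Vec n) (t : ℝ) :
    HasDerivAt (fun s : ℝ => φ (x + s • d)) ⟪gradient φ (x + t • d), d⟫_ℝ t := by
  have h1 : HasDerivAt (fun s : ℝ => x + s • d) d t := by
    simpa using ((hasDerivAt_id t).smul_const d).const_add x
  have h2 := (hd (x + t • d)).hasGradientAt.hasFDerivAt.comp_hasDerivAt t h1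
  rw [InnerProductSpace.toDual_apply_apply] at h2
  exact h2

lemma ConvexOn.add_inner_gradient_le {φ : Vec n → ℝ} (hc : ConvexOn ℝ Set.univ φ)
    (hd : Differentiable ℝ φ) (x u : Vec n) : φ x + ⟪gradient φ x, u - x⟫_ℝ ≤ φ u := by
  have h := hasDerivAt_comp_line hd x (u - x) 0
  have hline : ConvexOn ℝ Set.univ (fun s : ℝ => φ (x + s • (u - x))) := by
    have := hc.comp_affineMap (AffineMap.lineMap x u : ℝ →ᵃ[ℝ] Vec n)
    simp only [Set.preimage_univ] at this
    refine this.congr fun s _ => ?_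
    simp [AffineMap.lineMap_apply, add_comm]
  have h3 := hline.le_slope_of_hasDerivAt (Set.mem_univ 0) (Set.mem_univ 1) one_pos h
  simp only [slope_def_field, zero_smul, add_zero, one_smul, sub_zero, div_one,
    add_sub_cancel] at h3
  linarith

/-- The descent lemma on a convex set. -/
lemma le_quadratic_of_lipschitz_gradient {φ : Vec n → ℝ} (hd : Differentiable ℝ φ)
    {s : Set (Vec n)} (hs : Convex ℝ s) {L : ℝ}
    (hL : ∀ x ∈ s, ∀ u ∈ s, ‖gradient φ x - gradient φ u‖ ≤ L * ‖x - u‖)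
    {v x : Vec n} (hv : v ∈ s) (hx : x ∈ s) :
    φ x ≤ φ v + ⟪gradient φ v, x - v⟫_ℝ + L / 2 * ‖x - v‖ ^ 2 := by
  set d := x - v with hdd
  have hmem : ∀ t ∈ Set.Icc (0 : ℝ) 1, v + t • d ∈ s := by
    intro t ht
    have := hs.add_smul_sub_mem hv hx ht
    simpa [hdd] using this
  have hB : ∀ t : ℝ, HasDerivAt (fun t : ℝ => φ v + t * ⟪gradient φ v, d⟫_ℝ + L / 2 * t ^ 2 * ‖d‖ ^ 2)
      (⟪gradient φ v, d⟫_ℝ + L * t * ‖d‖ ^ 2) t := by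
    intro t
    have h1 := ((hasDerivAt_id' t).mul_const ⟪gradient φ v, d⟫_ℝ).const_add (φ v)
    have h2 := (((hasDerivAt_pow 2 t).const_mul (L / 2)).mul_const (‖d‖ ^ 2))
    exact (h1.add h2).congr_deriv (by push_cast; ring)
  have key := image_le_of_deriv_right_le_deriv_boundary (a := (0 : ℝ)) (b := 1)
    (f := fun t : ℝ => φ (v + t • d)) (f' := fun t => ⟪gradient φ (v + t • d), d⟫_ℝ)
    (B := fun t : ℝ => φ v + t * ⟪gradient φ v, d⟫_ℝ + L / 2 * t ^ 2 * ‖d‖ ^ 2)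
    (B' := fun t => ⟪gradient φ v, d⟫_ℝ + L * t * ‖d‖ ^ 2)
    (fun t _ => (hasDerivAt_comp_line hd v d t).continuousAt.continuousWithinAt)
    (fun t _ => (hasDerivAt_comp_line hd v d t).hasDerivWithinAt) (by simp)
    (fun t _ => (hB t).continuousAt.continuousWithinAt)
    (fun t _ => (hB t).hasDerivWithinAt) ?_ (x := 1) (by simp)
  · have : v + (1 : ℝ) • d = x := by simp [hdd]
    simp only [this] at key
    linarith
  · intro t ht
    have h1 := hL _ (hmem t ⟨ht.1, ht.2.le⟩) v hv
    have h2 : ‖v + t • d - v‖ = t * ‖d‖ := by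
      rw [add_sub_cancel_left, norm_smul, Real.norm_of_nonneg ht.1]
    rw [h2] at h1
    have h3 : ⟪gradient φ (v + t • d) - gradient φ v, d⟫_ℝ ≤ L * (t * ‖d‖) * ‖d‖ :=
      (real_inner_le_norm _ _).trans (mul_le_mul_of_nonneg_right h1 (norm_nonneg _))
    rw [inner_sub_left] at h3
    show ⟪gradient φ (v + t • d), d⟫_ℝ ≤ _
    nlinarith

/-- If `x` minimizes `φ + h` over `X` and `φ` lies below a parabola that touches it at `x` with
slope `a`, then `-a` is a subgradient of `h` at `x`. -/
lemma neg_mem_subdiff_of_isMinOn {X : Set (Vec n)} {h φ : Vec n → ℝ} (hh : ConvexOn ℝ X h)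
    {x a : Vec n} {c : ℝ} (hx : x ∈ X) (hmin : ∀ u ∈ X, φ x + h x ≤ φ u + h u)
    (hup : ∀ u ∈ X, φ u ≤ φ x + ⟪a, u - x⟫_ℝ + c * ‖u - x‖ ^ 2) : -a ∈ subdiff X h x := by
  refine ⟨hx, fun u hu => ?_⟩
  rw [inner_neg_left]
  have key : ∀ t : ℝ, t ∈ Set.Ioo (0 : ℝ) 1 →
      0 ≤ (⟪a, u - x⟫_ℝ + h u - h x) + t * (c * ‖u - x‖ ^ 2) := by
    intro t ht
    have hmem : x + t • (u - x) ∈ X := hh.1.add_smul_sub_mem hx hu ⟨ht.1.le, ht.2.le⟩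
    have h1 := hmin _ hmem
    have h2 := hup _ hmem
    have h3 := hh.2 hx hu (sub_nonneg.2 ht.2.le) ht.1.le (by ring)
    have h4 : (1 - t) • x + t • u = x + t • (u - x) := by module
    rw [h4] at h3
    rw [add_sub_cancel_left, inner_smul_right, norm_smul, Real.norm_of_nonneg ht.1.le] at h2
    simp only [smul_eq_mul] at h3
    have h5 : 0 ≤ t * ((⟪a, u - x⟫_ℝ + h u - h x) + t * (c * ‖u - x‖ ^ 2)) := by nlinarith
    exact nonneg_of_mul_nonneg_right h5 ht.1
  have hlim : Filter.Tendsto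
      (fun t : ℝ => (⟪a, u - x⟫_ℝ + h u - h x) + t * (c * ‖u - x‖ ^ 2)) (𝓝[>] 0)
      (𝓝 ((⟪a, u - x⟫_ℝ + h u - h x) + 0 * (c * ‖u - x‖ ^ 2))) := by
    apply Filter.Tendsto.mono_left _ nhdsWithin_le_nhds
    apply Continuous.tendsto'
    · fun_prop
    · rfl
  have := ge_of_tendsto hlim (by
    filter_upwards [Ioo_mem_nhdsGT one_pos] with t ht using key t ht)
  linarith

lemma inner_add_quadratic_expand (a v x u : Vec n) (L : ℝ) :
    ⟪a, u⟫_ℝ + L / 2 * ‖u - v‖ ^ 2 = ⟪a, x⟫_ℝ + L / 2 * ‖x - v‖ ^ 2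
      + ⟪a + L • (x - v), u - x⟫_ℝ + L / 2 * ‖u - x‖ ^ 2 := by
  have h1 : u - v = (x - v) + (u - x) := by abel
  rw [h1, norm_add_sq_real, inner_add_left, inner_smul_left, inner_sub_right a]
  simp
  ring

lemma IsProxStep.neg_mem_subdiff {G : Vec n → ℝ} {X : Set (Vec n)} {h : Vec n → ℝ}
    (hh : ConvexOn ℝ X h) {v x : Vec n} {L : ℝ} (hp : IsProxStep G X h v L x) :
    -(gradient G v + L • (x - v)) ∈ subdiff X h x := by
  refine neg_mem_subdiff_of_isMinOn (φ := fun u => ⟪gradient G v, u⟫_ℝ + L / 2 * ‖u - v‖ ^ 2)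
    (c := L / 2) hh hp.1 (fun u hu => hp.2 hu) fun u _ => ?_
  exact (inner_add_quadratic_expand _ v x u L).le

/-- Existence of minimizers of `φ + h` over a compact domain. -/
lemma exists_forall_add_le {X : Set (Vec n)} {h φ : Vec n → ℝ} (hX : IsCompact X)
    (hne : X.Nonempty) (hlsc : LowerSemicontinuousOn h X) (hφ : Continuous φ) :
    ∃ x ∈ X, ∀ u ∈ X, φ x + h x ≤ φ u + h u := by
  have : LowerSemicontinuousOn (fun u => φ u + h u) X :=
    (hφ.lowerSemicontinuous.lowerSemicontinuousOn X).add hlsc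
  obtain ⟨x, hx, hmin⟩ := this.exists_isMinOn hne hX
  exact ⟨x, hx, fun u hu => hmin hu⟩

end ConvexTools

/-! ### The adaptive accelerated proximal gradient method -/

section APGAnalysis

variable {n : ℕ}

/-- A composite function `G + h` on `X` to which the accelerated method applies: `G` is
`μ`-strongly convex, satisfies the descent inequality and has an `L`-Lipschitz gradient between
points of the extrapolation region and points of `X`, the proximal steps exist, `G + h` attains its
minimum `xs`, and `X` has diameter at most `D`. -/
structure ApgModel (G : Vec n → ℝ) (X : Set (Vec n)) (h : Vec n → ℝ) (xs : Vec n)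
    (μ L Lmin γ₁ γ₂ D : ℝ) : Prop where
  μ_pos : 0 < μ
  μ_le : μ ≤ Lmin
  le_L : Lmin ≤ L
  one_lt_γ₁ : 1 < γ₁
  one_le_γ₂ : 1 ≤ γ₂
  h_convex : ConvexOn ℝ X h
  strong : ∀ v u, G v + ⟪gradient G v, u - v⟫_ℝ + μ / 2 * ‖u - v‖ ^ 2 ≤ G u
  upper : ∀ v ∈ extrapSet X γ₂, ∀ u ∈ X,
    G u ≤ G v + ⟪gradient G v, u - v⟫_ℝ + L / 2 * ‖u - v‖ ^ 2
  lip : ∀ v ∈ extrapSet X γ₂, ∀ u ∈ X, ‖gradient G u - gradient G v‖ ≤ L * ‖u - v‖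
  prox : ∀ (v : Vec n) (M : ℝ), 0 < M → ∃ u, IsProxStep G X h v M u
  min_mem : xs ∈ X
  min_le : ∀ u ∈ X, G xs + h xs ≤ G u + h u
  diam : ∀ u ∈ X, ∀ v ∈ X, ‖u - v‖ ≤ D

lemma mem_extrapSet_of_mem {X : Set (Vec n)} {γ₂ : ℝ} {x : Vec n} (hx : x ∈ X) :
    x ∈ extrapSet X γ₂ := ⟨x, hx, x, hx, by simp⟩

lemma add_smul_sub_mem_extrapSet {X : Set (Vec n)} (hX : Convex ℝ X) {γ₂ t : ℝ} (hγ : 1 ≤ γ₂)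
    {x x' : Vec n} (hx : x ∈ X) (hx' : x' ∈ X) (ht : 0 ≤ t) (ht' : t ≤ Real.sqrt γ₂) :
    x + t • (x - x') ∈ extrapSet X γ₂ := by
  have hs : 0 < Real.sqrt γ₂ := Real.sqrt_pos.2 (by linarith)
  refine ⟨x, hx, x + (t / Real.sqrt γ₂) • (x' - x), hX.add_smul_sub_mem hx hx'
    ⟨by positivity, (div_le_one hs).2 ht'⟩, ?_⟩
  have : x - (x + (t / Real.sqrt γ₂) • (x' - x)) = (t / Real.sqrt γ₂) • (x - x') := by module
  rw [this, smul_smul, mul_div_cancel₀ _ hs.ne']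

lemma convex_extrapSet {X : Set (Vec n)} (hX : Convex ℝ X) (γ₂ : ℝ) :
    Convex ℝ (extrapSet X γ₂) := by
  rintro _ ⟨u, hu, v, hv, rfl⟩ _ ⟨u', hu', v', hv', rfl⟩ a b ha hb hab
  exact ⟨a • u + b • u', hX hu hu' ha hb hab, a • v + b • v', hX hv hv' ha hb hab, by module⟩

namespace ApgModel

variable {G : Vec n → ℝ} {X : Set (Vec n)} {h : Vec n → ℝ} {xs : Vec n}
  {μ L Lmin γ₁ γ₂ D : ℝ}

lemma L_pos (H : ApgModel G X h xs μ L Lmin γ₁ γ₂ D) : 0 < L :=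
  H.μ_pos.trans_le (H.μ_le.trans H.le_L)

/-- The basic inequality of an accepted proximal step. -/
lemma prox_ineq (H : ApgModel G X h xs μ L Lmin γ₁ γ₂ D) {v x u : Vec n} {M : ℝ}
    (hp : IsProxStep G X h v M x) (hd : Descent G v M x) (hu : u ∈ X) :
    G x + h x - M / 2 * ‖u - v‖ ^ 2 + M / 2 * ‖u - x‖ ^ 2 + μ / 2 * ‖u - v‖ ^ 2 ≤ G u + h u := by
  have h1 := (hp.neg_mem_subdiff H.h_convex).2 u hu
  have h2 := inner_add_quadratic_expand (gradient G v) v x u M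
  have h3 := H.strong v u
  unfold Descent at hd
  rw [inner_neg_left] at h1
  rw [inner_sub_right] at h3 hd
  linarith

lemma quadratic_growth (H : ApgModel G X h xs μ L Lmin γ₁ γ₂ D) {x : Vec n} (hx : x ∈ X) :
    μ / 2 * ‖x - xs‖ ^ 2 ≤ G x + h x - (G xs + h xs) := by
  have h1 := neg_mem_subdiff_of_isMinOn (a := gradient G xs) (c := L / 2) H.h_convex H.min_mem
    H.min_le (fun u hu => H.upper xs (mem_extrapSet_of_mem H.min_mem) u hu)
  have h2 := h1.2 x hx
  have h3 := H.strong xs x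
  rw [inner_neg_left] at h2
  linarith

/-- The Lyapunov function of the method. -/
noncomputable def energy (G h : Vec n → ℝ) (xs : Vec n) (μ : ℝ) (x z : Vec n) : ℝ :=
  G x + h x - (G xs + h xs) + μ / 2 * ‖z - xs‖ ^ 2

lemma energy_nonneg (H : ApgModel G X h xs μ L Lmin γ₁ γ₂ D) {x : Vec n} (hx : x ∈ X)
    (z : Vec n) : 0 ≤ energy G h xs μ x z := by
  have h1 := H.min_le x hx
  have := H.μ_pos
  unfold energy
  have : 0 ≤ μ / 2 * ‖z - xs‖ ^ 2 := by positivity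
  linarith

/-- One accelerated step contracts the energy by the factor `1 - α`, where `α ^ 2 M = μ`. -/
lemma energy_step (H : ApgModel G X h xs μ L Lmin γ₁ γ₂ D) {x z v u : Vec n} {M α : ℝ}
    (hx : x ∈ X) (hα : 0 < α) (hα1 : α ≤ 1) (hM : M * α ^ 2 = μ)
    (hv : v = (1 / (1 + α)) • (x + α • z)) (hp : IsProxStep G X h v M u) (hd : Descent G v M u) :
    energy G h xs μ u (x + (1 / α) • (u - x)) ≤ (1 - α) * energy G h xs μ x z := by
  have hXc : Convex ℝ X := H.h_convex.1
  have hμ := H.μ_pos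
  -- the comparison point of the proximal inequality
  set w := (1 - α) • x + α • xs with hw
  have hwX : w ∈ X := hXc hx H.min_mem (by linarith) hα.le (by ring)
  have h1 := H.prox_ineq hp hd hwX
  -- strong convexity of `G + h` along the segment from `x` to `xs`
  have h2 : G w + h w ≤ (1 - α) * (G x + h x) + α * (G xs + h xs)
      - μ / 2 * (α * (1 - α) * ‖x - xs‖ ^ 2) := by
    have a1 := H.strong w x
    have a2 := H.strong w xs
    have a3 := H.h_convex.2 hx H.min_mem (by linarith : 0 ≤ 1 - α) hα.le (by ring)
    rw [← hw] at a3
    have e1 : x - w = α • (x - xs) := by rw [hw]; module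
    have e2 : xs - w = -(1 - α) • (x - xs) := by rw [hw]; module
    rw [e1, inner_smul_right, norm_smul, Real.norm_of_nonneg hα.le] at a1
    rw [e2, inner_smul_right, norm_smul, norm_neg, Real.norm_of_nonneg (by linarith)] at a2
    simp only [smul_eq_mul] at a3
    have b1 := mul_le_mul_of_nonneg_left a1 (by linarith : 0 ≤ 1 - α)
    have b2 := mul_le_mul_of_nonneg_left a2 hα.le
    nlinarith
  have h3 : M / 2 * ‖w - u‖ ^ 2 = μ / 2 * ‖x + (1 / α) • (u - x) - xs‖ ^ 2 := by
    have e : w - u = -(α • (x + (1 / α) • (u - x) - xs)) := by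
      have : α • ((1 / α) • (u - x)) = u - x := by
        rw [smul_smul, mul_one_div_cancel hα.ne', one_smul]
      rw [smul_sub, smul_add, this, hw]; module
    rw [e, norm_neg, norm_smul, Real.norm_of_nonneg hα.le, ← hM]; ring
  have h4 : (M - μ) * ‖w - v‖ ^ 2
      ≤ μ * (1 - α) * (α * ‖x - xs‖ ^ 2 + ‖z - xs‖ ^ 2) := by
    have e : w - v = (-(α / (1 + α))) • (α • (x - xs) + (z - xs)) := by
      have h1α : (1 + α) ≠ 0 := by positivity
      rw [hw, hv]
      have : (1 / (1 + α)) = 1 - α / (1 + α) := by field_simp; ring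
      have h' : α * (1 / (1 + α)) = α / (1 + α) := by ring
      have h'' : α / (1 + α) * α = α - α / (1 + α) := by field_simp; ring
      rw [smul_add (1 / (1 + α)), smul_smul (1 / (1 + α)), mul_comm (1 / (1 + α)) α, h', this,
        smul_add, smul_smul, neg_mul, h'']
      module
    have hc : ‖α • (x - xs) + (z - xs)‖ ^ 2 ≤ (1 + α) * (α * ‖x - xs‖ ^ 2 + ‖z - xs‖ ^ 2) := by
      have hi : ‖x - xs - (z - xs)‖ ^ 2 = ‖x - xs‖ ^ 2 - 2 * ⟪x - xs, z - xs⟫_ℝ + ‖z - xs‖ ^ 2 :=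
        norm_sub_sq_real _ _
      rw [norm_add_sq_real, inner_smul_left, norm_smul, Real.norm_of_nonneg hα.le]
      simp only [conj_trivial]
      nlinarith [sq_nonneg (‖x - xs - (z - xs)‖)]
    rw [e, norm_smul, norm_neg, Real.norm_of_nonneg (by positivity), mul_pow]
    have e2 : (M - μ) * ((α / (1 + α)) ^ 2 * ‖α • (x - xs) + (z - xs)‖ ^ 2)
        = μ * (1 - α) / (1 + α) * ‖α • (x - xs) + (z - xs)‖ ^ 2 := by
      rw [← hM]; field_simp; ring
    rw [e2]
    have h0 : 0 ≤ μ * (1 - α) / (1 + α) :=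
      div_nonneg (mul_nonneg hμ.le (by linarith)) (by positivity)
    refine (mul_le_mul_of_nonneg_left hc h0).trans (le_of_eq ?_)
    field_simp
  unfold energy
  nlinarith

/-- An accepted step yields a subgradient whose size is controlled by the energy before it. -/
lemma residual_step (H : ApgModel G X h xs μ L Lmin γ₁ γ₂ D) {x z v u : Vec n} {M α e : ℝ}
    (hx : x ∈ X) (hα : 0 < α) (hα1 : α ≤ 1) (hM : M * α ^ 2 = μ) (hML : M ≤ γ₁ * L)
    (hv : v = (1 / (1 + α)) • (x + α • z)) (hvX : v ∈ extrapSet X γ₂)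
    (hp : IsProxStep G X h v M u) (hd : Descent G v M u) (he : energy G h xs μ x z ≤ e)
    {δ : ℝ} (hδ : 0 < δ) (hs : ¬ Stationary G X h δ u) :
    δ ^ 2 < ((1 + γ₁) * L) ^ 2 * (4 * e / μ) * ((1 - α) + 1 / (1 + α)) := by
  have hμ := H.μ_pos
  have hL := H.L_pos
  have hγ := H.one_lt_γ₁
  have hM0 : 0 < M := by
    by_contra hc
    have := mul_nonpos_of_nonpos_of_nonneg (not_lt.1 hc) (sq_nonneg α)
    linarith
  have h1 : δ < (1 + γ₁) * L * ‖u - v‖ := by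
    by_contra hc
    refine hs ⟨_, hp.neg_mem_subdiff H.h_convex, le_trans ?_ (not_lt.1 hc)⟩
    have : gradient G u + -(gradient G v + M • (u - v))
        = (gradient G u - gradient G v) - M • (u - v) := by abel
    rw [this]
    refine (norm_sub_le _ _).trans ?_
    rw [norm_smul, Real.norm_of_nonneg hM0.le]
    have := H.lip v hvX u hp.1
    have := mul_le_mul_of_nonneg_right hML (norm_nonneg (u - v))
    linarith
  have h2 : ‖u - v‖ ^ 2 ≤ 4 * e / μ * ((1 - α) + 1 / (1 + α)) := by
    have a1 : μ / 2 * ‖u - xs‖ ^ 2 ≤ (1 - α) * e := by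
      have b1 := H.quadratic_growth hp.1
      have b2 := H.energy_step hx hα hα1 hM hv hp hd
      have b3 : 0 ≤ μ / 2 * ‖x + (1 / α) • (u - x) - xs‖ ^ 2 := by positivity
      have b4 := mul_le_mul_of_nonneg_left he (by linarith : 0 ≤ 1 - α)
      unfold energy at b2 b4
      linarith
    have a2 : μ / 2 * ‖v - xs‖ ^ 2 ≤ 1 / (1 + α) * e := by
      have b1 := H.quadratic_growth hx
      have h1α : (1 + α) ≠ 0 := by positivity
      have e1 : v - xs = (1 / (1 + α)) • ((x - xs) + α • (z - xs)) := by
        have : xs = (1 / (1 + α)) • ((1 + α) • xs) := by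
          rw [smul_smul, one_div_mul_cancel h1α, one_smul]
        conv_lhs => rw [this]
        rw [hv]; module
      have hc : ‖(x - xs) + α • (z - xs)‖ ^ 2 ≤ (1 + α) * (‖x - xs‖ ^ 2 + α * ‖z - xs‖ ^ 2) := by
        have hi : ‖x - xs - (z - xs)‖ ^ 2
            = ‖x - xs‖ ^ 2 - 2 * ⟪x - xs, z - xs⟫_ℝ + ‖z - xs‖ ^ 2 := norm_sub_sq_real _ _
        rw [norm_add_sq_real, inner_smul_right, norm_smul, Real.norm_of_nonneg hα.le]
        nlinarith [sq_nonneg (‖x - xs - (z - xs)‖)]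
      have hsq : ‖v - xs‖ ^ 2 ≤ 1 / (1 + α) * (‖x - xs‖ ^ 2 + α * ‖z - xs‖ ^ 2) := by
        rw [e1, norm_smul, Real.norm_of_nonneg (by positivity), mul_pow]
        refine (mul_le_mul_of_nonneg_left hc (by positivity)).trans (le_of_eq ?_)
        field_simp
      have h5 : μ / 2 * (‖x - xs‖ ^ 2 + α * ‖z - xs‖ ^ 2) ≤ e := by
        unfold energy at he
        have : α * ‖z - xs‖ ^ 2 ≤ 1 * ‖z - xs‖ ^ 2 :=
          mul_le_mul_of_nonneg_right hα1 (by positivity)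
        nlinarith
      calc μ / 2 * ‖v - xs‖ ^ 2
          ≤ μ / 2 * (1 / (1 + α) * (‖x - xs‖ ^ 2 + α * ‖z - xs‖ ^ 2)) := by gcongr
        _ = 1 / (1 + α) * (μ / 2 * (‖x - xs‖ ^ 2 + α * ‖z - xs‖ ^ 2)) := by ring
        _ ≤ 1 / (1 + α) * e := by gcongr
    have h3 : ‖u - v‖ ^ 2 ≤ 2 * (‖u - xs‖ ^ 2 + ‖v - xs‖ ^ 2) := by
      have : ‖u - v‖ ≤ ‖u - xs‖ + ‖v - xs‖ := by
        have : u - v = (u - xs) - (v - xs) := by abel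
        rw [this]; exact norm_sub_le _ _
      nlinarith [norm_nonneg (u - v), sq_nonneg (‖u - xs‖ - ‖v - xs‖), norm_nonneg (u - xs),
        norm_nonneg (v - xs)]
    have h4 : 4 * e / μ * ((1 - α) + 1 / (1 + α))
        = 4 / μ * ((1 - α) * e + 1 / (1 + α) * e) := by ring
    rw [h4]
    calc ‖u - v‖ ^ 2 ≤ 2 * (‖u - xs‖ ^ 2 + ‖v - xs‖ ^ 2) := h3
      _ = 4 / μ * (μ / 2 * ‖u - xs‖ ^ 2 + μ / 2 * ‖v - xs‖ ^ 2) := by field_simp; ring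
      _ ≤ _ := by gcongr
  calc δ ^ 2 < ((1 + γ₁) * L * ‖u - v‖) ^ 2 := by gcongr
    _ = ((1 + γ₁) * L) ^ 2 * ‖u - v‖ ^ 2 := by ring
    _ ≤ ((1 + γ₁) * L) ^ 2 * (4 * e / μ * ((1 - α) + 1 / (1 + α))) := by gcongr
    _ = _ := by ring

end ApgModel

end APGAnalysis

/-! ### Line searches, iterations and evaluations of the accelerated method -/

section APGCount

variable {n : ℕ}

namespace ApgModel

variable {G : Vec n → ℝ} {X : Set (Vec n)} {h : Vec n → ℝ} {xs : Vec n}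
  {μ L Lmin γ₁ γ₂ D : ℝ}

/-- The invariant of the main loop: `L₀` is the entering estimate, `α'` the last parameter, and
`e` bounds the energy. -/
structure LoopState (G : Vec n → ℝ) (X : Set (Vec n)) (h : Vec n → ℝ) (xs : Vec n)
    (μ L Lmin γ₁ γ₂ : ℝ) (x x' : Vec n) (L₀ α' e : ℝ) : Prop where
  mem : x ∈ X
  mem' : x' ∈ X
  α_pos : 0 < α'
  α_le : α' ≤ 1
  ratio : μ ≤ γ₂ * α' ^ 2 * L₀
  le_est : Lmin ≤ L₀
  est_le : L₀ ≤ γ₁ * L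
  energy_le : energy G h xs μ x (x' + (1 / α') • (x - x')) ≤ e

lemma LoopState.extrap_mem (H : ApgModel G X h xs μ L Lmin γ₁ γ₂ D) {x x' : Vec n}
    {L₀ α' e M : ℝ} (S : LoopState G X h xs μ L Lmin γ₁ γ₂ x x' L₀ α' e) (hM : L₀ ≤ M) :
    extrap x x' α' (Real.sqrt (μ / M)) ∈ extrapSet X γ₂ := by
  have hμ := H.μ_pos
  have hL₀ : 0 < L₀ := hμ.trans_le (H.μ_le.trans S.le_est)
  have hM0 := hL₀.trans_le hM
  have hα := S.α_pos
  have h1 : Real.sqrt (μ / M) ≤ Real.sqrt γ₂ * α' := by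
    rw [← Real.sqrt_sq hα.le, ← Real.sqrt_mul (by linarith [H.one_le_γ₂])]
    apply Real.sqrt_le_sqrt
    rw [div_le_iff₀ hM0]
    exact S.ratio.trans (mul_le_mul_of_nonneg_left hM
      (mul_nonneg (by linarith [H.one_le_γ₂]) (sq_nonneg _)))
  have h0 : 0 ≤ Real.sqrt (μ / M) := Real.sqrt_nonneg _
  refine add_smul_sub_mem_extrapSet H.h_convex.1 H.one_le_γ₂ S.mem S.mem'
    (div_nonneg (mul_nonneg h0 (by linarith [S.α_le])) (by positivity)) ?_
  rw [div_le_iff₀ (by positivity)]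
  calc Real.sqrt (μ / M) * (1 - α') ≤ Real.sqrt (μ / M) * 1 := by gcongr; linarith
    _ ≤ Real.sqrt γ₂ * α' * (1 + 0) := by linarith
    _ ≤ Real.sqrt γ₂ * α' * (1 + Real.sqrt (μ / M)) := by gcongr
    _ = _ := by ring

lemma exists_lineSearch (H : ApgModel G X h xs μ L Lmin γ₁ γ₂ D) {x x' : Vec n}
    {L₀ α' e : ℝ} (S : LoopState G X h xs μ L Lmin γ₁ γ₂ x x' L₀ α' e) :
    ∃ u M α c, LineSearch G X h μ γ₁ x x' α' L₀ u M α c := by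
  have hL₀ : 0 < L₀ := H.μ_pos.trans_le (H.μ_le.trans S.le_est)
  suffices ∀ j : ℕ, ∀ L₁, L₀ ≤ L₁ → L ≤ L₁ * γ₁ ^ j →
      ∃ u M α c, LineSearch G X h μ γ₁ x x' α' L₁ u M α c by
    obtain ⟨j, hj⟩ := pow_unbounded_of_one_lt (L / L₀) H.one_lt_γ₁
    refine this j L₀ le_rfl ?_
    rw [div_lt_iff₀ hL₀] at hj
    linarith
  intro j
  induction j with
  | zero =>
    intro L₁ h1 h2
    obtain ⟨u, hu⟩ := H.prox (extrap x x' α' (Real.sqrt (μ / L₁))) L₁ (hL₀.trans_le h1)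
    refine ⟨u, _, _, _, .accept hu ?_⟩
    refine (H.upper _ (S.extrap_mem H h1) u hu.1).trans ?_
    gcongr
    simpa using h2
  | succ j ih =>
    intro L₁ h1 h2
    obtain ⟨u, hu⟩ := H.prox (extrap x x' α' (Real.sqrt (μ / L₁))) L₁ (hL₀.trans_le h1)
    by_cases hd : Descent G (extrap x x' α' (Real.sqrt (μ / L₁))) L₁ u
    · exact ⟨u, _, _, _, .accept hu hd⟩
    · have hγ := H.one_lt_γ₁
      have hL₁ := hL₀.trans_le h1
      obtain ⟨u', M, α, c, hr⟩ := ih (L₁ * γ₁)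
        (h1.trans (le_mul_of_one_le_right hL₁.le hγ.le)) (by rw [pow_succ] at h2; linarith)
      exact ⟨u', M, α, _, .reject hu hd hr⟩

lemma lineSearch_spec (H : ApgModel G X h xs μ L Lmin γ₁ γ₂ D) {x x' : Vec n}
    {L₀ α' e : ℝ} (S : LoopState G X h xs μ L Lmin γ₁ γ₂ x x' L₀ α' e)
    {L₁ M α : ℝ} {u : Vec n} {c : ℕ} (hls : LineSearch G X h μ γ₁ x x' α' L₁ u M α c)
    (h0 : L₀ ≤ L₁) (h1 : L₁ ≤ γ₁ * L) :
    L₁ ≤ M ∧ M ≤ γ₁ * L ∧ α = Real.sqrt (μ / M) ∧ IsProxStep G X h (extrap x x' α' α) M u ∧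
      Descent G (extrap x x' α' α) M u ∧ (c : ℝ) = 3 * (1 + Real.logb γ₁ (M / L₁)) := by
  have hL₀ : 0 < L₀ := H.μ_pos.trans_le (H.μ_le.trans S.le_est)
  have hγ := H.one_lt_γ₁
  induction hls with
  | @accept L₁ u hu hd =>
    refine ⟨le_rfl, h1, rfl, hu, hd, ?_⟩
    rw [div_self (hL₀.trans_le h0).ne']
    simp
  | @reject L₁ M α u u' c hu hd hr ih =>
    have hL₁ := hL₀.trans_le h0
    have hlt : L₁ < L := by
      by_contra hc
      refine hd ((H.upper _ (S.extrap_mem H h0) u hu.1).trans ?_)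
      gcongr
      exact not_lt.1 hc
    have hle : L₁ ≤ L₁ * γ₁ := le_mul_of_one_le_right hL₁.le hγ.le
    obtain ⟨a1, a2, a3, a4, a5, a6⟩ := ih (h0.trans hle)
      (by rw [mul_comm]; exact mul_le_mul_of_nonneg_left hlt.le (by linarith))
    refine ⟨hle.trans a1, a2, a3, a4, a5, ?_⟩
    have hM : 0 < M := hL₁.trans_le (hle.trans a1)
    push_cast
    rw [a6, Real.logb_div hM.ne' (by positivity), Real.logb_mul hL₁.ne' (by positivity),
      Real.logb_self_eq_one hγ, Real.logb_div hM.ne' hL₁.ne']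
    ring

/-- The smallest parameter `√(μ / L_max)` of the accelerated steps. -/
noncomputable def αmin (μ L γ₁ : ℝ) : ℝ := Real.sqrt (μ / (γ₁ * L))

lemma αmin_pos (H : ApgModel G X h xs μ L Lmin γ₁ γ₂ D) : 0 < αmin μ L γ₁ :=
  Real.sqrt_pos.2 (div_pos H.μ_pos (mul_pos (by linarith [H.one_lt_γ₁]) H.L_pos))

lemma αmin_lt_one (H : ApgModel G X h xs μ L Lmin γ₁ γ₂ D) : αmin μ L γ₁ < 1 := by
  rw [αmin, Real.sqrt_lt' one_pos, one_pow,
    div_lt_one (mul_pos (by linarith [H.one_lt_γ₁]) H.L_pos)]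
  have := mul_lt_mul_of_pos_right H.one_lt_γ₁ H.L_pos
  linarith [H.μ_le, H.le_L]

/-- The ratio of the squared residual after a step and the energy before it. -/
noncomputable def resRatio (μ L γ₁ : ℝ) : ℝ :=
  ((1 + γ₁) * L) ^ 2 * (4 / μ) * ((1 - αmin μ L γ₁) + 1 / (1 + αmin μ L γ₁))

/-- One iteration of the main loop preserves the invariant and contracts the energy bound. -/
lemma LoopState.step (H : ApgModel G X h xs μ L Lmin γ₁ γ₂ D) {x x' u : Vec n}
    {L₀ α' e M α : ℝ} {c : ℕ} (S : LoopState G X h xs μ L Lmin γ₁ γ₂ x x' L₀ α' e)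
    (hls : LineSearch G X h μ γ₁ x x' α' L₀ u M α c) :
    LoopState G X h xs μ L Lmin γ₁ γ₂ u x (max Lmin (M / γ₂)) α ((1 - αmin μ L γ₁) * e) ∧
      (c : ℝ) = 3 * (1 + Real.logb γ₁ (M / L₀)) ∧ L₀ ≤ M ∧ M ≤ γ₁ * L ∧
      ∀ δ : ℝ, 0 < δ → ¬ Stationary G X h δ u → δ ^ 2 < resRatio μ L γ₁ * e := by
  obtain ⟨a1, a2, a3, a4, a5, a6⟩ := H.lineSearch_spec S hls le_rfl S.est_le
  have hμ := H.μ_pos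
  have hL := H.L_pos
  have hγ := H.one_lt_γ₁
  have hγ₂ := H.one_le_γ₂
  have hM : 0 < M := hμ.trans_le (H.μ_le.trans (S.le_est.trans a1))
  have hα : 0 < α := by rw [a3]; exact Real.sqrt_pos.2 (by positivity)
  have hα2 : α ^ 2 = μ / M := by rw [a3, Real.sq_sqrt (by positivity)]
  have hMα : M * α ^ 2 = μ := by rw [hα2]; field_simp
  have hα1 : α ≤ 1 := by
    rw [a3, Real.sqrt_le_one, div_le_one hM]
    exact H.μ_le.trans (S.le_est.trans a1)
  have hmin : αmin μ L γ₁ ≤ α := by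
    rw [a3, αmin]
    exact Real.sqrt_le_sqrt (div_le_div_of_nonneg_left hμ.le hM a2)
  have he : 0 ≤ e := (H.energy_nonneg S.mem _).trans S.energy_le
  have hv : extrap x x' α' α
      = (1 / (1 + α)) • (x + α • (x' + (1 / α') • (x - x'))) := by
    have h1 : (1 + α) ≠ 0 := by positivity
    have h2 := S.α_pos.ne'
    have e1 : x + α • (x' + (1 / α') • (x - x'))
        = (1 + α) • x + (α * (1 - α') / α') • (x - x') := by
      have : α * (1 - α') / α' = α * (1 / α') - α := by field_simp
      rw [this]; module
    rw [e1, smul_add, smul_smul, smul_smul, one_div_mul_cancel h1, one_smul, extrap]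
    congr 2
    field_simp
  refine ⟨⟨a4.1, S.mem, hα, hα1, ?_, le_max_left _ _, ?_, ?_⟩, a6, a1, a2, ?_⟩
  · have : M / γ₂ ≤ max Lmin (M / γ₂) := le_max_right _ _
    calc μ = γ₂ * α ^ 2 * (M / γ₂) := by rw [← hMα]; field_simp
      _ ≤ _ := by gcongr
  · apply max_le
    · exact H.le_L.trans (le_mul_of_one_le_left hL.le hγ.le)
    · exact (div_le_self hM.le hγ₂).trans a2
  · refine (H.energy_step S.mem hα hα1 hMα hv a4 a5).trans ?_
    refine (mul_le_mul_of_nonneg_left S.energy_le (by linarith)).trans ?_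
    gcongr
  · intro δ hδ hs
    have hX := S.extrap_mem H a1
    rw [← a3] at hX
    refine (H.residual_step S.mem hα hα1 hMα a2 hv hX a4 a5 S.energy_le hδ hs).trans_le ?_
    have h1 : 1 - α + 1 / (1 + α) ≤ 1 - αmin μ L γ₁ + 1 / (1 + αmin μ L γ₁) := by
      have := H.αmin_pos
      gcongr
    calc ((1 + γ₁) * L) ^ 2 * (4 * e / μ) * (1 - α + 1 / (1 + α))
        ≤ ((1 + γ₁) * L) ^ 2 * (4 * e / μ) * (1 - αmin μ L γ₁ + 1 / (1 + αmin μ L γ₁)) := by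
          gcongr
      _ = _ := by unfold resRatio; ring

lemma exists_loop (H : ApgModel G X h xs μ L Lmin γ₁ γ₂ D) {x x' : Vec n}
    {L₀ α' e δ : ℝ} (S : LoopState G X h xs μ L Lmin γ₁ γ₂ x x' L₀ α' e) (hδ : 0 < δ) :
    ∃ out c, APGLoop G X h μ δ Lmin γ₁ γ₂ x x' L₀ α' out c := by
  -- otherwise the residual bound holds with arbitrarily many contractions
  have key : ∀ j : ℕ, ∀ (x x' : Vec n) (L₀ α' e : ℝ),
      LoopState G X h xs μ L Lmin γ₁ γ₂ x x' L₀ α' e →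
      (∃ out c, APGLoop G X h μ δ Lmin γ₁ γ₂ x x' L₀ α' out c) ∨
        δ ^ 2 < resRatio μ L γ₁ * ((1 - αmin μ L γ₁) ^ j * e) := by
    intro j
    induction j with
    | zero =>
      intro x x' L₀ α' e S
      obtain ⟨u, M, α, c, hl⟩ := H.exists_lineSearch S
      by_cases hs : Stationary G X h δ u
      · exact .inl ⟨_, _, .halt hl hs⟩
      · right
        simpa using (S.step H hl).2.2.2.2 δ hδ hs
    | succ j ih =>
      intro x x' L₀ α' e S
      obtain ⟨u, M, α, c, hl⟩ := H.exists_lineSearch S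
      by_cases hs : Stationary G X h δ u
      · exact .inl ⟨_, _, .halt hl hs⟩
      · rcases ih _ _ _ _ _ (S.step H hl).1 with ⟨out, c', hr⟩ | hr
        · exact .inl ⟨_, _, .next hl hs hr⟩
        · right
          rw [pow_succ (1 - αmin μ L γ₁), mul_assoc ((1 - αmin μ L γ₁) ^ j)]
          exact hr
  have hlim : Filter.Tendsto (fun j : ℕ => resRatio μ L γ₁ * ((1 - αmin μ L γ₁) ^ j * e))
      Filter.atTop (𝓝 (resRatio μ L γ₁ * (0 * e))) :=
    ((tendsto_pow_atTop_nhds_zero_of_lt_one (by linarith [H.αmin_lt_one])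
      (by linarith [H.αmin_pos])).mul_const e).const_mul _
  rw [zero_mul, mul_zero] at hlim
  obtain ⟨j, hj⟩ := (hlim.eventually_lt_const (by positivity : (0 : ℝ) < δ ^ 2)).exists
  rcases key j x x' L₀ α' e S with h | h
  · exact h
  · exact absurd hj (not_lt.2 h.le)

/-- The number `N` of iterations of the main loop controls the evaluations, and all but the last
iteration end in a point that is not stationary. -/
lemma loop_spec (H : ApgModel G X h xs μ L Lmin γ₁ γ₂ D) {δ : ℝ} (hδ : 0 < δ) {x x' out : Vec n}
    {L₀ α' : ℝ} {c : ℕ} (hr : APGLoop G X h μ δ Lmin γ₁ γ₂ x x' L₀ α' out c) :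
    ∀ e : ℝ, LoopState G X h xs μ L Lmin γ₁ γ₂ x x' L₀ α' e →
      Stationary G X h δ out ∧ ∃ N : ℕ,
        (c : ℝ) ≤ 3 * (N + 1) + 3 * N * Real.logb γ₁ γ₂ + 3 * Real.logb γ₁ (γ₁ * L / L₀) ∧
        (N ≠ 0 → δ ^ 2 < resRatio μ L γ₁ * ((1 - αmin μ L γ₁) ^ (N - 1) * e)) := by
  have hγ := H.one_lt_γ₁
  have hγ₂ := H.one_le_γ₂
  induction hr with
  | @halt x x' u L₀ α' M α c hl hs =>
    intro e S
    obtain ⟨S', a1, a2, a3, -⟩ := S.step H hl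
    refine ⟨hs, 0, ?_, by simp⟩
    have hL₀ : 0 < L₀ := H.μ_pos.trans_le (H.μ_le.trans S.le_est)
    have hM : 0 < M := hL₀.trans_le a2
    have : Real.logb γ₁ (M / L₀) ≤ Real.logb γ₁ (γ₁ * L / L₀) :=
      Real.logb_le_logb_of_le hγ (by positivity) (by gcongr)
    rw [a1]
    push_cast
    linarith
  | @next x x' u out L₀ α' M α c c' hl hs hr ih =>
    intro e S
    obtain ⟨S', a1, a2, a3, a4⟩ := S.step H hl
    obtain ⟨b1, N, b2, b3⟩ := ih _ S'
    refine ⟨b1, N + 1, ?_, fun _ => ?_⟩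
    · have hL₀ : 0 < L₀ := H.μ_pos.trans_le (H.μ_le.trans S.le_est)
      have hM : 0 < M := hL₀.trans_le a2
      have hL := H.L_pos
      have hγ0 : 0 < γ₁ := by linarith
      have hγ20 : 0 < γ₂ := by linarith
      have h1 : Real.logb γ₁ (γ₁ * L / max Lmin (M / γ₂))
          ≤ Real.logb γ₁ (γ₁ * L / (M / γ₂)) := by
        apply Real.logb_le_logb_of_le hγ
        · have : 0 < max Lmin (M / γ₂) := lt_max_of_lt_right (by positivity)
          positivity
        · gcongr
          exact le_max_right _ _
      rw [Real.logb_div (y := M / γ₂) (by positivity) (by positivity),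
        Real.logb_div hM.ne' hγ20.ne'] at h1
      rw [Real.logb_div hM.ne' hL₀.ne'] at a1
      rw [Real.logb_div (by positivity) hL₀.ne']
      push_cast
      linarith
    · rcases Nat.eq_zero_or_pos N with rfl | hN
      · simpa using a4 δ hδ hs
      · have := b3 hN.ne'
        rw [← mul_assoc ((1 - αmin μ L γ₁) ^ (N - 1)), ← pow_succ, Nat.sub_add_cancel hN] at this
        simpa using this

lemma exists_initSearch (H : ApgModel G X h xs μ L Lmin γ₁ γ₂ D) {w : Vec n} (hw : w ∈ X) :
    ∃ L' x c, InitSearch G X h γ₁ w Lmin L' x c := by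
  have hLmin : 0 < Lmin := H.μ_pos.trans_le H.μ_le
  have hγ := H.one_lt_γ₁
  suffices ∀ j : ℕ, ∀ L₁, 0 < L₁ → L ≤ γ₁ * L₁ * γ₁ ^ j →
      ∃ L' x c, InitSearch G X h γ₁ w L₁ L' x c by
    obtain ⟨j, hj⟩ := pow_unbounded_of_one_lt (L / (γ₁ * Lmin)) hγ
    refine this j Lmin hLmin ?_
    rw [div_lt_iff₀ (by positivity)] at hj
    linarith
  intro j
  induction j with
  | zero =>
    intro L₁ h1 h2
    obtain ⟨u, hu⟩ := H.prox w (γ₁ * L₁) (by positivity)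
    refine ⟨_, u, _, .accept hu ?_⟩
    refine (H.upper _ (mem_extrapSet_of_mem hw) u hu.1).trans ?_
    gcongr
    simpa using h2
  | succ j ih =>
    intro L₁ h1 h2
    obtain ⟨u, hu⟩ := H.prox w (γ₁ * L₁) (by positivity)
    by_cases hd : Descent G w (γ₁ * L₁) u
    · exact ⟨_, u, _, .accept hu hd⟩
    · obtain ⟨L', x, c, hr⟩ := ih (γ₁ * L₁) (by positivity) (by rw [pow_succ] at h2; linarith)
      exact ⟨L', x, _, .reject hu hd hr⟩

lemma initSearch_spec (H : ApgModel G X h xs μ L Lmin γ₁ γ₂ D) {w x : Vec n} (hw : w ∈ X)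
    {L₁ L' : ℝ} {c : ℕ} (hi : InitSearch G X h γ₁ w L₁ L' x c) (h0 : 0 < L₁) (h1 : L₁ ≤ L) :
    γ₁ * L₁ ≤ L' ∧ L' ≤ γ₁ * L ∧ IsProxStep G X h w L' x ∧ Descent G w L' x ∧
      (c : ℝ) = Real.logb γ₁ (L' / L₁) := by
  have hγ := H.one_lt_γ₁
  induction hi with
  | @accept L₁ x hx hd =>
    refine ⟨le_rfl, by gcongr, hx, hd, ?_⟩
    rw [mul_div_assoc, div_self h0.ne', mul_one, Real.logb_self_eq_one hγ]
    simp
  | @reject L₁ L' x x' c hx hd hr ih =>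
    have hlt : γ₁ * L₁ < L := by
      by_contra hc
      refine hd ((H.upper _ (mem_extrapSet_of_mem hw) x hx.1).trans ?_)
      gcongr
      exact not_lt.1 hc
    obtain ⟨a1, a2, a3, a4, a5⟩ := ih (by positivity) hlt.le
    have hle : γ₁ * L₁ ≤ γ₁ * (γ₁ * L₁) := le_mul_of_one_le_left (by positivity) hγ.le
    refine ⟨hle.trans a1, a2, a3, a4, ?_⟩
    have hL' : 0 < L' := lt_of_lt_of_le (by positivity) a1
    push_cast
    rw [a5, Real.logb_div hL'.ne' (by positivity), Real.logb_mul (by positivity) h0.ne',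
      Real.logb_self_eq_one hγ, Real.logb_div hL'.ne' h0.ne']
    ring

lemma initial_state (H : ApgModel G X h xs μ L Lmin γ₁ γ₂ D) {w x : Vec n} (hw : w ∈ X)
    {L' : ℝ} {c : ℕ} (hi : InitSearch G X h γ₁ w Lmin L' x c) :
    LoopState G X h xs μ L Lmin γ₁ γ₂ x x L' 1 ((γ₁ * L - μ) / 2 * D ^ 2) := by
  have hLmin : 0 < Lmin := H.μ_pos.trans_le H.μ_le
  have hγ := H.one_lt_γ₁
  obtain ⟨a1, a2, a3, a4, a5⟩ := H.initSearch_spec hw hi hLmin H.le_L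
  have hle : Lmin ≤ L' := (le_mul_of_one_le_left hLmin.le hγ.le).trans a1
  refine ⟨a3.1, a3.1, one_pos, le_rfl, ?_, hle, a2, ?_⟩
  · have := H.μ_le.trans hle
    have := H.one_le_γ₂
    nlinarith [H.μ_pos]
  · have h1 := H.prox_ineq a3 a4 H.min_mem
    have h2 := H.diam xs H.min_mem w hw
    have h3 : ‖xs - w‖ ^ 2 ≤ D ^ 2 := by gcongr
    have h4 : (L' - μ) / 2 * ‖xs - w‖ ^ 2 ≤ (γ₁ * L - μ) / 2 * D ^ 2 := by
      have : 0 ≤ γ₁ * L - μ := by linarith [H.μ_le]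
      gcongr
    rw [norm_sub_rev xs x] at h1
    have h5 : μ / 2 * ‖x - xs‖ ^ 2 ≤ L' / 2 * ‖x - xs‖ ^ 2 := by
      gcongr
      exact H.μ_le.trans hle
    simp only [sub_self, smul_zero, add_zero, energy]
    linarith

/-- The number of contractions that leave the residual above `δ` is at most `2 ℓ / α`. -/
lemma count_le (H : ApgModel G X h xs μ L Lmin γ₁ γ₂ D) (hD : 0 ≤ D) {δ ℓ : ℝ} (hδ : 0 < δ)
    (hℓ : 1 ≤ ℓ)
    (hlog : Real.log (2 * (1 + γ₁) * L * D * Real.sqrt (γ₁ * L / μ + 1) / δ) ≤ ℓ) {N : ℕ}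
    (hN : N ≠ 0)
    (hlt : δ ^ 2 < resRatio μ L γ₁ * ((1 - αmin μ L γ₁) ^ (N - 1)
      * ((γ₁ * L - μ) / 2 * D ^ 2))) :
    (N + 1 : ℝ) ≤ 2 * ℓ * Real.sqrt (γ₁ * L / μ) := by
  have hμ := H.μ_pos
  have hL := H.L_pos
  have hγ := H.one_lt_γ₁
  set α := αmin μ L γ₁ with hαdef
  have hα : 0 < α := H.αmin_pos
  have hα1 : α < 1 := H.αmin_lt_one
  have hq : γ₁ * L / μ = 1 / α ^ 2 := by
    rw [hαdef, αmin, Real.sq_sqrt (by positivity), one_div_div]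
  have hsq : Real.sqrt (γ₁ * L / μ) = 1 / α := by
    rw [hq, Real.sqrt_div one_pos.le, Real.sqrt_one, Real.sqrt_sq hα.le]
  have hDpos : 0 < D := by
    rcases hD.lt_or_eq with h | h
    · exact h
    · rw [← h] at hlt
      simp only [ne_eq, OfNat.ofNat_ne_zero, not_false_eq_true, zero_pow, mul_zero] at hlt
      exact absurd hlt (not_lt.2 (sq_nonneg δ))
  set Z := 2 * (1 + γ₁) * L * D * Real.sqrt (γ₁ * L / μ + 1) / δ with hZ
  have hZpos : 0 < Z := by positivity
  have hZ2 : Z ^ 2 ≤ Real.exp (2 * ℓ) := by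
    have : Z ≤ Real.exp ℓ := (Real.log_le_iff_le_exp hZpos).1 hlog
    calc Z ^ 2 ≤ (Real.exp ℓ) ^ 2 := by gcongr
      _ = Real.exp (2 * ℓ) := by rw [← Real.exp_nat_mul]; norm_num
  -- the residual bound, rewritten in terms of `Z`
  have hmain : 1 < Z ^ 2 * (1 - α) ^ N := by
    have e1 : Z ^ 2 * δ ^ 2 = (2 * (1 + γ₁) * L * D) ^ 2 * (1 / α ^ 2 + 1) := by
      rw [hZ, div_pow, mul_pow, Real.sq_sqrt (by positivity), hq]
      field_simp
    have e2 : (γ₁ * L - μ) = μ * (1 / α ^ 2 - 1) := by rw [← hq]; field_simp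
    have e3 : resRatio μ L γ₁ * ((1 - α) ^ (N - 1) * ((γ₁ * L - μ) / 2 * D ^ 2))
        = Z ^ 2 * δ ^ 2 * (1 - α) ^ (N - 1) * ((1 - α) * ((1 - α ^ 2 / 2) / (1 + α ^ 2))) := by
      rw [e1, e2, resRatio, ← hαdef]
      field_simp
      ring
    have e4 : (1 - α ^ 2 / 2) / (1 + α ^ 2) ≤ 1 := by
      rw [div_le_one (by positivity)]; nlinarith
    have e5 : (1 - α) ^ N = (1 - α) ^ (N - 1) * (1 - α) := by
      rw [← pow_succ, Nat.sub_add_cancel (Nat.pos_of_ne_zero hN)]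
    have h1α : 0 < 1 - α := by linarith
    rw [e3] at hlt
    have e6 : δ ^ 2 < δ ^ 2 * (Z ^ 2 * (1 - α) ^ N) := by
      refine hlt.trans_le ?_
      calc Z ^ 2 * δ ^ 2 * (1 - α) ^ (N - 1) * ((1 - α) * ((1 - α ^ 2 / 2) / (1 + α ^ 2)))
          ≤ Z ^ 2 * δ ^ 2 * (1 - α) ^ (N - 1) * ((1 - α) * 1) := by gcongr
        _ = _ := by rw [e5]; ring
    by_contra hc
    have := mul_le_mul_of_nonneg_left (not_lt.1 hc) (sq_nonneg δ)
    linarith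
  have hexp : 1 - α ≤ Real.exp (-(2 * α / (2 - α))) := by
    have h1 := Real.le_log_one_add_of_nonneg (x := α / (1 - α))
      (div_nonneg hα.le (by linarith))
    have h1α : 0 < 1 - α := by linarith
    have h2α : 0 < 2 - α := by linarith
    have e1 : 2 * (α / (1 - α)) / (α / (1 - α) + 2) = 2 * α / (2 - α) := by
      have : α / (1 - α) + 2 = (2 - α) / (1 - α) := by field_simp; ring
      rw [this]; field_simp
    have e2 : 1 + α / (1 - α) = (1 - α)⁻¹ := by field_simp; ring
    rw [e1, e2, Real.log_inv] at h1
    calc 1 - α = Real.exp (Real.log (1 - α)) := (Real.exp_log h1α).symm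
      _ ≤ _ := Real.exp_le_exp.2 (by linarith)
  have hlt2 : N * (2 * α / (2 - α)) < 2 * ℓ := by
    have h1 : (1 - α) ^ N ≤ Real.exp (-(N * (2 * α / (2 - α)))) := by
      calc (1 - α) ^ N ≤ Real.exp (-(2 * α / (2 - α))) ^ N :=
            pow_le_pow_left₀ (by linarith) hexp N
        _ = _ := by rw [← Real.exp_nat_mul]; congr 1; ring
    have h2 : 1 < Real.exp (2 * ℓ) * Real.exp (-(N * (2 * α / (2 - α)))) :=
      hmain.trans_le (mul_le_mul hZ2 h1 (pow_nonneg (by linarith) _) (Real.exp_pos _).le)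
    rw [← Real.exp_add, ← Real.exp_zero, Real.exp_lt_exp] at h2
    linarith
  rw [hsq]
  have h2α : 0 < 2 - α := by linarith
  rw [mul_one_div, le_div_iff₀ hα]
  have hlt3 : N * (2 * α) < 2 * ℓ * (2 - α) := by
    rw [← mul_div_assoc, div_lt_iff₀ h2α] at hlt2
    exact hlt2
  by_contra hc
  nlinarith

/-- Total evaluation count of the adaptive accelerated proximal gradient method. -/
theorem adapAPG_spec (H : ApgModel G X h xs μ L Lmin γ₁ γ₂ D) {w : Vec n} (hw : w ∈ X)
    {δ ℓ τ : ℝ} (hδ : 0 < δ) (hℓ : 1 ≤ ℓ)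
    (hlog : Real.log (2 * (1 + γ₁) * L * D * Real.sqrt (γ₁ * L / μ + 1) / δ) ≤ ℓ)
    (hτ : 1 + Real.logb γ₁ γ₂ ≤ τ) :
    (∃ out c, AdapAPG G X h w μ δ Lmin γ₁ γ₂ out c) ∧
      ∀ out c, AdapAPG G X h w μ δ Lmin γ₁ γ₂ out c → Stationary G X h δ out ∧
        (c : ℝ) ≤ 6 * τ * ℓ * Real.sqrt (γ₁ * L / μ) + 3 * Real.logb γ₁ (L / μ) + 3 := by
  have hμ := H.μ_pos
  have hL := H.L_pos
  have hγ := H.one_lt_γ₁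
  have hLmin : 0 < Lmin := H.μ_pos.trans_le H.μ_le
  constructor
  · obtain ⟨L', x, c, hi⟩ := H.exists_initSearch hw
    obtain ⟨out, c', hl⟩ := H.exists_loop (H.initial_state hw hi) hδ
    exact ⟨out, _, .run hi hl⟩
  · rintro out _ ⟨hi, hl⟩
    rename_i L' x c c'
    obtain ⟨a1, a2, a3, a4, a5⟩ := H.initSearch_spec hw hi hLmin H.le_L
    obtain ⟨b1, N, b2, b3⟩ := H.loop_spec hδ hl _ (H.initial_state hw hi)
    refine ⟨b1, ?_⟩
    have hL' : 0 < L' := lt_of_lt_of_le (by positivity) a1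
    have hc1 : (1 : ℝ) ≤ c := by
      rw [a5, ← Real.logb_self_eq_one hγ]
      apply Real.logb_le_logb_of_le hγ (by linarith)
      rw [le_div_iff₀ hLmin]; exact a1
    have hmono : Real.logb γ₁ (L / Lmin) ≤ Real.logb γ₁ (L / μ) :=
      Real.logb_le_logb_of_le hγ (by positivity) (by gcongr; exact H.μ_le)
    rw [Real.logb_div hL'.ne' hLmin.ne'] at a5
    rw [Real.logb_div hL.ne' hLmin.ne'] at hmono
    rw [Real.logb_div (by positivity) hL'.ne', Real.logb_mul (by positivity) hL.ne',
      Real.logb_self_eq_one hγ] at b2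
    have hlogγ : 0 ≤ Real.logb γ₁ γ₂ := Real.logb_nonneg hγ H.one_le_γ₂
    have hτ1 : 1 ≤ τ := by linarith
    have hNτ : 3 * (N : ℝ) * Real.logb γ₁ γ₂ ≤ 3 * N * (τ - 1) := by gcongr; linarith
    have hq : 1 ≤ Real.sqrt (γ₁ * L / μ) := by
      rw [Real.one_le_sqrt, le_div_iff₀ hμ]
      nlinarith [H.μ_le, H.le_L]
    have hD : 0 ≤ D := (norm_nonneg _).trans (H.diam _ hw _ hw)
    have hcount : 3 * τ * N + 3 ≤ 6 * τ * ℓ * Real.sqrt (γ₁ * L / μ) := by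
      rcases eq_or_ne N 0 with rfl | hN
      · have : 1 * 1 * 1 ≤ τ * ℓ * Real.sqrt (γ₁ * L / μ) := by gcongr
        push_cast; linarith
      · have h1 := H.count_le hD hδ hℓ hlog hN (b3 hN)
        have h2 := mul_le_mul_of_nonneg_left h1 (by linarith : 0 ≤ 3 * τ)
        linarith
    push_cast
    linarith

end ApgModel

end APGCount

/-! ### The augmented Lagrangian of the proximal subproblem -/

lemma hasDerivAt_sq_max_zero (t : ℝ) : HasDerivAt (fun s : ℝ => max s 0 ^ 2) (2 * max t 0) t := by
  rw [hasDerivAt_iff_isLittleO]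
  refine Asymptotics.IsBigO.trans_isLittleO (g := fun s => ‖s - t‖ ^ 2) ?_
    (Asymptotics.isLittleO_pow_sub_sub t one_lt_two)
  refine Asymptotics.IsBigO.of_bound 1 (Filter.Eventually.of_forall fun s => ?_)
  simp only [smul_eq_mul, Real.norm_eq_abs, sq_abs, one_mul, abs_of_nonneg (sq_nonneg (s - t))]
  rw [abs_le]
  rcases le_total s 0 with hs | hs <;> rcases le_total t 0 with ht | ht <;>
    simp only [max_eq_left, max_eq_right, hs, ht] <;> constructor <;> nlinarith

lemma sq_max_zero_add_le (s t : ℝ) : max t 0 ^ 2 + 2 * max t 0 * (s - t) ≤ max s 0 ^ 2 := by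
  rcases le_total s 0 with hs | hs <;> rcases le_total t 0 with ht | ht <;>
    simp only [max_eq_left, max_eq_right, hs, ht] <;> nlinarith [sq_nonneg (s - t)]

section Augmented

variable {n l m : ℕ}

lemma norm_posVec_sq {m : ℕ} (v : Vec m) : ‖posVec v‖ ^ 2 = ∑ i, max (v i) 0 ^ 2 := by
  simp [EuclideanSpace.real_norm_sq_eq, posVec]

lemma inner_vec_eq_sum {m : ℕ} (a b : Vec m) : ⟪a, b⟫_ℝ = ∑ i, a i * b i := by
  simp [PiLp.inner_apply, mul_comm]

namespace NLP

variable (P : NLP n l m)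

lemma inner_transpose (y : Vec l) (d : Vec n) :
    ⟪Matrix.toEuclideanLin P.Aᵀ y, d⟫_ℝ = ⟪y, Matrix.toEuclideanLin P.A d⟫_ℝ := by
  rw [← Matrix.conjTranspose_eq_transpose_of_trivial,
    Matrix.toEuclideanLin_conjTranspose_eq_adjoint, LinearMap.adjoint_inner_left]

lemma res_sub (w u : Vec n) : P.res w - P.res u = Matrix.toEuclideanLin P.A (w - u) := by
  simp [res]

lemma norm_transpose_mul_le (d : Vec n) :
    ‖Matrix.toEuclideanLin P.Aᵀ (Matrix.toEuclideanLin P.A d)‖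
      ≤ ‖Matrix.toEuclideanCLM (𝕜 := ℝ) (P.Aᵀ * P.A)‖ * ‖d‖ := by
  have : Matrix.toEuclideanLin P.Aᵀ (Matrix.toEuclideanLin P.A d)
      = Matrix.toEuclideanCLM (𝕜 := ℝ) (P.Aᵀ * P.A) d := by
    rw [← ContinuousLinearMap.coe_coe, Matrix.coe_toEuclideanCLM_eq_toEuclideanLin]
    simp [Matrix.toLpLin_apply]
  rw [this]
  exact ContinuousLinearMap.le_opNorm _ _

lemma continuous_res : Continuous P.res :=
  (LinearMap.continuous_of_finiteDimensional (Matrix.toEuclideanLin P.A)).sub continuous_const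

/-- Smooth part of the Lagrangian of the proximal subproblem with centre `c`. -/
noncomputable def lag (ρ : ℝ) (c : Vec n) (p : Dual l m) (x : Vec n) : ℝ :=
  P.g x + ρ * ‖x - c‖ ^ 2 + ⟪p.1, P.res x⟫_ℝ + ⟪p.2, P.fvec x⟫_ℝ

/-- Its gradient. -/
noncomputable def lagGrad (ρ : ℝ) (c : Vec n) (p : Dual l m) (x : Vec n) : Vec n :=
  gradient P.g x + (2 * ρ) • (x - c) + Matrix.toEuclideanLin P.Aᵀ p.1
    + ∑ i, p.2 i • gradient (P.f i) x

/-- The terms of the augmented Lagrangian that come from the constraints. -/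
noncomputable def penalty (β : ℝ) (p : Dual l m) (x : Vec n) : ℝ :=
  ⟪p.1, P.res x⟫_ℝ + β / 2 * ‖P.res x‖ ^ 2
    + 1 / (2 * β) * (‖posVec (p.2 + β • P.fvec x)‖ ^ 2 - ‖p.2‖ ^ 2)

lemma augSmooth_prox (ρ : ℝ) (c : Vec n) (β : ℝ) (p : Dual l m) (x : Vec n) :
    (P.prox ρ c).augSmooth β p x = P.g x + ρ * ‖x - c‖ ^ 2 + P.penalty β p x := by
  simp only [augSmooth, penalty]
  simp only [prox, res, fvec]
  ring

lemma dualStep_nonneg (β : ℝ) (p : Dual l m) (x : Vec n) (i : Fin m) :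
    0 ≤ (P.dualStep β p x).2 i := by
  simp [dualStep, posVec]

variable {P}

lemma hasGradientAt_augSmooth_prox (hg : Differentiable ℝ P.g) (hf : ∀ i, Differentiable ℝ (P.f i))
    (ρ : ℝ) (c : Vec n) {β : ℝ} (hβ : 0 < β) (p : Dual l m) (x : Vec n) :
    HasGradientAt ((P.prox ρ c).augSmooth β p) (P.lagGrad ρ c (P.dualStep β p x) x) x := by
  have e : (P.prox ρ c).augSmooth β p = fun x => P.g x + ρ * ‖x - c‖ ^ 2
      + (⟪p.1, P.res x⟫_ℝ + β / 2 * ‖P.res x‖ ^ 2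
        + 1 / (2 * β) * (∑ i, max (p.2 i + β * P.f i x) 0 ^ 2 - ‖p.2‖ ^ 2)) := by
    funext x
    rw [augSmooth_prox, penalty, norm_posVec_sq]
    simp [fvec]
  rw [e, hasGradientAt_iff_hasFDerivAt]
  have h1 := (hg x).hasGradientAt.hasFDerivAt
  have h2 := (((hasFDerivAt_id x).sub_const c).norm_sq).const_mul ρ
  have hres : HasFDerivAt P.res (LinearMap.toContinuousLinearMap (Matrix.toEuclideanLin P.A)) x :=
    ((LinearMap.toContinuousLinearMap (Matrix.toEuclideanLin P.A)).hasFDerivAt).sub_const P.b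
  have h3 : HasFDerivAt (fun x => ⟪p.1, P.res x⟫_ℝ)
      ((innerSL ℝ p.1).comp (LinearMap.toContinuousLinearMap (Matrix.toEuclideanLin P.A))) x :=
    (innerSL ℝ p.1).hasFDerivAt.comp x hres
  have h4 := hres.norm_sq.const_mul (β / 2)
  have h5 : HasFDerivAt (fun x => ∑ i, max (p.2 i + β * P.f i x) 0 ^ 2)
      (∑ i, (2 * max (p.2 i + β * P.f i x) 0) • (β • InnerProductSpace.toDual ℝ (Vec n)
        (gradient (P.f i) x))) x := by
    apply HasFDerivAt.fun_sum
    intro i _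
    have a1 := (((hf i x).hasGradientAt.hasFDerivAt).const_mul β).const_add (p.2 i)
    exact (hasDerivAt_sq_max_zero _).comp_hasFDerivAt x a1
  have h6 := (h1.add h2).add ((h3.add h4).add ((h5.sub_const (‖p.2‖ ^ 2)).const_mul (1 / (2 * β))))
  refine h6.congr_fderiv ?_
  ext d
  simp only [lagGrad, dualStep, InnerProductSpace.toDual_apply_apply, inner_add_left, sum_inner,
    inner_transpose, inner_smul_left]
  simp [posVec, fvec, innerSL_apply_apply, Finset.mul_sum]
  have hβ' := hβ.ne'
  have hs : ∑ i, β⁻¹ * 2⁻¹ * (2 * max (p.2 i + β * P.f i x) 0 * (β * fderiv ℝ (P.f i) x d))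
      = ∑ i, max (p.2 i + β * P.f i x) 0 * fderiv ℝ (P.f i) x d :=
    Finset.sum_congr rfl fun i _ => by field_simp
  rw [hs, inner_sub_left]
  ring

/-- The augmented Lagrangian is convex in the constraint values: it lies above the Lagrangian with
the updated multipliers. -/
lemma penalty_add_le {β : ℝ} (hβ : 0 < β) (p : Dual l m) (u w : Vec n) :
    P.penalty β p u + (⟪(P.dualStep β p u).1, P.res w - P.res u⟫_ℝ
      + ⟪(P.dualStep β p u).2, P.fvec w - P.fvec u⟫_ℝ) ≤ P.penalty β p w := by
  have h1 : ⟪(P.dualStep β p u).1, P.res w - P.res u⟫_ℝ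
      ≤ ⟪p.1, P.res w⟫_ℝ + β / 2 * ‖P.res w‖ ^ 2 - (⟪p.1, P.res u⟫_ℝ + β / 2 * ‖P.res u‖ ^ 2) := by
    have e : P.res w = P.res u + (P.res w - P.res u) := by abel
    have h := norm_add_sq_real (P.res u) (P.res w - P.res u)
    rw [← e] at h
    have hb : 0 ≤ β / 2 * ‖P.res w - P.res u‖ ^ 2 := by positivity
    simp only [dualStep, inner_add_left, inner_smul_left, conj_trivial, h]
    rw [inner_sub_right p.1]
    nlinarith
  have h2 : ⟪(P.dualStep β p u).2, P.fvec w - P.fvec u⟫_ℝ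
      ≤ 1 / (2 * β) * (‖posVec (p.2 + β • P.fvec w)‖ ^ 2)
        - 1 / (2 * β) * (‖posVec (p.2 + β • P.fvec u)‖ ^ 2) := by
    rw [inner_vec_eq_sum, norm_posVec_sq, norm_posVec_sq, ← mul_sub, ← Finset.sum_sub_distrib,
      Finset.mul_sum]
    refine Finset.sum_le_sum fun i _ => ?_
    have := sq_max_zero_add_le (p.2 i + β * P.f i w) (p.2 i + β * P.f i u)
    simp only [dualStep, posVec, fvec, PiLp.add_apply, PiLp.smul_apply, PiLp.sub_apply,
      smul_eq_mul]
    rw [one_div, inv_mul_eq_div, le_div_iff₀ (by positivity)]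
    nlinarith
  unfold penalty
  linarith

lemma lag_strong {ρ : ℝ} (hg : Differentiable ℝ P.g) (hw : IsWeaklyConvex P ρ)
    (hf : ∀ i, Differentiable ℝ (P.f i)) (hfc : ∀ i, ConvexOn ℝ Set.univ (P.f i)) (c : Vec n)
    {p : Dual l m} (hp : ∀ i, 0 ≤ p.2 i) (u w : Vec n) :
    P.lag ρ c p u + ⟪P.lagGrad ρ c p u, w - u⟫_ℝ + ρ / 2 * ‖w - u‖ ^ 2 ≤ P.lag ρ c p w := by
  have h1 : P.g u + ⟪gradient P.g u, w - u⟫_ℝ - ρ / 2 * ‖w - u‖ ^ 2 ≤ P.g w := by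
    have hd : Differentiable ℝ (fun x => P.g x + ρ / 2 * ‖x‖ ^ 2) := by
      have : Differentiable ℝ (fun x : Vec n => ‖x‖ ^ 2) := differentiable_id.norm_sq ℝ
      exact hg.add (this.const_mul _)
    have hgr : gradient (fun x => P.g x + ρ / 2 * ‖x‖ ^ 2) u = gradient P.g u + ρ • u := by
      apply HasGradientAt.gradient
      rw [hasGradientAt_iff_hasFDerivAt]
      refine ((hg u).hasGradientAt.hasFDerivAt.add
        ((hasFDerivAt_id u).norm_sq.const_mul (ρ / 2))).congr_fderiv ?_
      ext d
      simp [innerSL_apply_apply]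
      ring
    have := ConvexOn.add_inner_gradient_le hw hd u w
    rw [hgr, inner_add_left, inner_smul_left] at this
    have e : w = u + (w - u) := by abel
    have h := norm_add_sq_real u (w - u)
    rw [← e] at h
    simp only [conj_trivial] at this
    rw [h] at this
    linarith
  have h2 : ‖w - c‖ ^ 2 = ‖u - c‖ ^ 2 + 2 * ⟪u - c, w - u⟫_ℝ + ‖w - u‖ ^ 2 := by
    rw [← norm_add_sq_real]; congr 2; abel
  have h3 : ⟪p.1, P.res w⟫_ℝ = ⟪p.1, P.res u⟫_ℝ + ⟪Matrix.toEuclideanLin P.Aᵀ p.1, w - u⟫_ℝ := by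
    rw [inner_transpose, ← res_sub, inner_sub_right]; ring
  have h4 : ⟪p.2, P.fvec u⟫_ℝ + ⟪∑ i, p.2 i • gradient (P.f i) u, w - u⟫_ℝ ≤ ⟪p.2, P.fvec w⟫_ℝ := by
    rw [inner_vec_eq_sum p.2, inner_vec_eq_sum p.2, sum_inner, ← Finset.sum_add_distrib]
    refine Finset.sum_le_sum fun i _ => ?_
    have := mul_le_mul_of_nonneg_left
      (ConvexOn.add_inner_gradient_le (hfc i) (hf i) u w) (hp i)
    simp only [fvec, inner_smul_left, conj_trivial]
    linarith
  unfold lag lagGrad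
  rw [inner_add_left, inner_add_left, inner_add_left, inner_smul_left, h2, h3]
  simp only [conj_trivial]
  linarith

end NLP

/-- The hypotheses of the complexity theorem. -/
structure Setting (P : NLP n l m) (C : Consts n m) (q : Params) : Prop where
  comp : IsComposite P C q
  slater : IsSlater P C.xfeas
  ρ_pos : 0 < q.ρ
  weak : IsWeaklyConvex P q.ρ
  unif : IsUniformlyBounded P C
  β₀_pos : 0 < q.β₀
  one_lt_σ : 1 < q.σ
  one_lt_γ : 1 < q.γ
  one_lt_γ₁ : 1 < q.γ₁
  one_le_γ₂ : 1 ≤ q.γ₂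
  ρ_le_Lmin : q.ρ ≤ q.Lmin
  Lmin_le : q.Lmin ≤ C.L₀ + 2 * q.ρ + q.β₀ * Lc P C
  two_le_N₁ : 2 ≤ q.N₁
  le_N₀ : (q.N₁ : ℝ) / (q.γ - 1) ≤ q.N₀

namespace Setting

variable {P : NLP n l m} {C : Consts n m} {q : Params}

lemma xfeas_mem (T : Setting P C q) : C.xfeas ∈ P.X := interior_subset T.slater.mem

lemma convex_X (T : Setting P C q) : Convex ℝ P.X := T.comp.h_convex.1

lemma B₀_nonneg (T : Setting P C q) : 0 ≤ C.B₀ :=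
  (abs_nonneg _).trans ((le_max_left _ _).trans (T.unif.obj_bound _ T.xfeas_mem))

lemma abs_obj_le (T : Setting P C q) {x : Vec n} (hx : x ∈ P.X) : |P.g x + P.h x| ≤ C.B₀ :=
  (le_max_left _ _).trans (T.unif.obj_bound _ hx)

lemma norm_gradient_g_le (T : Setting P C q) {x : Vec n} (hx : x ∈ P.X) :
    ‖gradient P.g x‖ ≤ C.B₀ := (le_max_right _ _).trans (T.unif.obj_bound _ hx)

lemma abs_f_le (T : Setting P C q) (i : Fin m) {x : Vec n} (hx : x ∈ extrapSet P.X q.γ₂) :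
    |P.f i x| ≤ C.B i := (le_max_left _ _).trans (T.comp.f_bound i x hx)

lemma norm_gradient_f_le (T : Setting P C q) (i : Fin m) {x : Vec n}
    (hx : x ∈ extrapSet P.X q.γ₂) : ‖gradient (P.f i) x‖ ≤ C.B i :=
  (le_max_right _ _).trans (T.comp.f_bound i x hx)

lemma B_nonneg (T : Setting P C q) (i : Fin m) : 0 ≤ C.B i :=
  (abs_nonneg _).trans (T.abs_f_le i (mem_extrapSet_of_mem T.xfeas_mem))

lemma Lc_nonneg (T : Setting P C q) : 0 ≤ Lc P C :=
  add_nonneg (norm_nonneg _) (Finset.sum_nonneg fun i _ =>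
    mul_nonneg (T.B_nonneg i) (add_nonneg (T.B_nonneg i) (T.comp.L_nonneg i)))

lemma Lsum_nonneg (C : Consts n m) : 0 ≤ Lsum C := Real.sqrt_nonneg _

lemma abs_f_sub_le (T : Setting P C q) (i : Fin m) {u v : Vec n}
    (hu : u ∈ extrapSet P.X q.γ₂) (hv : v ∈ extrapSet P.X q.γ₂) :
    |P.f i u - P.f i v| ≤ C.B i * ‖u - v‖ := by
  have key : ∀ u v : Vec n, u ∈ extrapSet P.X q.γ₂ → P.f i u - P.f i v ≤ C.B i * ‖u - v‖ := by
    intro u v hu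
    have h1 := ConvexOn.add_inner_gradient_le (T.comp.f_convex i) (T.comp.f_diff i) u v
    have h2 := abs_le.1 (abs_real_inner_le_norm (gradient (P.f i) u) (v - u))
    have h3 := mul_le_mul_of_nonneg_right (T.norm_gradient_f_le i hu) (norm_nonneg (v - u))
    rw [norm_sub_rev u v]
    linarith [h2.1]
  rw [abs_le]
  refine ⟨?_, key u v hu⟩
  have := key v u hv
  rw [norm_sub_rev] at this
  linarith

lemma isCompact_X (T : Setting P C q) : IsCompact P.X := by
  have hcl : IsCompact (closure P.X) := T.comp.bounded.isCompact_closure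
  obtain ⟨B, hB⟩ := (hcl.image T.comp.g_diff.continuous).isBounded.exists_norm_le
  have hg : ∀ x ∈ P.X, |P.g x| ≤ B := fun x hx =>
    hB _ (Set.mem_image_of_mem _ (subset_closure hx))
  have hh : ∀ x ∈ P.X, |P.h x| ≤ B + C.B₀ := by
    intro x hx
    have h1 := abs_le.1 (hg x hx)
    have h2 := abs_le.1 (T.abs_obj_le hx)
    rw [abs_le]; constructor <;> linarith [h1.1, h1.2, h2.1, h2.2]
  -- `X` is the projection of a compact part of the closed epigraph
  have hK : IsCompact ({w : Vec n × ℝ | w.1 ∈ P.X ∧ P.h w.1 ≤ w.2}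
      ∩ (closure P.X ×ˢ Set.Icc (-(B + C.B₀)) (B + C.B₀))) :=
    (hcl.prod isCompact_Icc).inter_left T.comp.h_closed
  convert hK.image continuous_fst
  ext x
  constructor
  · intro hx
    exact ⟨(x, P.h x), ⟨⟨hx, le_rfl⟩, subset_closure hx, abs_le.1 (hh x hx)⟩, rfl⟩
  · rintro ⟨w, ⟨hw, -⟩, rfl⟩
    exact hw.1

lemma lowerSemicontinuousOn_h (T : Setting P C q) : LowerSemicontinuousOn P.h P.X := by
  intro x hx y hy
  have hcl : IsClosed {u | u ∈ P.X ∧ P.h u ≤ y} :=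
    T.comp.h_closed.preimage (Continuous.prodMk continuous_id continuous_const)
  have hmem : {u | u ∈ P.X ∧ P.h u ≤ y}ᶜ ∈ 𝓝 x :=
    hcl.isOpen_compl.mem_nhds fun hc => absurd hy (not_lt.2 hc.2)
  filter_upwards [mem_nhdsWithin_of_mem_nhds hmem, self_mem_nhdsWithin] with u hu huX
  by_contra hc
  exact hu ⟨huX, not_lt.1 hc⟩

lemma diamD_nonneg (P : NLP n l m) : 0 ≤ diamD P := Metric.diam_nonneg

lemma norm_sub_le_diamD (T : Setting P C q) {u v : Vec n} (hu : u ∈ P.X) (hv : v ∈ P.X) :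
    ‖u - v‖ ≤ diamD P := by
  rw [← dist_eq_norm]
  exact Metric.dist_le_diam_of_mem T.comp.bounded hu hv

lemma gradient_aug (T : Setting P C q) (c : Vec n) {β : ℝ} (hβ : 0 < β) (p : Dual l m)
    (x : Vec n) : gradient ((P.prox q.ρ c).augSmooth β p) x
      = P.lagGrad q.ρ c (P.dualStep β p x) x :=
  (NLP.hasGradientAt_augSmooth_prox T.comp.g_diff T.comp.f_diff q.ρ c hβ p x).gradient

lemma differentiable_aug (T : Setting P C q) (c : Vec n) {β : ℝ} (hβ : 0 < β) (p : Dual l m) :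
    Differentiable ℝ ((P.prox q.ρ c).augSmooth β p) := fun x =>
  (NLP.hasGradientAt_augSmooth_prox T.comp.g_diff T.comp.f_diff q.ρ c hβ p x).differentiableAt

lemma lag_strong (T : Setting P C q) (c : Vec n) {p : Dual l m} (hp : ∀ i, 0 ≤ p.2 i)
    (u w : Vec n) : P.lag q.ρ c p u + ⟪P.lagGrad q.ρ c p u, w - u⟫_ℝ + q.ρ / 2 * ‖w - u‖ ^ 2
      ≤ P.lag q.ρ c p w :=
  NLP.lag_strong T.comp.g_diff T.weak T.comp.f_diff T.comp.f_convex c hp u w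

lemma aug_strong (T : Setting P C q) (c : Vec n) {β : ℝ} (hβ : 0 < β) (p : Dual l m)
    (u w : Vec n) : (P.prox q.ρ c).augSmooth β p u
      + ⟪gradient ((P.prox q.ρ c).augSmooth β p) u, w - u⟫_ℝ + q.ρ / 2 * ‖w - u‖ ^ 2
      ≤ (P.prox q.ρ c).augSmooth β p w := by
  have h1 := T.lag_strong c (P.dualStep_nonneg β p u) u w
  have h2 := NLP.penalty_add_le (P := P) hβ p u w
  rw [T.gradient_aug c hβ, NLP.augSmooth_prox, NLP.augSmooth_prox]
  rw [inner_sub_right, inner_sub_right] at h2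
  unfold NLP.lag at h1
  linarith

/-- Lipschitz constant of the gradient of the augmented Lagrangian. -/
noncomputable def augLip (P : NLP n l m) (C : Consts n m) (q : Params) (β ζ : ℝ) : ℝ :=
  C.L₀ + 2 * q.ρ + β * Lc P C + ζ * Lsum C

lemma aug_lipschitz (T : Setting P C q) (c : Vec n) {β : ℝ} (hβ : 0 < β) (p : Dual l m)
    {u v : Vec n} (hu : u ∈ extrapSet P.X q.γ₂) (hv : v ∈ extrapSet P.X q.γ₂) :
    ‖gradient ((P.prox q.ρ c).augSmooth β p) u - gradient ((P.prox q.ρ c).augSmooth β p) v‖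
      ≤ augLip P C q β ‖p.2‖ * ‖u - v‖ := by
  rw [T.gradient_aug c hβ, T.gradient_aug c hβ]
  set d := ‖u - v‖ with hd
  have hd0 : 0 ≤ d := norm_nonneg _
  have hA : ‖Matrix.toEuclideanLin P.Aᵀ (P.dualStep β p u).1
      - Matrix.toEuclideanLin P.Aᵀ (P.dualStep β p v).1‖
      ≤ β * (‖Matrix.toEuclideanCLM (𝕜 := ℝ) (P.Aᵀ * P.A)‖ * d) := by
    have e : (P.dualStep β p u).1 - (P.dualStep β p v).1
        = β • Matrix.toEuclideanLin P.A (u - v) := by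
      rw [← NLP.res_sub]; simp only [NLP.dualStep]; module
    rw [← map_sub, e, map_smul, norm_smul, Real.norm_of_nonneg hβ.le]
    exact mul_le_mul_of_nonneg_left (P.norm_transpose_mul_le _) hβ.le
  have hF : ∀ i, ‖(P.dualStep β p u).2 i • gradient (P.f i) u
      - (P.dualStep β p v).2 i • gradient (P.f i) v‖
      ≤ β * (C.B i * (C.B i + C.L i)) * d + |p.2 i| * C.L i * d := by
    intro i
    have hB := T.B_nonneg i
    have hL := T.comp.L_nonneg i
    have e : (P.dualStep β p u).2 i • gradient (P.f i) u
        - (P.dualStep β p v).2 i • gradient (P.f i) v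
        = (P.dualStep β p u).2 i • (gradient (P.f i) u - gradient (P.f i) v)
          + ((P.dualStep β p u).2 i - (P.dualStep β p v).2 i) • gradient (P.f i) v := by module
    have h1 : |(P.dualStep β p u).2 i| ≤ |p.2 i| + β * C.B i := by
      rw [abs_of_nonneg (P.dualStep_nonneg β p u i)]
      simp only [NLP.dualStep, posVec, NLP.fvec, PiLp.add_apply, PiLp.smul_apply, smul_eq_mul]
      have h2 := mul_le_mul_of_nonneg_left ((le_abs_self _).trans (T.abs_f_le i hu)) hβ.le
      exact max_le (add_le_add (le_abs_self _) h2) (by positivity)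
    have h2 : |(P.dualStep β p u).2 i - (P.dualStep β p v).2 i| ≤ β * (C.B i * d) := by
      simp only [NLP.dualStep, posVec, NLP.fvec, PiLp.add_apply, PiLp.smul_apply, smul_eq_mul]
      refine (abs_max_sub_max_le_abs _ _ _).trans ?_
      rw [add_sub_add_left_eq_sub, ← mul_sub, abs_mul, abs_of_pos hβ]
      exact mul_le_mul_of_nonneg_left (T.abs_f_sub_le i hu hv) hβ.le
    have h3 := T.comp.f_lip i u hu v hv
    have h4 := T.norm_gradient_f_le i hv
    rw [e]
    refine (norm_add_le _ _).trans ?_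
    rw [norm_smul, norm_smul, Real.norm_eq_abs, Real.norm_eq_abs]
    calc _ ≤ (|p.2 i| + β * C.B i) * (C.L i * d) + β * (C.B i * d) * C.B i := by gcongr
      _ = _ := by ring
  have hcs : ∑ i, |p.2 i| * C.L i ≤ ‖p.2‖ * Lsum C := by
    have := Real.sum_mul_le_sqrt_mul_sqrt Finset.univ (fun i => |p.2 i|) C.L
    simp only [sq_abs] at this
    rw [← EuclideanSpace.real_norm_sq_eq, Real.sqrt_sq (norm_nonneg _)] at this
    exact this
  have hsum : ‖∑ i, (P.dualStep β p u).2 i • gradient (P.f i) u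
      - ∑ i, (P.dualStep β p v).2 i • gradient (P.f i) v‖
      ≤ β * (∑ i, C.B i * (C.B i + C.L i)) * d + ‖p.2‖ * Lsum C * d := by
    rw [← Finset.sum_sub_distrib]
    refine (norm_sum_le_of_le _ fun i _ => hF i).trans ?_
    rw [Finset.sum_add_distrib, ← Finset.sum_mul, ← Finset.sum_mul, ← Finset.mul_sum]
    gcongr
  have hg := T.comp.g_lip u hu v hv
  have hc : ‖(2 * q.ρ) • (u - c) - (2 * q.ρ) • (v - c)‖ = 2 * q.ρ * d := by
    have : (2 * q.ρ) • (u - c) - (2 * q.ρ) • (v - c) = (2 * q.ρ) • (u - v) := by module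
    rw [this, norm_smul, Real.norm_of_nonneg (by linarith [T.ρ_pos])]
  have e : P.lagGrad q.ρ c (P.dualStep β p u) u - P.lagGrad q.ρ c (P.dualStep β p v) v
      = (gradient P.g u - gradient P.g v) + ((2 * q.ρ) • (u - c) - (2 * q.ρ) • (v - c))
        + (Matrix.toEuclideanLin P.Aᵀ (P.dualStep β p u).1
          - Matrix.toEuclideanLin P.Aᵀ (P.dualStep β p v).1)
        + (∑ i, (P.dualStep β p u).2 i • gradient (P.f i) u
          - ∑ i, (P.dualStep β p v).2 i • gradient (P.f i) v) := by
    unfold NLP.lagGrad; abel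
  rw [e]
  refine (norm_add₄_le ..).trans ?_
  unfold augLip Lc
  rw [hc]
  linarith

/-- Minimizers of `G + h` over the domain, for continuous `G`. -/
lemma exists_min (T : Setting P C q) {G : Vec n → ℝ} (hG : Continuous G) :
    ∃ x ∈ P.X, ∀ u ∈ P.X, G x + P.h x ≤ G u + P.h u :=
  exists_forall_add_le T.isCompact_X ⟨_, T.xfeas_mem⟩ T.lowerSemicontinuousOn_h hG

lemma exists_apgModel (T : Setting P C q) (c : Vec n) {β : ℝ} (hβ : q.β₀ ≤ β) (p : Dual l m)
    {ζ : ℝ} (hζ : ‖p.2‖ ≤ ζ) : ∃ xs, ApgModel ((P.prox q.ρ c).augSmooth β p) P.X P.h xs q.ρ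
      (augLip P C q β ζ) q.Lmin q.γ₁ q.γ₂ (diamD P) := by
  have hβ0 : 0 < β := T.β₀_pos.trans_le hβ
  have hd := T.differentiable_aug c hβ0 p
  obtain ⟨xs, hxs, hmin⟩ := T.exists_min hd.continuous
  have hle : augLip P C q β ‖p.2‖ ≤ augLip P C q β ζ := by
    have := Lsum_nonneg C
    unfold augLip; gcongr
  have hlip : ∀ x ∈ extrapSet P.X q.γ₂, ∀ u ∈ extrapSet P.X q.γ₂,
      ‖gradient ((P.prox q.ρ c).augSmooth β p) x - gradient ((P.prox q.ρ c).augSmooth β p) u‖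
        ≤ augLip P C q β ζ * ‖x - u‖ := fun x hx u hu =>
    (T.aug_lipschitz c hβ0 p hx hu).trans (by gcongr)
  refine ⟨xs, T.ρ_pos, T.ρ_le_Lmin, ?_, T.one_lt_γ₁, T.one_le_γ₂, T.comp.h_convex,
    T.aug_strong c hβ0 p, ?_, fun v hv u hu => hlip u (mem_extrapSet_of_mem hu) v hv, ?_, hxs,
    hmin, fun u hu v hv => T.norm_sub_le_diamD hu hv⟩
  · refine T.Lmin_le.trans ?_
    have h1 := mul_le_mul_of_nonneg_right hβ T.Lc_nonneg
    have h2 := mul_nonneg ((norm_nonneg _).trans hζ) (Lsum_nonneg C)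
    unfold augLip
    linarith
  · intro v hv u hu
    exact le_quadratic_of_lipschitz_gradient hd (convex_extrapSet T.convex_X q.γ₂) hlip hv
      (mem_extrapSet_of_mem hu)
  · intro v M hM
    obtain ⟨x, hx, hx'⟩ := T.exists_min (G := fun u =>
      ⟪gradient ((P.prox q.ρ c).augSmooth β p) v, u⟫_ℝ + M / 2 * ‖u - v‖ ^ 2) (by fun_prop)
    exact ⟨x, hx, fun u hu => hx' u hu⟩

end Setting

end Augmented

/-! ### Multipliers of the proximal subproblem -/

section Multipliers

variable {n l m : ℕ}

lemma dualNorm_eq_norm_toLp (p : Dual l m) : dualNorm p = ‖WithLp.toLp 2 p‖ := by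
  rw [WithLp.prod_norm_eq_of_L2]; rfl

lemma dualNorm_nonneg (p : Dual l m) : 0 ≤ dualNorm p := Real.sqrt_nonneg _

lemma dualNorm_sq (p : Dual l m) : dualNorm p ^ 2 = ‖p.1‖ ^ 2 + ‖p.2‖ ^ 2 :=
  Real.sq_sqrt (by positivity)

lemma norm_snd_le_dualNorm (p : Dual l m) : ‖p.2‖ ≤ dualNorm p :=
  Real.le_sqrt_of_sq_le (by nlinarith [sq_nonneg ‖p.1‖])

lemma dualNorm_add_le (p p' : Dual l m) : dualNorm (p + p') ≤ dualNorm p + dualNorm p' := by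
  simp only [dualNorm_eq_norm_toLp, WithLp.toLp_add]
  exact norm_add_le _ _

lemma dualNorm_sub_rev (p p' : Dual l m) : dualNorm (p - p') = dualNorm (p' - p) := by
  simp only [dualNorm, Prod.fst_sub, Prod.snd_sub, norm_sub_rev]

lemma dualNorm_sub_le (p p' : Dual l m) : dualNorm (p - p') ≤ dualNorm p + dualNorm p' := by
  simp only [dualNorm_eq_norm_toLp, WithLp.toLp_sub]
  exact norm_sub_le _ _

lemma abs_dual_inner_le (p p' : Dual l m) :
    |⟪p.1, p'.1⟫_ℝ + ⟪p.2, p'.2⟫_ℝ| ≤ dualNorm p * dualNorm p' := by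
  simp only [dualNorm_eq_norm_toLp]
  have := abs_real_inner_le_norm (WithLp.toLp 2 p) (WithLp.toLp 2 p')
  rwa [WithLp.prod_inner_apply] at this

lemma norm_le_sum_of_nonneg {z : Vec m} (hz : ∀ i, 0 ≤ z i) : ‖z‖ ≤ ∑ i, z i := by
  have h : z = ∑ i, z i • EuclideanSpace.single i (1 : ℝ) := by
    ext j
    simp [Finset.sum_apply, Pi.single_apply]
  calc ‖z‖ = ‖∑ i, z i • EuclideanSpace.single i (1 : ℝ)‖ := by rw [← h]
    _ ≤ ∑ i, z i := norm_sum_le_of_le _ fun i _ => by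
      rw [norm_smul, Real.norm_of_nonneg (hz i)]; simp

lemma le_one_norm_of_coord (z : Vec m) (i : Fin m) : z i ≤ ‖z‖ :=
  (le_abs_self _).trans (by simpa using PiLp.norm_apply_le z i)

namespace NLP

variable (P : NLP n l m)

/-- The eigenvalues of `A Aᵀ` control `Aᵀ` from below. -/
lemma lamMin_mul_le (y : Vec l) :
    lamMin P * ‖y‖ ^ 2 ≤ ‖Matrix.toEuclideanLin P.Aᵀ y‖ ^ 2 := by
  set hH := Matrix.isHermitian_mul_conjTranspose_self P.A with hHdef
  set b := hH.eigenvectorBasis with hb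
  have heig : ∀ i, Matrix.toEuclideanLin P.A (Matrix.toEuclideanLin P.Aᵀ (b i))
      = hH.eigenvalues i • b i := by
    intro i
    have := hH.mulVec_eigenvectorBasis i
    ext j
    have h2 := congrFun this j
    simpa [Matrix.toLpLin_apply, Matrix.mulVec_mulVec, hb,
      Matrix.conjTranspose_eq_transpose_of_trivial] using h2
  have h1 : ‖Matrix.toEuclideanLin P.Aᵀ y‖ ^ 2 = ∑ i, hH.eigenvalues i * ⟪b i, y⟫_ℝ ^ 2 := by
    rw [← real_inner_self_eq_norm_sq, inner_transpose, ← b.sum_inner_mul_inner]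
    refine Finset.sum_congr rfl fun i _ => ?_
    have h : ⟪b i, Matrix.toEuclideanLin P.A (Matrix.toEuclideanLin P.Aᵀ y)⟫_ℝ
        = hH.eigenvalues i * ⟪y, b i⟫_ℝ := by
      rw [← inner_transpose, real_inner_comm, inner_transpose, heig, inner_smul_right]
    rw [h, real_inner_comm (b i) y]
    ring
  have h2 : ‖y‖ ^ 2 = ∑ i, ⟪b i, y⟫_ℝ ^ 2 := by
    rw [← real_inner_self_eq_norm_sq, ← b.sum_inner_mul_inner]
    refine Finset.sum_congr rfl fun i _ => ?_
    rw [real_inner_comm (b i) y]; ring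
  rw [h1, h2, Finset.mul_sum]
  refine Finset.sum_le_sum fun i _ => ?_
  refine mul_le_mul_of_nonneg_right ?_ (sq_nonneg _)
  exact ciInf_le (Set.finite_range _).bddBelow i

lemma lamMin_pos (hr : P.A.rank = l) (hl : l ≠ 0) : 0 < lamMin P := by
  have : Nonempty (Fin l) := Fin.pos_iff_nonempty.1 (Nat.pos_of_ne_zero hl)
  set hH := Matrix.isHermitian_mul_conjTranspose_self P.A with hHdef
  have hcard := hH.rank_eq_card_non_zero_eigs
  rw [Matrix.rank_self_mul_conjTranspose, hr] at hcard
  have hne : ∀ i, hH.eigenvalues i ≠ 0 := by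
    intro i hi
    have : Fintype.card {i // hH.eigenvalues i ≠ 0} < Fintype.card (Fin l) :=
      Fintype.card_subtype_lt (x := i) (by simpa using hi)
    rw [Fintype.card_fin] at this
    omega
  obtain ⟨i, hi⟩ := exists_eq_ciInf_of_finite (f := hH.eigenvalues)
  rw [lamMin, ← hi]
  exact lt_of_le_of_ne (Matrix.eigenvalues_self_mul_conjTranspose_nonneg P.A i) (hne i).symm

lemma norm_le_of_transpose (hr : P.A.rank = l) (y : Vec l) :
    ‖y‖ ≤ Real.sqrt (lamMax P) / lamMin P * ‖Matrix.toEuclideanLin P.Aᵀ y‖ := by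
  rcases eq_or_ne l 0 with rfl | hl
  · have : y = 0 := Subsingleton.elim _ _
    simp [this]
  have hpos := P.lamMin_pos hr hl
  have : Nonempty (Fin l) := Fin.pos_iff_nonempty.1 (Nat.pos_of_ne_zero hl)
  have hle : lamMin P ≤ lamMax P :=
    (ciInf_le (Set.finite_range _).bddBelow (Classical.arbitrary (Fin l))).trans
      (le_ciSup (f := (Matrix.isHermitian_mul_conjTranspose_self P.A).eigenvalues)
        (Set.finite_range _).bddAbove (Classical.arbitrary (Fin l)))
  have h1 : Real.sqrt (lamMin P) * ‖y‖ ≤ ‖Matrix.toEuclideanLin P.Aᵀ y‖ := by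
    apply le_of_sq_le_sq _ (norm_nonneg _)
    rw [mul_pow, Real.sq_sqrt hpos.le]
    exact P.lamMin_mul_le y
  have h2 : ‖y‖ = Real.sqrt (lamMin P) / lamMin P * (Real.sqrt (lamMin P) * ‖y‖) := by
    have := Real.mul_self_sqrt hpos.le
    field_simp
    rw [sq, this]
  rw [h2]
  have := Real.sqrt_le_sqrt hle
  gcongr

end NLP

namespace Setting

variable {P : NLP n l m} {C : Consts n m} {q : Params}

/-- A ball around the Slater point lies in the domain, so normal vectors point away from it. -/
lemma infDist_mul_norm_le (T : Setting P C q) {x w : Vec n} (hw : w ∈ normalCone P.X x) :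
    Metric.infDist C.xfeas (frontier P.X) * ‖w‖ ≤ -⟪w, C.xfeas - x⟫_ℝ := by
  set r := Metric.infDist C.xfeas (frontier P.X) with hr
  rcases eq_or_ne w 0 with rfl | hw0
  · simp
  have hwn : 0 < ‖w‖ := norm_pos_iff.2 hw0
  have key : ∀ t : ℝ, 0 ≤ t → t < r → t * ‖w‖ ≤ -⟪w, C.xfeas - x⟫_ℝ := by
    intro t ht htr
    have hball : Metric.ball C.xfeas r ⊆ P.X := by
      refine ((convex_ball C.xfeas r).isPreconnected.subset_of_closure_inter_subset
        isOpen_interior ⟨C.xfeas, Metric.mem_ball_self (ht.trans_lt htr), T.slater.mem⟩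
        ?_).trans interior_subset
      rintro a ⟨ha, har⟩
      by_contra hc
      have h1 := Metric.infDist_le_dist_of_mem (x := C.xfeas)
        (show a ∈ frontier P.X from ⟨closure_mono interior_subset ha, hc⟩)
      rw [Metric.mem_ball, dist_comm] at har
      linarith
    have hmem : C.xfeas + (t / ‖w‖) • w ∈ P.X := by
      apply hball
      rw [Metric.mem_ball, dist_eq_norm, add_sub_cancel_left, norm_smul,
        Real.norm_of_nonneg (by positivity), div_mul_cancel₀ _ hwn.ne']
      exact htr
    have h1 := hw.2 _ hmem
    have e : C.xfeas + (t / ‖w‖) • w - x = (C.xfeas - x) + (t / ‖w‖) • w := by abel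
    rw [e, inner_add_right, inner_smul_right, real_inner_self_eq_norm_sq] at h1
    have : t / ‖w‖ * ‖w‖ ^ 2 = t * ‖w‖ := by field_simp
    linarith
  rcases (Metric.infDist_nonneg (x := C.xfeas) (s := frontier P.X)).eq_or_lt with h0 | h0
  · rw [← hr] at h0
    rw [← h0, zero_mul]
    have := hw.2 _ T.xfeas_mem
    linarith
  · rw [← le_div_iff₀ hwn]
    refine le_of_forall_lt_imp_le_of_dense fun t ht => ?_
    rcases le_total 0 t with h | h
    · rw [le_div_iff₀ hwn]; exact key t h ht
    · exact h.trans (div_nonneg (by linarith [hw.2 _ T.xfeas_mem]) hwn.le)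

lemma infDist_pos_or (T : Setting P C q) {x w : Vec n} (hw : w ∈ normalCone P.X x) :
    0 < Metric.infDist C.xfeas (frontier P.X) ∨ w = 0 := by
  rcases (frontier P.X).eq_empty_or_nonempty with h | h
  · right
    have hX : P.X = Set.univ := by
      rcases (frontier_eq_empty_iff (s := P.X)).1 h with h' | h'
      · exact absurd T.xfeas_mem (by simp [h'])
      · exact h'
    have := hw.2 (x + w) (hX ▸ Set.mem_univ _)
    rw [add_sub_cancel_left, real_inner_self_eq_norm_sq] at this
    have h3 : ‖w‖ = 0 := by nlinarith [sq_nonneg ‖w‖]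
    exact norm_eq_zero.1 h3
  · left
    exact (isClosed_frontier.notMem_iff_infDist_pos h).1 fun hc => hc.2 T.slater.mem

lemma slaterGap_le (T : Setting P C q) (i : Fin m) : slaterGap P C ≤ -P.f i C.xfeas := by
  rw [← abs_of_neg (T.slater.lt i)]
  exact ciInf_le (Set.finite_range (fun i => |P.f i C.xfeas|)).bddBelow i

lemma slaterGap_pos (T : Setting P C q) (i : Fin m) : 0 < slaterGap P C := by
  have : Nonempty (Fin m) := ⟨i⟩
  obtain ⟨j, hj⟩ := exists_eq_ciInf_of_finite (f := fun i => |P.f i C.xfeas|)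
  rw [slaterGap, ← hj]
  exact abs_pos.2 (T.slater.lt j).ne

/-- Multipliers for which the Lagrangian is stationary, at a point where both constraint terms of
the Lagrangian are nonnegative, are bounded by `My` and `Mz`: test stationarity with the Slater
point. -/
lemma multiplier_bound (T : Setting P C q) {c x v : Vec n} (hc : c ∈ P.X)
    (hv : v ∈ subdiff P.X P.h x) {p : Dual l m} (hp : ∀ i, 0 ≤ p.2 i)
    (hst : P.lagGrad q.ρ c p x + v = 0) (hy : 0 ≤ ⟪p.1, P.res x⟫_ℝ)
    (hz : 0 ≤ ⟪p.2, P.fvec x⟫_ℝ) : ‖p.1‖ ≤ My P C q ∧ ‖p.2‖ ≤ Mz P C q := by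
  have hx : x ∈ P.X := hv.1
  obtain ⟨w, hw, hvw⟩ := T.unif.subdiff_sub x hx v hv
  have hρ := T.ρ_pos
  have hM := T.unif.M_nonneg
  have hB₀ := T.B₀_nonneg
  set D := diamD P with hD
  have hD0 : 0 ≤ D := diamD_nonneg P
  have hd : ‖C.xfeas - x‖ ≤ D := T.norm_sub_le_diamD T.xfeas_mem hx
  set R := C.B₀ + q.ρ * D + C.M with hR
  have hR0 : 0 ≤ R := by positivity
  set r := Metric.infDist C.xfeas (frontier P.X) with hr
  set gap := slaterGap P C with hgap
  set Z := ∑ i, p.2 i with hZ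
  have hZ0 : 0 ≤ Z := Finset.sum_nonneg fun i _ => hp i
  -- the tested stationarity condition
  have hmain : r * ‖w‖ + gap * Z ≤ D * R := by
    have h0 : ⟪P.lagGrad q.ρ c p x + v, C.xfeas - x⟫_ℝ = 0 := by rw [hst, inner_zero_left]
    have e : v = (v - w) + w := by abel
    rw [e, inner_add_left, inner_add_left, NLP.lagGrad, inner_add_left, inner_add_left,
      inner_add_left, inner_smul_left, NLP.inner_transpose, ← NLP.res_sub, T.slater.eq,
      zero_sub, inner_neg_right, sum_inner] at h0
    simp only [conj_trivial, inner_smul_left] at h0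
    have h1 : ⟪gradient P.g x, C.xfeas - x⟫_ℝ ≤ C.B₀ * D :=
      (real_inner_le_norm _ _).trans
        (mul_le_mul (T.norm_gradient_g_le hx) hd (norm_nonneg _) hB₀)
    have h2 : 2 * ⟪x - c, C.xfeas - x⟫_ℝ ≤ D ^ 2 := by
      have e : C.xfeas - c = (x - c) + (C.xfeas - x) := by abel
      have h := norm_add_sq_real (x - c) (C.xfeas - x)
      rw [← e] at h
      have h' : ‖C.xfeas - c‖ ^ 2 ≤ D ^ 2 := by
        gcongr; exact T.norm_sub_le_diamD T.xfeas_mem hc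
      nlinarith [sq_nonneg ‖x - c‖, sq_nonneg ‖C.xfeas - x‖]
    have h3 : ∑ i, p.2 i * ⟪gradient (P.f i) x, C.xfeas - x⟫_ℝ ≤ -(gap * Z) := by
      have : ∑ i, p.2 i * ⟪gradient (P.f i) x, C.xfeas - x⟫_ℝ
          ≤ ∑ i, (-(gap * p.2 i) - p.2 i * P.f i x) := by
        refine Finset.sum_le_sum fun i _ => ?_
        have a1 := ConvexOn.add_inner_gradient_le (T.comp.f_convex i) (T.comp.f_diff i) x C.xfeas
        have a2 := T.slaterGap_le i
        have a3 := mul_le_mul_of_nonneg_left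
          (show ⟪gradient (P.f i) x, C.xfeas - x⟫_ℝ ≤ -gap - P.f i x by linarith) (hp i)
        linarith
      rw [Finset.sum_sub_distrib, Finset.sum_neg_distrib, ← Finset.mul_sum] at this
      rw [inner_vec_eq_sum] at hz
      simp only [NLP.fvec] at hz
      linarith
    have h4 : ⟪v - w, C.xfeas - x⟫_ℝ ≤ C.M * D :=
      (real_inner_le_norm _ _).trans (mul_le_mul hvw hd (norm_nonneg _) hM)
    have h5 := T.infDist_mul_norm_le hw
    have h6 := mul_le_mul_of_nonneg_left h2 hρ.le
    rw [hR]
    nlinarith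
  have hgap0 : 0 ≤ gap := Real.iInf_nonneg fun i => abs_nonneg _
  have hw' : ‖w‖ ≤ D * R / r := by
    rcases T.infDist_pos_or hw with h | h
    · rw [le_div_iff₀ h]
      nlinarith [mul_nonneg hgap0 hZ0]
    · rw [h, norm_zero]
      exact div_nonneg (by positivity) Metric.infDist_nonneg
  have hZ' : Z ≤ D * R / gap := by
    rcases isEmpty_or_nonempty (Fin m) with h | ⟨⟨i⟩⟩
    · rw [hZ, Finset.univ_eq_empty, Finset.sum_empty]
      positivity
    · rw [le_div_iff₀ (T.slaterGap_pos i)]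
      nlinarith [mul_nonneg (Metric.infDist_nonneg (x := C.xfeas) (s := frontier P.X))
        (norm_nonneg w)]
  refine ⟨?_, (norm_le_sum_of_nonneg hp).trans hZ'⟩
  have hsupB : ∀ i, C.B i ≤ ⨆ i, C.B i := fun i => le_ciSup (Set.finite_range _).bddAbove i
  have hsup0 : 0 ≤ ⨆ i, C.B i := Real.iSup_nonneg T.B_nonneg
  have hA : ‖Matrix.toEuclideanLin P.Aᵀ p.1‖ ≤ (C.B₀ + 2 * q.ρ * D + C.M)
      * (1 + D / r + D * (⨆ i, C.B i) / gap) := by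
    have e : Matrix.toEuclideanLin P.Aᵀ p.1 = -(gradient P.g x + (2 * q.ρ) • (x - c)
        + ∑ i, p.2 i • gradient (P.f i) x + (v - w) + w) := by
      have : Matrix.toEuclideanLin P.Aᵀ p.1 = (P.lagGrad q.ρ c p x + v)
          - (gradient P.g x + (2 * q.ρ) • (x - c)
            + ∑ i, p.2 i • gradient (P.f i) x + (v - w) + w) := by
        unfold NLP.lagGrad; abel
      rw [this, hst, zero_sub]
    have h1 : ‖(2 * q.ρ) • (x - c)‖ ≤ 2 * q.ρ * D := by
      rw [norm_smul, Real.norm_of_nonneg (by positivity)]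
      have := T.norm_sub_le_diamD hx hc
      gcongr
    have h2 : ‖∑ i, p.2 i • gradient (P.f i) x‖ ≤ (⨆ i, C.B i) * Z := by
      rw [hZ, Finset.mul_sum]
      refine norm_sum_le_of_le _ fun i _ => ?_
      rw [norm_smul, Real.norm_of_nonneg (hp i), mul_comm]
      exact mul_le_mul_of_nonneg_right
        ((T.norm_gradient_f_le i (mem_extrapSet_of_mem hx)).trans (hsupB i)) (hp i)
    have h3 : ‖Matrix.toEuclideanLin P.Aᵀ p.1‖
        ≤ C.B₀ + 2 * q.ρ * D + (⨆ i, C.B i) * Z + C.M + ‖w‖ := by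
      rw [e, norm_neg]
      refine (norm_add_le _ _).trans (add_le_add ?_ le_rfl)
      refine (norm_add_le _ _).trans (add_le_add ?_ hvw)
      refine (norm_add_le _ _).trans (add_le_add ?_ h2)
      exact (norm_add_le _ _).trans (add_le_add (T.norm_gradient_g_le hx) h1)
    have hRR : R ≤ C.B₀ + 2 * q.ρ * D + C.M := by
      rw [hR]; nlinarith [mul_nonneg hρ.le hD0]
    have h4 : D * R / r ≤ (C.B₀ + 2 * q.ρ * D + C.M) * (D / r) := by
      have : 0 ≤ D / r := div_nonneg hD0 Metric.infDist_nonneg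
      calc D * R / r = R * (D / r) := by ring
        _ ≤ _ := mul_le_mul_of_nonneg_right hRR this
    have h5 : (⨆ i, C.B i) * Z
        ≤ (C.B₀ + 2 * q.ρ * D + C.M) * (D * (⨆ i, C.B i) / gap) := by
      have : 0 ≤ D * (⨆ i, C.B i) / gap := by positivity
      calc (⨆ i, C.B i) * Z ≤ (⨆ i, C.B i) * (D * R / gap) := by gcongr
        _ = R * (D * (⨆ i, C.B i) / gap) := by ring
        _ ≤ _ := mul_le_mul_of_nonneg_right hRR this
    linarith
  refine (P.norm_le_of_transpose T.unif.full_rank p.1).trans ?_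
  unfold My
  rw [mul_assoc (Real.sqrt (lamMax P) / lamMin P)]
  refine mul_le_mul_of_nonneg_left hA ?_
  rcases eq_or_ne l 0 with rfl | hl
  · simp [lamMin]
  · exact div_nonneg (Real.sqrt_nonneg _) (P.lamMin_pos T.unif.full_rank hl).le

/-- A saddle point of the proximal subproblem with centre `c`, with multipliers bounded by
`Mp`. -/
structure Saddle (P : NLP n l m) (C : Consts n m) (q : Params) (c xs : Vec n) (ps : Dual l m) :
    Prop where
  mem : xs ∈ P.X
  eq : P.res xs = 0
  le : ∀ i, P.f i xs ≤ 0
  nonneg : ∀ i, 0 ≤ ps.2 i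
  norm_le : dualNorm ps ≤ Mp P C q
  min_le : ∀ u ∈ P.X, P.g xs + q.ρ * ‖xs - c‖ ^ 2 + P.h xs ≤ P.lag q.ρ c ps u + P.h u

/-- Saddle points arise as limits of the minimizers of penalized problems and the multipliers
that the penalty terms define. -/
lemma exists_saddle (T : Setting P C q) {c : Vec n} (hc : c ∈ P.X) :
    ∃ xs ps, Saddle P C q c xs ps := by
  have hβ : ∀ k : ℕ, (0 : ℝ) < k + 1 := fun k => by positivity
  choose x hxX hxmin using fun k : ℕ => T.exists_min
    (T.differentiable_aug c (hβ k) (0 : Dual l m)).continuous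
  set p : ℕ → Dual l m := fun k => P.dualStep (k + 1) 0 (x k) with hpdef
  have hp0 : ∀ k i, 0 ≤ (p k).2 i := fun k i => P.dualStep_nonneg _ _ _ i
  have hp1 : ∀ k, (p k).1 = ((k : ℝ) + 1) • P.res (x k) := fun k => by simp [hpdef, NLP.dualStep]
  have hp2 : ∀ k i, (p k).2 i = max (((k : ℝ) + 1) * P.f i (x k)) 0 := fun k i => by
    simp [hpdef, NLP.dualStep, posVec, NLP.fvec]
  have hy : ∀ k, 0 ≤ ⟪(p k).1, P.res (x k)⟫_ℝ := fun k => by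
    rw [hp1, inner_smul_left, real_inner_self_eq_norm_sq]
    exact mul_nonneg (hβ k).le (sq_nonneg _)
  have hz : ∀ k, 0 ≤ ⟪(p k).2, P.fvec (x k)⟫_ℝ := fun k => by
    rw [inner_vec_eq_sum]
    refine Finset.sum_nonneg fun i _ => ?_
    rw [hp2]
    have e : (P.fvec (x k)) i = P.f i (x k) := rfl
    rw [e]
    rcases le_total (P.f i (x k)) 0 with h | h
    · rw [max_eq_right (mul_nonpos_of_nonneg_of_nonpos (hβ k).le h)]; simp
    · exact mul_nonneg (le_max_right _ _) h
  have hsub : ∀ k, -P.lagGrad q.ρ c (p k) (x k) ∈ subdiff P.X P.h (x k) := by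
    intro k
    have := neg_mem_subdiff_of_isMinOn (a := gradient ((P.prox q.ρ c).augSmooth (k + 1) 0) (x k))
      (c := augLip P C q (k + 1) ‖(0 : Dual l m).2‖ / 2) T.comp.h_convex (hxX k) (hxmin k)
      (fun u hu => le_quadratic_of_lipschitz_gradient (T.differentiable_aug c (hβ k) 0)
        (convex_extrapSet T.convex_X q.γ₂)
        (fun a ha b hb => T.aug_lipschitz c (hβ k) 0 ha hb)
        (mem_extrapSet_of_mem (hxX k)) (mem_extrapSet_of_mem hu))
    rwa [T.gradient_aug c (hβ k)] at this
  have hbd : ∀ k, ‖(p k).1‖ ≤ My P C q ∧ ‖(p k).2‖ ≤ Mz P C q := fun k =>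
    T.multiplier_bound hc (hsub k) (hp0 k) (add_neg_cancel _) (hy k) (hz k)
  have hineq : ∀ k, ∀ u ∈ P.X,
      P.g (x k) + q.ρ * ‖x k - c‖ ^ 2 + P.h (x k) ≤ P.lag q.ρ c (p k) u + P.h u := by
    intro k u hu
    have h1 := T.lag_strong c (hp0 k) (x k) u
    have h2 := (hsub k).2 u hu
    have h3 : P.g (x k) + q.ρ * ‖x k - c‖ ^ 2 ≤ P.lag q.ρ c (p k) (x k) := by
      unfold NLP.lag; linarith [hy k, hz k]
    have h4 : 0 ≤ q.ρ / 2 * ‖u - x k‖ ^ 2 := by have := T.ρ_pos; positivity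
    rw [inner_neg_left] at h2
    linarith
  have hK : IsCompact (P.X ×ˢ (Metric.closedBall (0 : Vec l) (My P C q)
      ×ˢ Metric.closedBall (0 : Vec m) (Mz P C q))) :=
    T.isCompact_X.prod ((isCompact_closedBall _ _).prod (isCompact_closedBall _ _))
  obtain ⟨⟨xs, ps⟩, hmem, φ, hφ, hlim⟩ := hK.tendsto_subseq (x := fun k => (x k, p k))
    (fun k => ⟨hxX k, by simpa using (hbd k).1, by simpa using (hbd k).2⟩)
  have hlx : Filter.Tendsto (fun k => x (φ k)) Filter.atTop (𝓝 xs) :=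
    (continuous_fst.tendsto _).comp hlim
  have hlp : Filter.Tendsto (fun k => p (φ k)) Filter.atTop (𝓝 ps) :=
    (continuous_snd.tendsto _).comp hlim
  have hly : Filter.Tendsto (fun k => (p (φ k)).1) Filter.atTop (𝓝 ps.1) :=
    (continuous_fst.tendsto _).comp hlp
  have hlz : Filter.Tendsto (fun k => (p (φ k)).2) Filter.atTop (𝓝 ps.2) :=
    (continuous_snd.tendsto _).comp hlp
  have hinv : ∀ B : ℝ, Filter.Tendsto (fun k => B / ((φ k : ℝ) + 1)) Filter.atTop (𝓝 0) := by
    intro B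
    have : Filter.Tendsto (fun k : ℕ => B / ((k : ℝ) + 1)) Filter.atTop (𝓝 0) := by
      have := (tendsto_one_div_add_atTop_nhds_zero_nat (𝕜 := ℝ)).const_mul B
      simpa [div_eq_mul_inv] using this
    exact this.comp hφ.tendsto_atTop
  refine ⟨xs, ps, hmem.1, ?_, ?_, ?_, ?_, ?_⟩
  · have h1 : Filter.Tendsto (fun k => P.res (x (φ k))) Filter.atTop (𝓝 (P.res xs)) :=
      (P.continuous_res.tendsto _).comp hlx
    have h2 : Filter.Tendsto (fun k => P.res (x (φ k))) Filter.atTop (𝓝 0) := by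
      refine squeeze_zero_norm (fun k => ?_) (hinv (My P C q))
      rw [le_div_iff₀ (hβ _)]
      have := (hbd (φ k)).1
      rw [hp1, norm_smul, Real.norm_of_nonneg (hβ _).le] at this
      linarith
    exact tendsto_nhds_unique h1 h2
  · intro i
    have h1 : Filter.Tendsto (fun k => P.f i (x (φ k))) Filter.atTop (𝓝 (P.f i xs)) :=
      ((T.comp.f_diff i).continuous.tendsto _).comp hlx
    refine le_of_tendsto_of_tendsto' h1 (hinv (Mz P C q)) fun k => ?_
    rw [le_div_iff₀ (hβ _)]
    have a1 := (le_one_norm_of_coord (p (φ k)).2 i).trans (hbd (φ k)).2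
    rw [hp2] at a1
    have := (le_max_left _ _).trans a1
    linarith
  · intro i
    have h1 : Filter.Tendsto (fun k => (p (φ k)).2 i) Filter.atTop (𝓝 (ps.2 i)) :=
      ((EuclideanSpace.proj i : Vec m →L[ℝ] ℝ).continuous.tendsto _).comp hlz
    exact ge_of_tendsto' h1 fun k => hp0 _ i
  · have h1 : ‖ps.1‖ ≤ My P C q := by simpa using hmem.2.1
    have h2 : ‖ps.2‖ ≤ Mz P C q := by simpa using hmem.2.2
    unfold dualNorm Mp
    gcongr
  · intro u hu
    have h1 : Filter.Tendsto (fun k => P.lag q.ρ c (p (φ k)) u + P.h u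
        - (P.g (x (φ k)) + q.ρ * ‖x (φ k) - c‖ ^ 2)) Filter.atTop
        (𝓝 (P.lag q.ρ c ps u + P.h u - (P.g xs + q.ρ * ‖xs - c‖ ^ 2))) := by
      unfold NLP.lag
      have a1 := hly.inner (𝕜 := ℝ) (tendsto_const_nhds (x := P.res u))
      have a2 := hlz.inner (𝕜 := ℝ) (tendsto_const_nhds (x := P.fvec u))
      have a3 := (T.comp.g_diff.continuous.tendsto _).comp hlx
      have a4 := (((hlx.sub_const c).norm).pow 2).const_mul q.ρ
      exact ((((tendsto_const_nhds (x := P.g u + q.ρ * ‖u - c‖ ^ 2)).add a1).add a2).add_const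
        (P.h u)).sub (a3.add a4)
    -- the epigraph of `h` is closed
    have h2 := T.comp.h_closed.mem_of_tendsto (hlx.prodMk_nhds h1)
      (Filter.Eventually.of_forall fun k => ⟨hxX _, by
        have := hineq (φ k) u hu
        show P.h (x (φ k)) ≤ _
        linarith⟩)
    have := h2.2
    simp only at this
    linarith

end Setting

end Multipliers

/-! ### One step of the method of multipliers -/

section DualStep

variable {n l m : ℕ}

namespace NLP

variable (P : NLP n l m)

/-- The violation of the constraints. -/
noncomputable def feas (x : Vec n) : ℝ := Real.sqrt (‖P.res x‖ ^ 2 + ‖posVec (P.fvec x)‖ ^ 2)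

/-- The value of the constraint terms of the Lagrangian. -/
noncomputable def pairing (p : Dual l m) (x : Vec n) : ℝ := ⟪p.1, P.res x⟫_ℝ + ⟪p.2, P.fvec x⟫_ℝ

lemma feas_nonneg (x : Vec n) : 0 ≤ P.feas x := Real.sqrt_nonneg _

lemma pairing_le {p : Dual l m} (hp : ∀ i, 0 ≤ p.2 i) (x : Vec n) :
    P.pairing p x ≤ dualNorm p * P.feas x := by
  have h1 : ⟪p.2, P.fvec x⟫_ℝ ≤ ⟪p.2, posVec (P.fvec x)⟫_ℝ := by
    rw [inner_vec_eq_sum, inner_vec_eq_sum]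
    exact Finset.sum_le_sum fun i _ => mul_le_mul_of_nonneg_left (le_max_left _ _) (hp i)
  have h2 := (le_abs_self _).trans (abs_dual_inner_le p (P.res x, posVec (P.fvec x)))
  unfold pairing
  exact (add_le_add le_rfl h1).trans h2

lemma dualStep_fst_sub {β : ℝ} (p : Dual l m) (x : Vec n) :
    (P.dualStep β p x - p).1 = β • P.res x := by
  simp [dualStep]

lemma dualStep_snd_mul {β : ℝ} (hβ : 0 < β) (p : Dual l m) (x : Vec n) (i : Fin m) :
    (P.dualStep β p x).2 i * P.f i x
      = (P.dualStep β p x).2 i * ((P.dualStep β p x).2 i - p.2 i) / β := by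
  simp only [dualStep, posVec, fvec, PiLp.add_apply, PiLp.smul_apply, smul_eq_mul]
  rcases le_total (p.2 i + β * P.f i x) 0 with h | h
  · simp [h]
  · rw [max_eq_left h]
    field_simp
    ring

lemma pairing_dualStep {β : ℝ} (hβ : 0 < β) (p : Dual l m) (x : Vec n) :
    P.pairing (P.dualStep β p x) x
      = (⟪(P.dualStep β p x).1, (P.dualStep β p x - p).1⟫_ℝ
        + ⟪(P.dualStep β p x).2, (P.dualStep β p x - p).2⟫_ℝ) / β := by
  rw [add_div, dualStep_fst_sub, inner_smul_right, mul_div_assoc, mul_div_cancel₀ _ hβ.ne',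
    pairing, inner_vec_eq_sum (P.dualStep β p x).2, inner_vec_eq_sum (P.dualStep β p x).2,
    Finset.sum_div]
  congr 1
  exact Finset.sum_congr rfl fun i _ => P.dualStep_snd_mul hβ p x i

lemma neg_le_pairing_dualStep {β : ℝ} (hβ : 0 < β) (p : Dual l m) (x : Vec n) :
    -(dualNorm (P.dualStep β p x) * (dualNorm (P.dualStep β p x - p) / β))
      ≤ P.pairing (P.dualStep β p x) x := by
  rw [P.pairing_dualStep hβ, ← mul_div_assoc, ← neg_div]
  exact div_le_div_of_nonneg_right
    (abs_le.1 (abs_dual_inner_le (P.dualStep β p x) (P.dualStep β p x - p))).1 hβ.le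

lemma feas_le_dualStep {β : ℝ} (hβ : 0 < β) {p : Dual l m} (hp : ∀ i, 0 ≤ p.2 i) (x : Vec n) :
    P.feas x ≤ dualNorm (P.dualStep β p x - p) / β := by
  rw [le_div_iff₀ hβ]
  refine Real.le_sqrt_of_sq_le ?_
  rw [mul_pow, feas, Real.sq_sqrt (by positivity), dualStep_fst_sub, norm_smul,
    Real.norm_of_nonneg hβ.le, add_mul]
  have h : ‖posVec (P.fvec x)‖ ^ 2 * β ^ 2 ≤ ‖(P.dualStep β p x - p).2‖ ^ 2 := by
    rw [norm_posVec_sq, EuclideanSpace.real_norm_sq_eq, Finset.sum_mul]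
    refine Finset.sum_le_sum fun i _ => ?_
    simp only [dualStep, posVec, fvec, Prod.snd_sub, PiLp.add_apply, PiLp.smul_apply,
      PiLp.sub_apply, smul_eq_mul]
    rcases le_total (P.f i x) 0 with h | h
    · rw [max_eq_right h]; simp [sq_nonneg]
    · have h0 : 0 ≤ p.2 i + β * P.f i x := add_nonneg (hp i) (by positivity)
      rw [max_eq_left h, max_eq_left h0]
      exact le_of_eq (by ring)
  linarith

lemma sum_abs_dualStep_le {β : ℝ} (hβ : 0 < β) (p : Dual l m) (x : Vec n) :
    ∑ i, |(P.dualStep β p x).2 i * P.f i x|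
      ≤ dualNorm (P.dualStep β p x) * dualNorm (P.dualStep β p x - p) / β := by
  have h1 : ∑ i, |(P.dualStep β p x).2 i * P.f i x|
      = (∑ i, |(P.dualStep β p x).2 i| * |(P.dualStep β p x - p).2 i|) / β := by
    rw [Finset.sum_div]
    refine Finset.sum_congr rfl fun i _ => ?_
    rw [P.dualStep_snd_mul hβ, abs_div, abs_mul, abs_of_pos hβ]
    rfl
  rw [h1]
  refine div_le_div_of_nonneg_right ?_ hβ.le
  refine (Real.sum_mul_le_sqrt_mul_sqrt _ _ _).trans ?_
  simp only [sq_abs]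
  rw [← EuclideanSpace.real_norm_sq_eq, ← EuclideanSpace.real_norm_sq_eq,
    Real.sqrt_sq (norm_nonneg _), Real.sqrt_sq (norm_nonneg _)]
  exact mul_le_mul (norm_snd_le_dualNorm _) (norm_snd_le_dualNorm _) (norm_nonneg _)
    (dualNorm_nonneg _)

lemma pairing_sub_le {β : ℝ} (p : Dual l m) {ps : Dual l m}
    (hps : ∀ i, 0 ≤ ps.2 i) (x : Vec n) :
    β * (P.pairing ps x - P.pairing (P.dualStep β p x) x)
      ≤ ⟪(ps - P.dualStep β p x).1, (P.dualStep β p x - p).1⟫_ℝ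
        + ⟪(ps - P.dualStep β p x).2, (P.dualStep β p x - p).2⟫_ℝ := by
  have h1 : β * (⟪ps.2, P.fvec x⟫_ℝ - ⟪(P.dualStep β p x).2, P.fvec x⟫_ℝ)
      ≤ ⟪(ps - P.dualStep β p x).2, (P.dualStep β p x - p).2⟫_ℝ := by
    rw [inner_vec_eq_sum, inner_vec_eq_sum, inner_vec_eq_sum, ← Finset.sum_sub_distrib,
      Finset.mul_sum]
    refine Finset.sum_le_sum fun i _ => ?_
    have hz := hps i
    simp only [dualStep, posVec, fvec, Prod.snd_sub, PiLp.add_apply, PiLp.smul_apply,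
      PiLp.sub_apply, smul_eq_mul]
    rcases le_total (p.2 i + β * P.f i x) 0 with h | h
    · rw [max_eq_right h]
      nlinarith
    · rw [max_eq_left h]
      exact le_of_eq (by ring)
  rw [dualStep_fst_sub, inner_smul_right, Prod.fst_sub, inner_sub_left]
  unfold pairing
  linarith

end NLP

namespace Setting

variable {P : NLP n l m} {C : Consts n m} {q : Params}

lemma lag_eq (ρ : ℝ) (c : Vec n) (p : Dual l m) (x : Vec n) :
    P.lag ρ c p x = P.g x + ρ * ‖x - c‖ ^ 2 + P.pairing p x := by
  unfold NLP.lag NLP.pairing; ring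

lemma stationary_aug_iff (T : Setting P C q) (c : Vec n) {β : ℝ} (hβ : 0 < β) (p : Dual l m)
    (δ : ℝ) (u : Vec n) : Stationary ((P.prox q.ρ c).augSmooth β p) P.X P.h δ u
      ↔ ∃ v ∈ subdiff P.X P.h u, ‖P.lagGrad q.ρ c (P.dualStep β p u) u + v‖ ≤ δ := by
  unfold Stationary
  rw [T.gradient_aug c hβ]

/-- Approximate stationarity bounds the Lagrangian from below on the domain. -/
lemma lag_lower (T : Setting P C q) (c : Vec n) {p : Dual l m} (hp : ∀ i, 0 ≤ p.2 i)
    {u v w : Vec n} {δ : ℝ} (hv : v ∈ subdiff P.X P.h u) (hδ : ‖P.lagGrad q.ρ c p u + v‖ ≤ δ)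
    (hw : w ∈ P.X) :
    P.lag q.ρ c p u + P.h u - δ * ‖w - u‖ + q.ρ / 2 * ‖w - u‖ ^ 2 ≤ P.lag q.ρ c p w + P.h w := by
  have h1 := T.lag_strong c hp u w
  have h2 := hv.2 w hw
  have h3 := abs_le.1 (abs_real_inner_le_norm (P.lagGrad q.ρ c p u + v) (w - u))
  have h4 := mul_le_mul_of_nonneg_right hδ (norm_nonneg (w - u))
  rw [inner_add_left] at h3
  linarith [h3.1]

/-- An inexact multiplier step is an inexact proximal point step on the dual problem. -/
lemma dual_contraction (T : Setting P C q) {c xs : Vec n} {ps p : Dual l m}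
    (hS : Saddle P C q c xs ps) {β δ : ℝ} (hβ : 0 < β) {u : Vec n}
    (hst : Stationary ((P.prox q.ρ c).augSmooth β p) P.X P.h δ u) :
    dualNorm (P.dualStep β p u - ps) ^ 2 + dualNorm (P.dualStep β p u - p) ^ 2
      ≤ dualNorm (p - ps) ^ 2 + β * (δ ^ 2 / q.ρ) := by
  obtain ⟨v, hv, hδ⟩ := (T.stationary_aug_iff c hβ p δ u).1 hst
  have hρ := T.ρ_pos
  have hp' := P.dualStep_nonneg β p u
  set p' := P.dualStep β p u with hp'def
  have h1 := T.lag_lower c hp' hv hδ hS.mem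
  have h2 := hS.min_le u hv.1
  have h3 : P.pairing p' xs ≤ 0 := by
    unfold NLP.pairing
    rw [hS.eq, inner_zero_right, zero_add, inner_vec_eq_sum]
    exact Finset.sum_nonpos fun i _ => mul_nonpos_of_nonneg_of_nonpos (hp' i) (hS.le i)
  have h4 : -(δ ^ 2 / (2 * q.ρ)) ≤ -δ * ‖xs - u‖ + q.ρ / 2 * ‖xs - u‖ ^ 2 := by
    have e : -δ * ‖xs - u‖ + q.ρ / 2 * ‖xs - u‖ ^ 2 + δ ^ 2 / (2 * q.ρ)
        = (q.ρ * ‖xs - u‖ - δ) ^ 2 / (2 * q.ρ) := by field_simp; ring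
    have : 0 ≤ (q.ρ * ‖xs - u‖ - δ) ^ 2 / (2 * q.ρ) := by positivity
    linarith
  rw [lag_eq] at h2
  rw [lag_eq, lag_eq] at h1
  have h5 : -(δ ^ 2 / (2 * q.ρ)) ≤ P.pairing ps u - P.pairing p' u := by linarith
  have h6 := (mul_le_mul_of_nonneg_left h5 hβ.le).trans (P.pairing_sub_le p hS.nonneg u)
  rw [← hp'def] at h6
  have h7 : dualNorm (p - ps) ^ 2 = dualNorm (p' - ps) ^ 2 + dualNorm (p' - p) ^ 2
      + 2 * (⟪(ps - p').1, (p' - p).1⟫_ℝ + ⟪(ps - p').2, (p' - p).2⟫_ℝ) := by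
    have e : p - ps = -((ps - p') + (p' - p)) := by abel
    have e1 := norm_add_sq_real (ps - p').1 (p' - p).1
    have e2 := norm_add_sq_real (ps - p').2 (p' - p).2
    have e3 : dualNorm (p' - ps) ^ 2 = dualNorm (ps - p') ^ 2 := by rw [dualNorm_sub_rev]
    rw [e3, dualNorm_sq, dualNorm_sq, dualNorm_sq, e, Prod.fst_neg, Prod.snd_neg, norm_neg,
      norm_neg, Prod.fst_add, Prod.snd_add, e1, e2]
    ring
  have h8 : β * -(δ ^ 2 / (2 * q.ρ)) = -(β * (δ ^ 2 / q.ρ)) / 2 := by field_simp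
  linarith

lemma gradient_prox (T : Setting P C q) (c x : Vec n) :
    gradient (P.prox q.ρ c).g x = gradient P.g x + (2 * q.ρ) • (x - c) := by
  apply HasGradientAt.gradient
  rw [hasGradientAt_iff_hasFDerivAt]
  refine ((T.comp.g_diff x).hasGradientAt.hasFDerivAt.add
    (((hasFDerivAt_id x).sub_const c).norm_sq.const_mul q.ρ)).congr_fderiv ?_
  ext d
  simp [innerSL_apply_apply]
  ring

/-- The approximate KKT conditions of the proximal subproblem. -/
lemma isKKTPair_prox_iff (T : Setting P C q) (c : Vec n) (η : ℝ) (x : Vec n) (p : Dual l m) :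
    (P.prox q.ρ c).IsKKTPair η x p ↔ x ∈ P.X ∧ (∀ i, 0 ≤ p.2 i) ∧ P.feas x ≤ η ∧
      (∃ v ∈ subdiff P.X P.h x, ‖P.lagGrad q.ρ c p x + v‖ ≤ η) ∧
      ∑ i, |p.2 i * P.f i x| ≤ η := by
  have e : ∀ v : Vec n, gradient (P.prox q.ρ c).g x + v
      + Matrix.toEuclideanLin (P.prox q.ρ c).Aᵀ p.1
      + ∑ i, p.2 i • gradient ((P.prox q.ρ c).f i) x = P.lagGrad q.ρ c p x + v := by
    intro v
    rw [T.gradient_prox]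
    unfold NLP.lagGrad
    simp only [NLP.prox]
    abel
  unfold NLP.IsKKTPair
  simp only [e]
  rfl

/-- If the centre is close, the KKT conditions of the subproblem give those of the problem. -/
lemma isKKTPair_of_prox (T : Setting P C q) {c x : Vec n} {p : Dual l m} {η ε : ℝ}
    (h : (P.prox q.ρ c).IsKKTPair η x p) (hη : η ≤ ε / 2) (hε : 0 ≤ ε)
    (hc : ‖x - c‖ ≤ ε / (4 * q.ρ)) : P.IsKKTPair ε x p := by
  obtain ⟨h1, h2, h3, ⟨v, hv, h4⟩, h5⟩ := (T.isKKTPair_prox_iff c η x p).1 h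
  have hρ := T.ρ_pos
  refine ⟨h1, h2, h3.trans (by linarith), ⟨v, hv, ?_⟩, h5.trans (by linarith)⟩
  have e : gradient P.g x + v + Matrix.toEuclideanLin P.Aᵀ p.1
      + ∑ i, p.2 i • gradient (P.f i) x
      = (P.lagGrad q.ρ c p x + v) - (2 * q.ρ) • (x - c) := by
    unfold NLP.lagGrad; abel
  rw [e]
  refine (norm_sub_le _ _).trans ?_
  rw [norm_smul, Real.norm_of_nonneg (by positivity)]
  have : 2 * q.ρ * ‖x - c‖ ≤ ε / 2 := by
    calc 2 * q.ρ * ‖x - c‖ ≤ 2 * q.ρ * (ε / (4 * q.ρ)) := by gcongr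
      _ = ε / 2 := by field_simp; ring
  linarith

/-- Decrease of the penalized objective when the centre is replaced by an approximate minimizer
of the augmented Lagrangian. -/
lemma penalty_descent (T : Setting P C q) {c u : Vec n} (hc : c ∈ P.X) {β δ : ℝ} (hβ : 0 < β)
    {p : Dual l m} (hst : Stationary ((P.prox q.ρ c).augSmooth β p) P.X P.h δ u) :
    P.g u + P.h u + P.penalty β p u + 3 / 2 * q.ρ * ‖u - c‖ ^ 2 - δ * ‖u - c‖
      ≤ P.g c + P.h c + P.penalty β p c := by
  obtain ⟨v, hv, hδ⟩ := hst
  have h1 := T.aug_strong c hβ p u c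
  have h2 := hv.2 c hc
  have h3 := abs_le.1 (abs_real_inner_le_norm
    (gradient ((P.prox q.ρ c).augSmooth β p) u + v) (c - u))
  have h4 := mul_le_mul_of_nonneg_right hδ (norm_nonneg (c - u))
  rw [NLP.augSmooth_prox, NLP.augSmooth_prox, sub_self, norm_zero] at h1
  rw [inner_add_left] at h3
  rw [norm_sub_rev c u] at *
  linarith [h3.1]

/-- Decrease of the objective in a multiplier step with the centre as comparison point. -/
lemma lag_descent (T : Setting P C q) {c u : Vec n} (hc : c ∈ P.X) {β δ : ℝ} (hβ : 0 < β)
    {p : Dual l m} (hst : Stationary ((P.prox q.ρ c).augSmooth β p) P.X P.h δ u) :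
    P.g u + P.h u + 3 / 2 * q.ρ * ‖u - c‖ ^ 2 ≤ P.g c + P.h c + δ * ‖u - c‖
      + dualNorm (P.dualStep β p u) * (dualNorm (P.dualStep β p u - p) / β)
      + dualNorm (P.dualStep β p u) * P.feas c := by
  obtain ⟨v, hv, hδ⟩ := (T.stationary_aug_iff c hβ p δ u).1 hst
  have h1 := T.lag_lower c (P.dualStep_nonneg β p u) hv hδ hc
  have h2 := P.neg_le_pairing_dualStep hβ p u
  have h3 := P.pairing_le (P.dualStep_nonneg β p u) c
  rw [lag_eq, lag_eq, sub_self, norm_zero, norm_sub_rev c u] at h1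
  linarith

end Setting

end DualStep

/-! ### The inexact augmented Lagrangian method -/

section IALMAnalysis

variable {n l m : ℕ}

lemma le_pow_ceil_logb {s y : ℝ} (hs : 1 < s) (hy : 0 < y) : y ≤ s ^ ⌈Real.logb s y⌉₊ := by
  have h := Nat.le_ceil (Real.logb s y)
  rw [Real.logb_le_iff_le_rpow hs hy, Real.rpow_natCast] at h
  exact h

lemma pow_ceil_logb_le {s y : ℝ} (hs : 1 < s) (hy : 0 < y) :
    s ^ ⌈Real.logb s y⌉₊ ≤ max 1 (s * y) := by
  rcases Nat.eq_zero_or_pos ⌈Real.logb s y⌉₊ with h | h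
  · rw [h]; simp
  · refine le_max_of_le_right ?_
    obtain ⟨k, hk⟩ := Nat.exists_eq_succ_of_ne_zero h.ne'
    have h1 : (k : ℝ) < Real.logb s y := Nat.lt_ceil.1 (by omega)
    rw [Real.lt_logb_iff_rpow_lt hs hy, Real.rpow_natCast] at h1
    rw [hk, Nat.succ_eq_add_one, pow_succ, mul_comm]
    exact mul_le_mul_of_nonneg_left h1.le (by linarith)

/-- Bound on the number of evaluations of one call of the adaptive accelerated proximal gradient
method, for a function with Lipschitz constant `L ≤ Λ`. -/
noncomputable def apgCost (P : NLP n l m) (q : Params) (Λ δ L : ℝ) : ℝ :=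
  6 * trials q * logTerm P q Λ δ * Real.sqrt (q.γ₁ * L / q.ρ)
    + (3 * ⌈Real.logb q.γ₁ (Λ / q.ρ)⌉ + 3)

namespace Setting

variable {P : NLP n l m} {C : Consts n m} {q : Params}

lemma trials_ge (q : Params) : 1 + Real.logb q.γ₁ q.γ₂ ≤ trials q := by
  unfold trials
  linarith [Int.le_ceil (Real.logb q.γ₁ q.γ₂)]

lemma one_le_trials (T : Setting P C q) : 1 ≤ trials q := by
  linarith [trials_ge q, Real.logb_nonneg T.one_lt_γ₁ T.one_le_γ₂]

lemma one_le_logTerm (P : NLP n l m) (q : Params) (Λ δ : ℝ) : 1 ≤ logTerm P q Λ δ :=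
  le_max_left _ _

lemma ceil_logb_nonneg (T : Setting P C q) {Λ : ℝ} (hΛ : q.ρ ≤ Λ) :
    (0 : ℝ) ≤ ⌈Real.logb q.γ₁ (Λ / q.ρ)⌉ := by
  have : 0 ≤ Real.logb q.γ₁ (Λ / q.ρ) :=
    Real.logb_nonneg T.one_lt_γ₁ ((one_le_div T.ρ_pos).2 hΛ)
  exact_mod_cast Int.ceil_nonneg this

lemma apgCost_nonneg (T : Setting P C q) {Λ : ℝ} (hΛ : q.ρ ≤ Λ) (δ L : ℝ) :
    0 ≤ apgCost P q Λ δ L := by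
  have h1 := T.one_le_trials
  have h2 := one_le_logTerm P q Λ δ
  have h3 := T.ceil_logb_nonneg hΛ
  unfold apgCost
  positivity

/-- A call of the adaptive method on an augmented Lagrangian. -/
lemma apg_call (T : Setting P C q) (c : Vec n) {β : ℝ} (hβ : q.β₀ ≤ β) (p : Dual l m)
    {ζ : ℝ} (hζ : ‖p.2‖ ≤ ζ) {Λ : ℝ} (hΛ : augLip P C q β ζ ≤ Λ) {w : Vec n} (hw : w ∈ P.X)
    {δ : ℝ} (hδ : 0 < δ) :
    (∃ out k, AdapAPG ((P.prox q.ρ c).augSmooth β p) P.X P.h w q.ρ δ q.Lmin q.γ₁ q.γ₂ out k) ∧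
    ∀ out k, AdapAPG ((P.prox q.ρ c).augSmooth β p) P.X P.h w q.ρ δ q.Lmin q.γ₁ q.γ₂ out k →
      Stationary ((P.prox q.ρ c).augSmooth β p) P.X P.h δ out ∧
        (k : ℝ) ≤ apgCost P q Λ δ (augLip P C q β ζ) := by
  have hρ := T.ρ_pos
  have hγ := T.one_lt_γ₁
  obtain ⟨xs, H⟩ := T.exists_apgModel c hβ p hζ
  have hL := H.L_pos
  have hD : 0 ≤ diamD P := diamD_nonneg P
  have hlog : Real.log (2 * (1 + q.γ₁) * augLip P C q β ζ * diamD P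
      * Real.sqrt (q.γ₁ * augLip P C q β ζ / q.ρ + 1) / δ) ≤ logTerm P q Λ δ := by
    rcases hD.eq_or_lt with h | h
    · rw [← h]
      simp only [mul_zero, zero_mul, zero_div, Real.log_zero]
      exact zero_le_one.trans (one_le_logTerm P q Λ δ)
    · have hΛ0 : 0 < Λ := hL.trans_le hΛ
      refine le_max_of_le_right (Real.log_le_log (by positivity) ?_)
      gcongr
  obtain ⟨h1, h2⟩ := H.adapAPG_spec hw hδ (one_le_logTerm P q Λ δ) hlog (trials_ge q)
  refine ⟨h1, fun out k hk => ?_⟩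
  obtain ⟨a1, a2⟩ := h2 out k hk
  refine ⟨a1, a2.trans ?_⟩
  have h3 : Real.logb q.γ₁ (augLip P C q β ζ / q.ρ) ≤ ⌈Real.logb q.γ₁ (Λ / q.ρ)⌉ :=
    (Real.logb_le_logb_of_le hγ (by positivity) (by gcongr)).trans (Int.le_ceil _)
  unfold apgCost
  linarith

lemma Mp_nonneg (P : NLP n l m) (C : Consts n m) (q : Params) : 0 ≤ Mp P C q := Real.sqrt_nonneg _

lemma two_mul_Mp_le_Mhat (P : NLP n l m) (C : Consts n m) (q : Params) :
    2 * Mp P C q ≤ Mhat P C q := by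
  have h := Mp_nonneg P C q
  unfold Mhat
  have : 0 ≤ max (Real.sqrt 5 / 2 * Mp P C q)
      (max (Real.sqrt (Mp P C q)) (1 / (2 * Real.sqrt 2))) := le_max_of_le_left (by positivity)
  have := mul_nonneg (Real.sqrt_nonneg q.σ) this
  linarith

lemma Mhat_nonneg (P : NLP n l m) (C : Consts n m) (q : Params) : 0 ≤ Mhat P C q := by
  linarith [two_mul_Mp_le_Mhat P C q, Mp_nonneg P C q]

lemma epsBar₁_eq (q : Params) (ε : ℝ) :
    Real.sqrt ((q.σ - 1) / (q.σ + 1)) * (ε / 2 / 2) * min 1 (Real.sqrt q.ρ) = epsBar₁ q ε := by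
  unfold epsBar₁; ring

lemma epsBar₁_pos (T : Setting P C q) {ε : ℝ} (hε : 0 < ε) : 0 < epsBar₁ q ε := by
  have h1 := T.one_lt_σ
  have h2 : 0 < (q.σ - 1) / (q.σ + 1) := div_pos (by linarith) (by linarith)
  have h3 : 0 < min 1 (Real.sqrt q.ρ) := lt_min one_pos (Real.sqrt_pos.2 T.ρ_pos)
  unfold epsBar₁
  positivity

lemma epsBar₁_le (T : Setting P C q) {ε : ℝ} (hε : 0 < ε) : epsBar₁ q ε ≤ ε / 4 := by
  have h1 := T.one_lt_σ
  have h2 : Real.sqrt ((q.σ - 1) / (q.σ + 1)) ≤ 1 := by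
    rw [Real.sqrt_le_one, div_le_one (by linarith)]; linarith
  have h3 : min 1 (Real.sqrt q.ρ) ≤ 1 := min_le_left _ _
  have h4 : 0 ≤ min 1 (Real.sqrt q.ρ) := le_min one_pos.le (Real.sqrt_nonneg _)
  unfold epsBar₁
  calc _ ≤ 1 * (ε / 4) * 1 := by gcongr
    _ = ε / 4 := by ring

lemma min_sq_div_le (T : Setting P C q) : min 1 (Real.sqrt q.ρ) ^ 2 / q.ρ ≤ 1 := by
  rw [div_le_one T.ρ_pos]
  calc min 1 (Real.sqrt q.ρ) ^ 2 ≤ Real.sqrt q.ρ ^ 2 := by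
        have : 0 ≤ min 1 (Real.sqrt q.ρ) := le_min one_pos.le (Real.sqrt_nonneg _)
        gcongr
        exact min_le_right _ _
    _ = q.ρ := Real.sq_sqrt T.ρ_pos.le

lemma epsBar₁_sq_div_le (T : Setting P C q) (ε : ℝ) :
    epsBar₁ q ε ^ 2 / q.ρ ≤ (q.σ - 1) / (q.σ + 1) * (ε ^ 2 / 16) := by
  have h1 := T.one_lt_σ
  have h2 : 0 ≤ (q.σ - 1) / (q.σ + 1) := div_nonneg (by linarith) (by linarith)
  have e : epsBar₁ q ε ^ 2 / q.ρ = (q.σ - 1) / (q.σ + 1) * (ε ^ 2 / 16)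
      * (min 1 (Real.sqrt q.ρ) ^ 2 / q.ρ) := by
    unfold epsBar₁
    rw [mul_pow, mul_pow, Real.sq_sqrt h2]; ring
  rw [e]
  exact mul_le_of_le_one_right (by positivity) T.min_sq_div_le

/-- Bound on the multipliers in the augmented Lagrangian method at penalty parameter `β`. -/
noncomputable def ialmZeta (P : NLP n l m) (C : Consts n m) (q : Params) (ε β : ℝ) : ℝ :=
  2 * Mp P C q + ε / 4 * Real.sqrt (β / (q.σ + 1))

/-- The number of increases of the penalty parameter in the augmented Lagrangian method. -/
noncomputable def ialmSteps (P : NLP n l m) (C : Consts n m) (q : Params) (ε : ℝ) : ℕ :=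
  ⌈Real.logb q.σ (ChatEps P C q ε)⌉₊

/-- The evaluations of the call of the accelerated method at penalty parameter `β₀ σ ^ k`. -/
noncomputable def ialmCost (P : NLP n l m) (C : Consts n m) (q : Params) (ε : ℝ) (k : ℕ) : ℝ :=
  apgCost P q (LhatEps P C q ε) (epsBar₁ q ε)
    (augLip P C q (q.β₀ * q.σ ^ k) (ialmZeta P C q ε (q.β₀ * q.σ ^ k)))

/-- The invariant of the augmented Lagrangian method for the subproblem with multipliers `ps`. -/
structure IALMState (P : NLP n l m) (C : Consts n m) (q : Params) (ε : ℝ) (ps : Dual l m) (β : ℝ)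
    (x : Vec n) (p : Dual l m) : Prop where
  mem : x ∈ P.X
  nonneg : ∀ i, 0 ≤ p.2 i
  dist_sq_le : dualNorm (p - ps) ^ 2 ≤ Mp P C q ^ 2 + ε ^ 2 / 16 * (β / (q.σ + 1))

lemma dualNorm_le_of_dist_sq_le {p ps : Dual l m} {M r : ℝ} (hM : 0 ≤ M) (hr : 0 ≤ r)
    (hps : dualNorm ps ≤ M) (h : dualNorm (p - ps) ^ 2 ≤ M ^ 2 + r ^ 2) :
    dualNorm p ≤ 2 * M + r := by
  have h1 : dualNorm (p - ps) ≤ M + r :=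
    le_of_sq_le_sq (h.trans (by nlinarith)) (by positivity)
  have h2 : dualNorm p ≤ dualNorm (p - ps) + dualNorm ps := by
    simpa using dualNorm_add_le (p - ps) ps
  linarith

lemma sq_ialm_radius {ε β σ : ℝ} (h : 0 ≤ β / (σ + 1)) :
    (ε / 4 * Real.sqrt (β / (σ + 1))) ^ 2 = ε ^ 2 / 16 * (β / (σ + 1)) := by
  rw [mul_pow, Real.sq_sqrt h]; ring

/-- What a call of the augmented Lagrangian method with centre `c` returns. -/
structure IALMOut (P : NLP n l m) (C : Consts n m) (q : Params) (ε : ℝ) (c : Vec n) (β : ℝ)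
    (u : Vec n) (p : Dual l m) : Prop where
  kkt : (P.prox q.ρ c).IsKKTPair (ε / 2) u p
  norm_le : dualNorm p ≤ Mhat P C q
  norm_le_mul : dualNorm p ≤ β * (ε / 2)
  le_β : q.β₀ ≤ β
  β_le : β ≤ q.σ * (q.β₀ * ChatEps P C q ε)
  descent : P.g u + P.h u + 3 / 2 * q.ρ * ‖u - c‖ ^ 2 ≤ P.g c + P.h c
    + ε * (diamD P / 4 + Mhat P C q / 2) + Mhat P C q * P.feas c

lemma ialm_step (T : Setting P C q) {ε β : ℝ} (hβ : q.β₀ ≤ β) {c xs : Vec n}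
    {ps p : Dual l m} (hS : Saddle P C q c xs ps) {x u : Vec n} (hI : IALMState P C q ε ps β x p)
    (hst : Stationary ((P.prox q.ρ c).augSmooth β p) P.X P.h (epsBar₁ q ε) u) :
    dualNorm (P.dualStep β p u - ps) ^ 2 + dualNorm (P.dualStep β p u - p) ^ 2
      ≤ Mp P C q ^ 2 + ε ^ 2 / 16 * (q.σ * β / (q.σ + 1)) := by
  have hβ0 : 0 < β := T.β₀_pos.trans_le hβ
  have hσ := T.one_lt_σ
  have h1 := T.dual_contraction hS hβ0 hst
  have h2 := mul_le_mul_of_nonneg_left (T.epsBar₁_sq_div_le ε) hβ0.le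
  have h3 := hI.dist_sq_le
  have h4 : ε ^ 2 / 16 * (β / (q.σ + 1)) + β * ((q.σ - 1) / (q.σ + 1) * (ε ^ 2 / 16))
      = ε ^ 2 / 16 * (q.σ * β / (q.σ + 1)) := by field_simp; ring
  linarith

lemma β₀_mul_ChatEps (T : Setting P C q) (ε : ℝ) : q.β₀ * ChatEps P C q ε
    = max (20 * Mp P C q ^ 2 / ε) (max (16 * Mp P C q / ε) 4) := by
  have h := T.β₀_pos
  unfold ChatEps
  rw [mul_max_of_nonneg _ _ h.le, mul_max_of_nonneg _ _ h.le]
  congr 1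
  · field_simp
  · congr 1 <;> field_simp

/-- Once the penalty parameter has reached `β₀ Ĉ_ε`, the stopping test holds. -/
lemma ialm_test (T : Setting P C q) {ε β : ℝ} (hε : 0 < ε) (hε2 : ε ≤ 1 / 2) (hβ : q.β₀ ≤ β)
    (hβC : q.β₀ * ChatEps P C q ε ≤ β) {c xs : Vec n}
    {ps p : Dual l m} (hS : Saddle P C q c xs ps) {x u : Vec n} (hI : IALMState P C q ε ps β x p)
    (hst : Stationary ((P.prox q.ρ c).augSmooth β p) P.X P.h (epsBar₁ q ε) u) :
    max ((dualNorm p + dualNorm (P.dualStep β p u)) / β)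
        (∑ i, |(P.dualStep β p u).2 i * P.f i u|) ≤ ε / 2 := by
  have hβ0 : 0 < β := T.β₀_pos.trans_le hβ
  have hσ := T.one_lt_σ
  have hM := Mp_nonneg P C q
  rw [T.β₀_mul_ChatEps] at hβC
  have b1 : 20 * Mp P C q ^ 2 ≤ β * ε := (div_le_iff₀ hε).1 ((le_max_left _ _).trans hβC)
  have b2 : 16 * Mp P C q ≤ β * ε :=
    (div_le_iff₀ hε).1 (((le_max_left _ _).trans (le_max_right _ _)).trans hβC)
  have b3 : 4 ≤ β := ((le_max_right _ _).trans (le_max_right _ _)).trans hβC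
  have hstep := T.ialm_step hβ hS hI hst
  set p' := P.dualStep β p u with hp'
  set s := Real.sqrt β with hs
  have hs2 : s ^ 2 = β := Real.sq_sqrt hβ0.le
  have hs0 : 0 ≤ s := Real.sqrt_nonneg _
  have hsge : 2 ≤ s := by
    rw [hs]; exact Real.le_sqrt_of_sq_le (by linarith)
  have hrad : ∀ t, t ≤ β → ε ^ 2 / 16 * t ≤ (ε / 4 * s) ^ 2 := by
    intro t ht
    rw [mul_pow, hs2]
    calc ε ^ 2 / 16 * t ≤ ε ^ 2 / 16 * β := by gcongr
      _ = _ := by ring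
  have hr1 := hrad (β / (q.σ + 1)) (div_le_self hβ0.le (by linarith))
  have hr2 := hrad (q.σ * β / (q.σ + 1)) (by
    rw [div_le_iff₀ (by linarith)]; nlinarith)
  have h1 : dualNorm p ≤ 2 * Mp P C q + ε / 4 * s :=
    dualNorm_le_of_dist_sq_le hM (by positivity) hS.norm_le (hI.dist_sq_le.trans (by linarith))
  have h2 : dualNorm p' ≤ 2 * Mp P C q + ε / 4 * s :=
    dualNorm_le_of_dist_sq_le hM (by positivity) hS.norm_le
      (by linarith [sq_nonneg (dualNorm (p' - p))])
  apply max_le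
  · rw [div_le_iff₀ hβ0]
    have : ε * s ≤ ε * (s ^ 2 / 2) := by gcongr; nlinarith
    rw [hs2] at this
    linarith
  · refine (P.sum_abs_dualStep_le hβ0 p u).trans ?_
    rw [← hp', div_le_iff₀ hβ0]
    have h3 : dualNorm p' ≤ Mp P C q + dualNorm (p' - ps) := by
      have : dualNorm p' ≤ dualNorm (p' - ps) + dualNorm ps := by
        simpa using dualNorm_add_le (p' - ps) ps
      linarith [hS.norm_le]
    have h4 := mul_le_mul_of_nonneg_right h3 (dualNorm_nonneg (p' - p))
    have h5 : (Mp P C q + dualNorm (p' - ps)) * dualNorm (p' - p)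
        ≤ Mp P C q ^ 2 / 2 + (dualNorm (p' - ps) ^ 2 + dualNorm (p' - p) ^ 2) := by
      nlinarith [sq_nonneg (Mp P C q - dualNorm (p' - p)),
        sq_nonneg (dualNorm (p' - ps) - dualNorm (p' - p)), sq_nonneg (dualNorm (p' - ps))]
    have h6 : (ε / 4 * s) ^ 2 = ε / 16 * (β * ε) := by rw [mul_pow, hs2]; ring
    have h7 : ε / 16 * (β * ε) ≤ (1 / 2) / 16 * (β * ε) := by gcongr
    linarith

lemma ialm_out (T : Setting P C q) {ε β : ℝ} (hε : 0 < ε) (hε2 : ε ≤ 1 / 2) (hβ : q.β₀ ≤ β)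
    (hβC : β ≤ q.σ * (q.β₀ * ChatEps P C q ε)) {c xs : Vec n} (hc : c ∈ P.X)
    {ps p : Dual l m} (hS : Saddle P C q c xs ps) {x u : Vec n} (hI : IALMState P C q ε ps β x p)
    (hst : Stationary ((P.prox q.ρ c).augSmooth β p) P.X P.h (epsBar₁ q ε) u)
    (htest : max ((dualNorm p + dualNorm (P.dualStep β p u)) / β)
        (∑ i, |(P.dualStep β p u).2 i * P.f i u|) ≤ ε / 2) :
    IALMOut P C q ε c β u (P.dualStep β p u) := by
  have hβ0 : 0 < β := T.β₀_pos.trans_le hβ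
  have hσ := T.one_lt_σ
  have hM := Mp_nonneg P C q
  have hstep := T.ialm_step hβ hS hI hst
  obtain ⟨t1, t2⟩ := max_le_iff.1 htest
  have hsub : dualNorm (P.dualStep β p u - p) / β ≤ ε / 2 := by
    refine le_trans ?_ t1
    gcongr
    rw [add_comm]
    exact dualNorm_sub_le _ _
  have hnorm : dualNorm (P.dualStep β p u) ≤ Mhat P C q := by
    set μ := max (Real.sqrt 5 / 2 * Mp P C q)
      (max (Real.sqrt (Mp P C q)) (1 / (2 * Real.sqrt 2))) with hμ
    have m1 : Real.sqrt 5 / 2 * Mp P C q ≤ μ := le_max_left _ _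
    have m2 : Real.sqrt (Mp P C q) ≤ μ := (le_max_left _ _).trans (le_max_right _ _)
    have m3 : 1 / (2 * Real.sqrt 2) ≤ μ := (le_max_right _ _).trans (le_max_right _ _)
    have hμ0 : 0 ≤ μ := (Real.sqrt_nonneg _).trans m2
    have s1 : 5 / 4 * Mp P C q ^ 2 ≤ μ ^ 2 := by
      have : (Real.sqrt 5 / 2 * Mp P C q) ^ 2 ≤ μ ^ 2 := by gcongr
      rw [mul_pow, div_pow, Real.sq_sqrt (by norm_num)] at this
      linarith
    have s2 : Mp P C q ≤ μ ^ 2 := by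
      have : Real.sqrt (Mp P C q) ^ 2 ≤ μ ^ 2 := by gcongr
      rwa [Real.sq_sqrt hM] at this
    have s3 : 1 / 8 ≤ μ ^ 2 := by
      have : (1 / (2 * Real.sqrt 2)) ^ 2 ≤ μ ^ 2 := by gcongr
      rw [div_pow, mul_pow, Real.sq_sqrt (by norm_num)] at this
      linarith
    have key : ε ^ 2 / 16 * (q.σ * β / (q.σ + 1)) ≤ (Real.sqrt q.σ * μ) ^ 2 := by
      have k1 : q.σ * β / (q.σ + 1) ≤ q.σ * (q.β₀ * ChatEps P C q ε) := by
        refine le_trans ?_ hβC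
        rw [div_le_iff₀ (by linarith)]; nlinarith
      have k2 : ε ^ 2 / 16 * (q.β₀ * ChatEps P C q ε) ≤ μ ^ 2 := by
        rw [T.β₀_mul_ChatEps, mul_max_of_nonneg _ _ (by positivity),
          mul_max_of_nonneg _ _ (by positivity)]
        refine max_le ?_ (max_le ?_ ?_)
        · have : ε ^ 2 / 16 * (20 * Mp P C q ^ 2 / ε) = ε * (5 / 4 * Mp P C q ^ 2) := by
            field_simp; ring
          rw [this]
          nlinarith [sq_nonneg (Mp P C q)]
        · have : ε ^ 2 / 16 * (16 * Mp P C q / ε) = ε * Mp P C q := by field_simp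
          rw [this]; nlinarith
        · nlinarith
      rw [mul_pow, Real.sq_sqrt (by linarith)]
      calc ε ^ 2 / 16 * (q.σ * β / (q.σ + 1))
          ≤ ε ^ 2 / 16 * (q.σ * (q.β₀ * ChatEps P C q ε)) := by gcongr
        _ = q.σ * (ε ^ 2 / 16 * (q.β₀ * ChatEps P C q ε)) := by ring
        _ ≤ _ := by gcongr
    have := dualNorm_le_of_dist_sq_le (p := P.dualStep β p u) (r := Real.sqrt q.σ * μ) hM
      (by positivity) hS.norm_le
      (by linarith [sq_nonneg (dualNorm (P.dualStep β p u - p))])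
    exact this
  have hu := hst.choose_spec.1.1
  have hMh := Mhat_nonneg P C q
  refine ⟨?_, hnorm, ?_, hβ, hβC, ?_⟩
  · rw [T.isKKTPair_prox_iff]
    obtain ⟨v, hv, hδ⟩ := (T.stationary_aug_iff c hβ0 p _ u).1 hst
    exact ⟨hu, P.dualStep_nonneg β p u, (P.feas_le_dualStep hβ0 hI.nonneg u).trans hsub,
      ⟨v, hv, hδ.trans ((T.epsBar₁_le hε).trans (by linarith))⟩, t2⟩
  · rw [div_le_iff₀ hβ0] at t1
    linarith [dualNorm_nonneg p]
  · have h1 := T.lag_descent hc hβ0 hst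
    have h2 : epsBar₁ q ε * ‖u - c‖ ≤ ε / 4 * diamD P :=
      mul_le_mul (T.epsBar₁_le hε) (T.norm_sub_le_diamD hu hc) (norm_nonneg _) (by positivity)
    have h3 := mul_le_mul hnorm hsub (div_nonneg (dualNorm_nonneg _) hβ0.le) hMh
    have h4 := mul_le_mul_of_nonneg_right hnorm (P.feas_nonneg c)
    linarith

lemma ialmLoop_spec (T : Setting P C q) {ε : ℝ} (hε : 0 < ε) (hε2 : ε ≤ 1 / 2)
    (hC : 1 ≤ ChatEps P C q ε) {c xs : Vec n} (hc : c ∈ P.X) {ps : Dual l m}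
    (hS : Saddle P C q c xs ps) : ∀ j k : ℕ, k + j = ialmSteps P C q ε → ∀ x p,
      IALMState P C q ε ps (q.β₀ * q.σ ^ k) x p →
      (∃ βo xo po cnt,
        IALMLoop (P.prox q.ρ c) q (ε / 2) x p (q.β₀ * q.σ ^ k) βo xo po cnt) ∧
      ∀ βo xo po cnt, IALMLoop (P.prox q.ρ c) q (ε / 2) x p (q.β₀ * q.σ ^ k) βo xo po cnt →
        IALMOut P C q ε c βo xo po ∧
        (cnt : ℝ) ≤ ∑ i ∈ Finset.range (j + 1), ialmCost P C q ε (k + i) := by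
  have hσ := T.one_lt_σ
  have hβ₀ := T.β₀_pos
  have hC0 : 0 < ChatEps P C q ε := by linarith
  have hle : ∀ k ≤ ialmSteps P C q ε,
      q.β₀ * q.σ ^ k ≤ q.σ * (q.β₀ * ChatEps P C q ε) := by
    intro k hk
    have h1 : q.σ ^ k ≤ q.σ * ChatEps P C q ε := by
      refine (pow_le_pow_right₀ hσ.le hk).trans ((pow_ceil_logb_le hσ hC0).trans ?_)
      exact max_le (by nlinarith) le_rfl
    calc q.β₀ * q.σ ^ k ≤ q.β₀ * (q.σ * ChatEps P C q ε) := by gcongr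
      _ = _ := by ring
  have hge : ∀ k : ℕ, q.β₀ ≤ q.β₀ * q.σ ^ k := fun k =>
    le_mul_of_one_le_right hβ₀.le (one_le_pow₀ hσ.le)
  have hM := Mp_nonneg P C q
  -- each call of the accelerated method
  have hcall : ∀ k ≤ ialmSteps P C q ε, ∀ x p, IALMState P C q ε ps (q.β₀ * q.σ ^ k) x p →
      (∃ out t, AdapAPG ((P.prox q.ρ c).augSmooth (q.β₀ * q.σ ^ k) p) P.X P.h x q.ρ
        (epsBar₁ q ε) q.Lmin q.γ₁ q.γ₂ out t) ∧
      ∀ out t, AdapAPG ((P.prox q.ρ c).augSmooth (q.β₀ * q.σ ^ k) p) P.X P.h x q.ρ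
        (epsBar₁ q ε) q.Lmin q.γ₁ q.γ₂ out t →
        Stationary ((P.prox q.ρ c).augSmooth (q.β₀ * q.σ ^ k) p) P.X P.h (epsBar₁ q ε) out ∧
          (t : ℝ) ≤ ialmCost P C q ε k := by
    intro k hk x p hI
    have hβk : 0 < q.β₀ * q.σ ^ k := hβ₀.trans_le (hge k)
    have hdiv : 0 ≤ q.β₀ * q.σ ^ k / (q.σ + 1) := by positivity
    refine T.apg_call c (hge k) p (ζ := ialmZeta P C q ε (q.β₀ * q.σ ^ k)) ?_ ?_ hI.mem
      (T.epsBar₁_pos hε)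
    · refine (norm_snd_le_dualNorm p).trans (dualNorm_le_of_dist_sq_le hM (by positivity)
        hS.norm_le ?_)
      rw [sq_ialm_radius hdiv]
      exact hI.dist_sq_le
    · have h1 : Real.sqrt (q.β₀ * q.σ ^ k / (q.σ + 1))
          ≤ Real.sqrt (q.β₀ * ChatEps P C q ε) := by
        apply Real.sqrt_le_sqrt
        rw [div_le_iff₀ (by linarith)]
        have := hle k hk
        nlinarith [mul_pos hβ₀ hC0]
      have h2 : ε / 4 ≤ ε / (2 * Real.sqrt 2) := by
        apply div_le_div_of_nonneg_left hε.le (by positivity)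
        nlinarith [Real.sq_sqrt (show (0 : ℝ) ≤ 2 by norm_num), Real.sqrt_nonneg 2]
      have h3 : ialmZeta P C q ε (q.β₀ * q.σ ^ k) ≤ 2 * Mp P C q
          + ε / (2 * Real.sqrt 2) * Real.sqrt (q.β₀ * ChatEps P C q ε) := by
        unfold ialmZeta; gcongr
      have h4 := mul_le_mul_of_nonneg_right (hle k hk) T.Lc_nonneg
      have h5 := mul_le_mul_of_nonneg_right h3 (Lsum_nonneg C)
      unfold augLip LhatEps
      linarith
  intro j
  induction j with
  | zero =>
    intro k hk x p hI
    have hk' : k = ialmSteps P C q ε := by omega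
    obtain ⟨⟨u, t, hu⟩, hall⟩ := hcall k hk'.le x p hI
    have hbig : q.β₀ * ChatEps P C q ε ≤ q.β₀ * q.σ ^ k := by
      rw [hk']
      exact mul_le_mul_of_nonneg_left (le_pow_ceil_logb hσ hC0) hβ₀.le
    rw [← epsBar₁_eq] at hu
    constructor
    · refine ⟨_, _, _, _, .halt hu ?_⟩
      rw [epsBar₁_eq] at hu
      exact T.ialm_test hε hε2 (hge k) hbig hS hI (hall _ _ hu).1
    · intro βo xo po cnt hr
      cases hr with
      | halt ha he =>
        rw [epsBar₁_eq] at ha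
        obtain ⟨a1, a2⟩ := hall _ _ ha
        exact ⟨T.ialm_out hε hε2 (hge k) (hle k hk'.le) hc hS hI a1 he, by simpa using a2⟩
      | next ha he hr =>
        rw [epsBar₁_eq] at ha
        exact absurd (T.ialm_test hε hε2 (hge k) hbig hS hI (hall _ _ ha).1) he
  | succ j ih =>
    intro k hk x p hI
    have hk' : k ≤ ialmSteps P C q ε := by omega
    obtain ⟨⟨u, t, hu⟩, hall⟩ := hcall k hk' x p hI
    have hnext : ∀ u, Stationary ((P.prox q.ρ c).augSmooth (q.β₀ * q.σ ^ k) p) P.X P.h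
        (epsBar₁ q ε) u →
        IALMState P C q ε ps (q.β₀ * q.σ ^ (k + 1)) u (P.dualStep (q.β₀ * q.σ ^ k) p u) := by
      intro u hst
      have h1 := T.ialm_step (hge k) hS hI hst
      refine ⟨hst.choose_spec.1.1, P.dualStep_nonneg _ _ _, ?_⟩
      have e : q.β₀ * q.σ ^ (k + 1) = q.σ * (q.β₀ * q.σ ^ k) := by ring
      rw [e]
      linarith [sq_nonneg (dualNorm (P.dualStep (q.β₀ * q.σ ^ k) p u - p))]
    have eβ : q.σ * (q.β₀ * q.σ ^ k) = q.β₀ * q.σ ^ (k + 1) := by ring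
    have hsum : ∑ i ∈ Finset.range (j + 1 + 1), ialmCost P C q ε (k + i)
        = ialmCost P C q ε k + ∑ i ∈ Finset.range (j + 1), ialmCost P C q ε (k + 1 + i) := by
      rw [Finset.sum_range_succ', add_zero, add_comm]
      congr 1
      exact Finset.sum_congr rfl fun i _ => by congr 1; omega
    have hρΛ : q.ρ ≤ LhatEps P C q ε := by
      have h1 := mul_nonneg (mul_nonneg (mul_nonneg hβ₀.le (by linarith : 0 ≤ q.σ)) T.Lc_nonneg)
        hC0.le
      have h2 : 0 ≤ Lsum C * (2 * Mp P C q
        + ε / (2 * Real.sqrt 2) * Real.sqrt (q.β₀ * ChatEps P C q ε)) :=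
        mul_nonneg (Lsum_nonneg C) (by positivity)
      unfold LhatEps
      linarith [T.comp.L₀_nonneg, T.ρ_pos]
    constructor
    · have hst := (hall _ _ hu).1
      rw [← epsBar₁_eq] at hu
      by_cases he : max ((dualNorm p + dualNorm ((P.prox q.ρ c).dualStep (q.β₀ * q.σ ^ k) p u))
          / (q.β₀ * q.σ ^ k))
        (∑ i, |((P.prox q.ρ c).dualStep (q.β₀ * q.σ ^ k) p u).2 i * (P.prox q.ρ c).f i u|) ≤ ε / 2
      · exact ⟨_, _, _, _, .halt hu he⟩
      · obtain ⟨βo, xo, po, cnt, hr⟩ := (ih (k + 1) (by omega) _ _ (hnext u hst)).1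
        rw [← eβ] at hr
        exact ⟨_, _, _, _, .next hu he hr⟩
    · intro βo xo po cnt hr
      rw [hsum]
      cases hr with
      | halt ha he =>
        rw [epsBar₁_eq] at ha
        obtain ⟨a1, a2⟩ := hall _ _ ha
        refine ⟨T.ialm_out hε hε2 (hge k) (hle k hk') hc hS hI a1 he, a2.trans ?_⟩
        have : 0 ≤ ∑ i ∈ Finset.range (j + 1), ialmCost P C q ε (k + 1 + i) :=
          Finset.sum_nonneg fun i _ => T.apgCost_nonneg hρΛ _ _
        linarith
      | next ha he hr =>
        rw [epsBar₁_eq] at ha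
        obtain ⟨a1, a2⟩ := hall _ _ ha
        rw [eβ] at hr
        obtain ⟨b1, b2⟩ := (ih (k + 1) (by omega) _ _ (hnext _ a1)).2 _ _ _ _ hr
        refine ⟨b1, ?_⟩
        push_cast
        linarith

end Setting

end IALMAnalysis

/-! ### The penalty method with estimated multipliers -/

section PenAnalysis

variable {n l m : ℕ}

namespace Setting

variable {P : NLP n l m} {C : Consts n m} {q : Params}

/-- The tolerance of the calls of the penalty method. -/
noncomputable def penTol (q : Params) (ε : ℝ) : ℝ :=
  ε / (2 * Real.sqrt 2) * min 1 (1 / Real.sqrt q.ρ) / 2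

lemma min_inv_pos (T : Setting P C q) : 0 < min 1 (1 / Real.sqrt q.ρ) :=
  lt_min one_pos (one_div_pos.2 (Real.sqrt_pos.2 T.ρ_pos))

lemma penTol_pos (T : Setting P C q) {ε : ℝ} (hε : 0 < ε) : 0 < penTol q ε := by
  have := T.min_inv_pos
  unfold penTol; positivity

lemma penTol_le (T : Setting P C q) {ε : ℝ} (hε : 0 < ε) : penTol q ε ≤ ε / (4 * Real.sqrt 2) := by
  have h1 : min 1 (1 / Real.sqrt q.ρ) ≤ 1 := min_le_left _ _
  have h2 := T.min_inv_pos
  unfold penTol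
  calc ε / (2 * Real.sqrt 2) * min 1 (1 / Real.sqrt q.ρ) / 2
      ≤ ε / (2 * Real.sqrt 2) * 1 / 2 := by gcongr
    _ = _ := by field_simp; norm_num

lemma penTol_le' (T : Setting P C q) {ε : ℝ} (hε : 0 < ε) : penTol q ε ≤ ε / 4 := by
  refine (T.penTol_le hε).trans (div_le_div_of_nonneg_left hε.le (by norm_num) ?_)
  nlinarith [Real.sq_sqrt (show (0 : ℝ) ≤ 2 by norm_num), Real.sqrt_nonneg 2]

lemma penTol_mul (T : Setting P C q) (ε : ℝ) :
    penTol q ε * min 1 (Real.sqrt q.ρ) = epsBar₂ q ε := by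
  have hs : 0 < Real.sqrt q.ρ := Real.sqrt_pos.2 T.ρ_pos
  have h : min 1 (1 / Real.sqrt q.ρ) * min 1 (Real.sqrt q.ρ)
      = min (Real.sqrt q.ρ) (1 / Real.sqrt q.ρ) := by
    rcases le_total (Real.sqrt q.ρ) 1 with h | h
    · have h' : 1 ≤ 1 / Real.sqrt q.ρ := (one_le_div hs).2 h
      rw [min_eq_left h', min_eq_right h, min_eq_left (h.trans h'), one_mul]
    · have h' : 1 / Real.sqrt q.ρ ≤ 1 := (div_le_one hs).2 h
      rw [min_eq_right h', min_eq_left h, min_eq_right (h'.trans h), mul_one]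
  unfold penTol epsBar₂
  rw [← h]
  field_simp
  norm_num

lemma epsBar₂_pos (T : Setting P C q) {ε : ℝ} (hε : 0 < ε) : 0 < epsBar₂ q ε := by
  rw [← T.penTol_mul]
  exact mul_pos (T.penTol_pos hε) (lt_min one_pos (Real.sqrt_pos.2 T.ρ_pos))

lemma epsBar₂_le (T : Setting P C q) {ε : ℝ} (hε : 0 < ε) : epsBar₂ q ε ≤ penTol q ε := by
  rw [← T.penTol_mul]
  exact mul_le_of_le_one_right (T.penTol_pos hε).le (min_le_left _ _)

lemma epsBar₂_sq_div_le (T : Setting P C q) (ε : ℝ) : epsBar₂ q ε ^ 2 / q.ρ ≤ penTol q ε ^ 2 := by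
  rw [← T.penTol_mul, mul_pow, mul_div_assoc]
  exact mul_le_of_le_one_right (sq_nonneg _) T.min_sq_div_le

lemma betaBar_eq (T : Setting P C q) {ε : ℝ} (hε : 0 < ε) :
    betaBar P C q ε = max (4 * (3 * Mp P C q ^ 2 + 2 * Mhat P C q ^ 2) / penTol q ε)
      (max (4 * (Mp P C q + Mhat P C q) / penTol q ε) 8) := by
  have h1 := T.min_inv_pos
  have h2 := Real.sqrt_pos.2 (show (0 : ℝ) < 2 by norm_num)
  have h3 := Real.sq_sqrt (show (0 : ℝ) ≤ 2 by norm_num)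
  have key : ∀ a : ℝ, 16 * Real.sqrt 2 * a / (ε * min 1 (1 / Real.sqrt q.ρ))
      = 4 * a / penTol q ε := by
    intro a
    unfold penTol
    field_simp
    ring
  unfold betaBar
  rw [key, key]

lemma eight_le_betaBar (P : NLP n l m) (C : Consts n m) (q : Params) (ε : ℝ) :
    8 ≤ betaBar P C q ε := (le_max_right _ _).trans (le_max_right _ _)

lemma β₀_mul_ChatEps_le_betaBar (T : Setting P C q) {ε : ℝ} (hε : 0 < ε) :
    q.β₀ * ChatEps P C q ε ≤ betaBar P C q ε := by
  have hM := Mp_nonneg P C q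
  have hMh := Mhat_nonneg P C q
  have h1 := T.min_inv_pos
  have h2 : min 1 (1 / Real.sqrt q.ρ) ≤ 1 := min_le_left _ _
  have hs : (1.4 : ℝ) ≤ Real.sqrt 2 := Real.le_sqrt_of_sq_le (by norm_num)
  have hm : ε * min 1 (1 / Real.sqrt q.ρ) ≤ ε := mul_le_of_le_one_right hε.le h2
  have hm0 : 0 < ε * min 1 (1 / Real.sqrt q.ρ) := mul_pos hε h1
  rw [T.β₀_mul_ChatEps]
  unfold betaBar
  refine max_le_max ?_ (max_le_max ?_ (by norm_num))
  · apply div_le_div₀ (by positivity) _ hm0 hm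
    nlinarith [sq_nonneg (Mp P C q), sq_nonneg (Mhat P C q)]
  · apply div_le_div₀ (by positivity) _ hm0 hm
    nlinarith

/-- The evaluations of the call of the accelerated method at penalty parameter `β` in the penalty
method. -/
noncomputable def penCost (P : NLP n l m) (C : Consts n m) (q : Params) (ε β : ℝ) : ℝ :=
  apgCost P q (Lbar P C q ε) (epsBar₂ q ε) (augLip P C q β (Mhat P C q))

/-- What a call of the penalty method with centre `c` returns if it makes at least one step. -/
structure PenOut (P : NLP n l m) (C : Consts n m) (q : Params) (ε : ℝ) (c : Vec n)
    (pbar : Dual l m) (β : ℝ) (u : Vec n) (p : Dual l m) : Prop where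
  kkt : (P.prox q.ρ c).IsKKTPair (penTol q ε) u p
  stationary : Stationary ((P.prox q.ρ c).augSmooth β pbar) P.X P.h (epsBar₂ q ε) u
  β_le : β ≤ q.σ * betaBar P C q ε

/-- A step of the penalty method with `β ≥ β̄` succeeds. -/
lemma pen_step_kkt (T : Setting P C q) {ε β : ℝ} (hε : 0 < ε) (hε2 : ε ≤ 1 / 2)
    (hβ : betaBar P C q ε ≤ β) {c xs : Vec n} {ps pbar : Dual l m} (hS : Saddle P C q c xs ps)
    (hp0 : ∀ i, 0 ≤ pbar.2 i) (hpn : dualNorm pbar ≤ Mhat P C q) {u : Vec n}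
    (hst : Stationary ((P.prox q.ρ c).augSmooth β pbar) P.X P.h (epsBar₂ q ε) u) :
    (P.prox q.ρ c).IsKKTPair (penTol q ε) u (P.dualStep β pbar u) := by
  have hM := Mp_nonneg P C q
  have hMh := Mhat_nonneg P C q
  have hη := T.penTol_pos hε
  set η := penTol q ε with hηdef
  have hη8 : η ≤ 1 / 8 := (T.penTol_le' hε).trans (by linarith)
  have hβ8 : 8 ≤ β := (eight_le_betaBar P C q ε).trans hβ
  have hβ0 : 0 < β := by linarith
  have hb := hβ
  rw [T.betaBar_eq hε, ← hηdef] at hb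
  have b1 : 4 * (3 * Mp P C q ^ 2 + 2 * Mhat P C q ^ 2) ≤ β * η :=
    (div_le_iff₀ hη).1 ((le_max_left _ _).trans hb)
  have b2 : 4 * (Mp P C q + Mhat P C q) ≤ β * η :=
    (div_le_iff₀ hη).1 (((le_max_left _ _).trans (le_max_right _ _)).trans hb)
  have h1 := T.dual_contraction hS hβ0 hst
  have h2 := mul_le_mul_of_nonneg_left (T.epsBar₂_sq_div_le ε) hβ0.le
  rw [← hηdef] at h2
  have h3 : dualNorm (pbar - ps) ≤ Mp P C q + Mhat P C q := by
    linarith [dualNorm_sub_le pbar ps, hS.norm_le]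
  have h3' : dualNorm (pbar - ps) ^ 2 ≤ (Mp P C q + Mhat P C q) ^ 2 :=
    pow_le_pow_left₀ (dualNorm_nonneg _) h3 2
  set p' := P.dualStep β pbar u with hp'
  set s := Real.sqrt β with hs
  have hs2 : s ^ 2 = β := Real.sq_sqrt hβ0.le
  have hs0 : 0 ≤ s := Real.sqrt_nonneg _
  have hsge : 2 ≤ s := by
    rw [hs]; exact Real.le_sqrt_of_sq_le (by linarith)
  obtain ⟨v, hv, hδ⟩ := (T.stationary_aug_iff c hβ0 pbar _ u).1 hst
  rw [T.isKKTPair_prox_iff]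
  refine ⟨hv.1, P.dualStep_nonneg β pbar u, ?_, ⟨v, hv, hδ.trans (T.epsBar₂_le hε)⟩, ?_⟩
  · refine (P.feas_le_dualStep hβ0 hp0 u).trans ?_
    rw [← hp', div_le_iff₀ hβ0]
    have h4 : dualNorm (p' - pbar) ≤ (Mp P C q + Mhat P C q) + η * s := by
      apply le_of_sq_le_sq _ (by positivity)
      have e : (η * s) ^ 2 = β * η ^ 2 := by rw [mul_pow, hs2]; ring
      have : 0 ≤ 2 * ((Mp P C q + Mhat P C q) * (η * s)) := by positivity
      nlinarith [sq_nonneg (dualNorm (p' - ps))]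
    have h5 : η * s ≤ η * (s ^ 2 / 2) := by gcongr; nlinarith
    rw [hs2] at h5
    linarith
  · refine (P.sum_abs_dualStep_le hβ0 pbar u).trans ?_
    rw [← hp', div_le_iff₀ hβ0]
    have h4 : dualNorm p' ≤ Mp P C q + dualNorm (p' - ps) := by
      have : dualNorm p' ≤ dualNorm (p' - ps) + dualNorm ps := by
        simpa using dualNorm_add_le (p' - ps) ps
      linarith [hS.norm_le]
    have h5 := mul_le_mul_of_nonneg_right h4 (dualNorm_nonneg (p' - pbar))
    have h6 : (Mp P C q + dualNorm (p' - ps)) * dualNorm (p' - pbar)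
        ≤ Mp P C q ^ 2 / 2 + (dualNorm (p' - ps) ^ 2 + dualNorm (p' - pbar) ^ 2) := by
      nlinarith [sq_nonneg (Mp P C q - dualNorm (p' - pbar)),
        sq_nonneg (dualNorm (p' - ps) - dualNorm (p' - pbar)), sq_nonneg (dualNorm (p' - ps))]
    have h7 : (Mp P C q + Mhat P C q) ^ 2 ≤ 2 * Mp P C q ^ 2 + 2 * Mhat P C q ^ 2 := by
      nlinarith [sq_nonneg (Mp P C q - Mhat P C q)]
    have h8 : β * η ^ 2 ≤ 1 / 8 * (η * β) := by
      have := mul_le_mul_of_nonneg_left hη8 (mul_pos hβ0 hη).le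
      linarith
    linarith [sq_nonneg (Mp P C q), sq_nonneg (Mhat P C q), mul_pos hβ0 hη]

lemma ρ_le_Lbar (T : Setting P C q) (ε : ℝ) : q.ρ ≤ Lbar P C q ε := by
  have hσ := T.one_lt_σ
  have h1 := eight_le_betaBar P C q ε
  have h2 : 0 ≤ Lc P C * q.σ * betaBar P C q ε :=
    mul_nonneg (mul_nonneg T.Lc_nonneg (by linarith)) (by linarith)
  have h3 := mul_nonneg (Mhat_nonneg P C q) (Lsum_nonneg C)
  unfold Lbar
  linarith [T.comp.L₀_nonneg, T.ρ_pos]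

lemma penLoop_spec (T : Setting P C q) {ε : ℝ} (hε : 0 < ε) (hε2 : ε ≤ 1 / 2) {c xs : Vec n}
    {ps pbar : Dual l m} (hS : Saddle P C q c xs ps)
    (hp0 : ∀ i, 0 ≤ pbar.2 i) (hpn : dualNorm pbar ≤ Mhat P C q) : ∀ (N : ℕ) (x : Vec n)
      (p : Dual l m) (β' β : ℝ), x ∈ P.X → q.β₀ ≤ β → betaBar P C q ε ≤ β * q.σ ^ N →
      β * q.σ ^ N ≤ q.σ * betaBar P C q ε →
      (∃ βo xo po cnt, PenLoop (P.prox q.ρ c) q (penTol q ε) pbar x p β' β βo xo po cnt) ∧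
      ∀ βo xo po cnt, PenLoop (P.prox q.ρ c) q (penTol q ε) pbar x p β' β βo xo po cnt →
        ((xo = x ∧ po = p ∧ βo = β' ∧ (P.prox q.ρ c).IsKKTPair (penTol q ε) x p) ∨
          (β ≤ βo ∧ PenOut P C q ε c pbar βo xo po)) ∧
        (cnt : ℝ) ≤ ∑ i ∈ Finset.range (N + 1), penCost P C q ε (β * q.σ ^ i) := by
  have hσ := T.one_lt_σ
  have hβ₀ := T.β₀_pos
  have hcost : ∀ β, 0 ≤ penCost P C q ε β := fun β => T.apgCost_nonneg (T.ρ_le_Lbar ε) _ _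
  have hcall : ∀ β, q.β₀ ≤ β → β ≤ q.σ * betaBar P C q ε → ∀ x ∈ P.X,
      (∃ out t, AdapAPG ((P.prox q.ρ c).augSmooth β pbar) P.X P.h x q.ρ
        (penTol q ε * min 1 (Real.sqrt q.ρ)) q.Lmin q.γ₁ q.γ₂ out t) ∧
      ∀ out t, AdapAPG ((P.prox q.ρ c).augSmooth β pbar) P.X P.h x q.ρ
        (penTol q ε * min 1 (Real.sqrt q.ρ)) q.Lmin q.γ₁ q.γ₂ out t →
        Stationary ((P.prox q.ρ c).augSmooth β pbar) P.X P.h (epsBar₂ q ε) out ∧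
          (t : ℝ) ≤ penCost P C q ε β := by
    intro β h1 h2 x hx
    rw [T.penTol_mul]
    refine T.apg_call c h1 pbar ((norm_snd_le_dualNorm pbar).trans hpn) ?_ hx (T.epsBar₂_pos hε)
    have := mul_le_mul_of_nonneg_right h2 T.Lc_nonneg
    unfold augLip Lbar
    linarith
  intro N
  induction N with
  | zero =>
    intro x p β' β hx hβ h1 h2
    rw [pow_zero, mul_one] at h1 h2
    obtain ⟨⟨u, t, hu⟩, hall⟩ := hcall β hβ h2 x hx
    have hkkt : ∀ u, Stationary ((P.prox q.ρ c).augSmooth β pbar) P.X P.h (epsBar₂ q ε) u →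
        (P.prox q.ρ c).IsKKTPair (penTol q ε) u ((P.prox q.ρ c).dualStep β pbar u) :=
      fun u hst => T.pen_step_kkt hε hε2 h1 hS hp0 hpn hst
    constructor
    · by_cases hk : (P.prox q.ρ c).IsKKTPair (penTol q ε) x p
      · exact ⟨_, _, _, _, .done hk⟩
      · exact ⟨_, _, _, _, .step hk hu (.done (hkkt u (hall _ _ hu).1))⟩
    · intro βo xo po cnt hr
      cases hr with
      | done hk => exact ⟨.inl ⟨rfl, rfl, rfl, hk⟩, by simpa using hcost _⟩
      | step hk ha hr =>
        obtain ⟨a1, a2⟩ := hall _ _ ha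
        cases hr with
        | done hk' => exact ⟨.inr ⟨le_rfl, hk', a1, h2⟩, by simpa using a2⟩
        | step hk' ha' hr' => exact absurd (hkkt _ a1) hk'
  | succ N ih =>
    intro x p β' β hx hβ h1 h2
    have hβ0 : 0 < β := hβ₀.trans_le hβ
    have hβσ : β ≤ β * q.σ := le_mul_of_one_le_right hβ0.le hσ.le
    have hβle : β ≤ q.σ * betaBar P C q ε :=
      (le_mul_of_one_le_right hβ0.le (one_le_pow₀ hσ.le)).trans h2
    obtain ⟨⟨u, t, hu⟩, hall⟩ := hcall β hβ hβle x hx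
    have e : q.σ * β * q.σ ^ N = β * q.σ ^ (N + 1) := by ring
    have hih := fun u (hu : u ∈ P.X) => ih u ((P.prox q.ρ c).dualStep β pbar u) β (q.σ * β) hu
      (by linarith) (by rw [e]; exact h1) (by rw [e]; exact h2)
    have hsum : ∑ i ∈ Finset.range (N + 1 + 1), penCost P C q ε (β * q.σ ^ i)
        = penCost P C q ε β
          + ∑ i ∈ Finset.range (N + 1), penCost P C q ε (q.σ * β * q.σ ^ i) := by
      rw [Finset.sum_range_succ', pow_zero, mul_one, add_comm]
      congr 1
      exact Finset.sum_congr rfl fun i _ => by congr 1; ring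
    have hsum0 : 0 ≤ ∑ i ∈ Finset.range (N + 1), penCost P C q ε (q.σ * β * q.σ ^ i) :=
      Finset.sum_nonneg fun i _ => hcost _
    constructor
    · by_cases hk : (P.prox q.ρ c).IsKKTPair (penTol q ε) x p
      · exact ⟨_, _, _, _, .done hk⟩
      · obtain ⟨βo, xo, po, cnt, hr⟩ := (hih u (hall _ _ hu).1.choose_spec.1.1).1
        exact ⟨_, _, _, _, .step hk hu hr⟩
    · intro βo xo po cnt hr
      rw [hsum]
      cases hr with
      | done hk =>
        refine ⟨.inl ⟨rfl, rfl, rfl, hk⟩, ?_⟩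
        have := hcost β
        push_cast; linarith
      | step hk ha hr =>
        obtain ⟨a1, a2⟩ := hall _ _ ha
        obtain ⟨b1, b2⟩ := (hih _ a1.choose_spec.1.1).2 _ _ _ _ hr
        refine ⟨.inr ?_, by push_cast; linarith⟩
        rcases b1 with ⟨rfl, rfl, rfl, hk'⟩ | ⟨hle, hout⟩
        · exact ⟨le_rfl, hk', a1, hβle⟩
        · exact ⟨by linarith, hout⟩

end Setting

end PenAnalysis

/-! ### Evaluations of the two subroutines -/

section Costs

variable {n l m : ℕ}

lemma sum_pow_le {s : ℝ} (hs : 1 < s) (N : ℕ) :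
    ∑ i ∈ Finset.range N, s ^ i ≤ s ^ N / (s - 1) := by
  rw [geom_sum_eq hs.ne']
  have : 0 < s - 1 := by linarith
  gcongr
  linarith

lemma sqrt_pow_eq {s : ℝ} (hs : 0 ≤ s) (k : ℕ) : Real.sqrt (s ^ k) = Real.sqrt s ^ k := by
  rw [Real.sqrt_eq_iff_mul_self_eq (by positivity) (by positivity), ← mul_pow,
    Real.mul_self_sqrt hs]

lemma sqrt_add_three_le {a b c : ℝ} (ha : 0 ≤ a) (hb : 0 ≤ b) (hc : 0 ≤ c) :
    Real.sqrt (a + b + c) ≤ Real.sqrt a + Real.sqrt b + Real.sqrt c := by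
  apply Real.sqrt_le_iff.2 ⟨by positivity, ?_⟩
  have h1 := mul_nonneg (Real.sqrt_nonneg a) (Real.sqrt_nonneg b)
  have h2 := mul_nonneg (Real.sqrt_nonneg a) (Real.sqrt_nonneg c)
  have h3 := mul_nonneg (Real.sqrt_nonneg b) (Real.sqrt_nonneg c)
  nlinarith [Real.sq_sqrt ha, Real.sq_sqrt hb, Real.sq_sqrt hc]

namespace Setting

variable {P : NLP n l m} {C : Consts n m} {q : Params}

lemma ChatEps_pos (T : Setting P C q) (ε : ℝ) : 0 < ChatEps P C q ε :=
  (div_pos (by norm_num) T.β₀_pos).trans_le ((le_max_right _ _).trans (le_max_right _ _))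

lemma kappa_nonneg (T : Setting P C q) : 0 ≤ kappa P C q := by
  have := mul_nonneg (Mp_nonneg P C q) (Lsum_nonneg C)
  unfold kappa
  exact div_nonneg (by linarith [T.comp.L₀_nonneg, T.ρ_pos]) T.ρ_pos.le

lemma Kialm_eq (T : Setting P C q) {ε : ℝ} (hC : 1 ≤ ChatEps P C q ε) :
    (Kialm P C q ε : ℝ) = ialmSteps P C q ε + 1 := by
  have h := Int.natCast_ceil_eq_ceil (Real.logb_nonneg T.one_lt_σ hC)
  unfold Kialm ialmSteps
  rw [← h]
  push_cast
  rfl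

lemma ρ_le_LhatEps (T : Setting P C q) {ε : ℝ} (hε : 0 < ε) : q.ρ ≤ LhatEps P C q ε := by
  have h1 := mul_nonneg (mul_nonneg (mul_nonneg T.β₀_pos.le (by linarith [T.one_lt_σ] : 0 ≤ q.σ))
    T.Lc_nonneg) (T.ChatEps_pos ε).le
  have hM := Mp_nonneg P C q
  have h2 : 0 ≤ Lsum C * (2 * Mp P C q
    + ε / (2 * Real.sqrt 2) * Real.sqrt (q.β₀ * ChatEps P C q ε)) :=
    mul_nonneg (Lsum_nonneg C) (by positivity)
  unfold LhatEps
  linarith [T.comp.L₀_nonneg, T.ρ_pos]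

lemma pow_ialmSteps_le (T : Setting P C q) {ε : ℝ} (hC : 1 ≤ ChatEps P C q ε) :
    q.σ ^ (ialmSteps P C q ε + 1) ≤ q.σ ^ 2 * ChatEps P C q ε := by
  have hσ := T.one_lt_σ
  have h1 : q.σ ^ ialmSteps P C q ε ≤ q.σ * ChatEps P C q ε :=
    (pow_ceil_logb_le hσ (T.ChatEps_pos ε)).trans (max_le (by nlinarith) le_rfl)
  rw [pow_succ]
  nlinarith

/-- The square roots of the condition numbers of the subproblems grow geometrically. -/
lemma sum_sqrt_augLip_le (T : Setting P C q) {ε : ℝ} (hε : 0 < ε) (hC : 1 ≤ ChatEps P C q ε) :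
    ∑ k ∈ Finset.range (ialmSteps P C q ε + 1),
      Real.sqrt (augLip P C q (q.β₀ * q.σ ^ k) (ialmZeta P C q ε (q.β₀ * q.σ ^ k)) / q.ρ)
      ≤ Real.sqrt (kappa P C q) * Kialm P C q ε + CtilEps P C q ε := by
  have hσ := T.one_lt_σ
  have hσ0 : 0 < q.σ := by linarith
  have hβ₀ := T.β₀_pos
  have hρ := T.ρ_pos
  have hLc := T.Lc_nonneg
  have hLs := Lsum_nonneg C
  have hCe := T.ChatEps_pos ε
  set K := ialmSteps P C q ε with hK
  set Ce := ChatEps P C q ε with hCedef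
  set s := Real.sqrt q.σ with hs
  set a := q.σ ^ (1 / 4 : ℝ) with ha
  have hs1 : 1 < s := by rw [hs, Real.lt_sqrt zero_le_one]; linarith
  have hs2 : s ^ 2 = q.σ := Real.sq_sqrt hσ0.le
  have ha0 : 0 < a := Real.rpow_pos_of_pos hσ0 _
  have ha1 : 1 < a := Real.one_lt_rpow hσ (by norm_num)
  have ha2 : a ^ 2 = s := by
    rw [ha, hs, Real.sqrt_eq_rpow, ← Real.rpow_mul_natCast hσ0.le]; norm_num
  set b := Ce ^ (1 / 4 : ℝ) with hb
  have hb0 : 0 < b := Real.rpow_pos_of_pos hCe _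
  have hb4 : b ^ 4 = Ce := by
    rw [hb, ← Real.rpow_mul_natCast hCe.le]; norm_num
  set t := Real.sqrt (Lsum C * (ε * Real.sqrt q.β₀ / Real.sqrt (2 * q.σ))) with ht
  -- the bound on one term
  have hterm : ∀ k : ℕ,
      Real.sqrt (augLip P C q (q.β₀ * q.σ ^ k) (ialmZeta P C q ε (q.β₀ * q.σ ^ k)) / q.ρ)
      ≤ Real.sqrt (kappa P C q) + Real.sqrt (q.β₀ * Lc P C) / Real.sqrt q.ρ * s ^ k
        + t / Real.sqrt q.ρ * a ^ k := by
    intro k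
    have e : augLip P C q (q.β₀ * q.σ ^ k) (ialmZeta P C q ε (q.β₀ * q.σ ^ k)) / q.ρ
        = kappa P C q + q.β₀ * Lc P C / q.ρ * q.σ ^ k
          + Lsum C * (ε / 4 * Real.sqrt (q.β₀ * q.σ ^ k / (q.σ + 1))) / q.ρ := by
      unfold augLip ialmZeta kappa
      field_simp
      ring
    have h2 : Real.sqrt (q.β₀ * Lc P C / q.ρ * q.σ ^ k)
        = Real.sqrt (q.β₀ * Lc P C) / Real.sqrt q.ρ * s ^ k := by
      rw [Real.sqrt_mul (by positivity), Real.sqrt_div (by positivity), sqrt_pow_eq hσ0.le]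
    have h3 : Real.sqrt (Lsum C * (ε / 4 * Real.sqrt (q.β₀ * q.σ ^ k / (q.σ + 1))) / q.ρ)
        ≤ t / Real.sqrt q.ρ * a ^ k := by
      have e1 : Real.sqrt (q.β₀ * q.σ ^ k / (q.σ + 1))
          = Real.sqrt q.β₀ / Real.sqrt (q.σ + 1) * (a ^ k) ^ 2 := by
        rw [Real.sqrt_div (by positivity), Real.sqrt_mul hβ₀.le, sqrt_pow_eq hσ0.le, ← hs, ← ha2]
        ring
      have e2 : ε / 4 * (Real.sqrt q.β₀ / Real.sqrt (q.σ + 1))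
          ≤ ε * Real.sqrt q.β₀ / Real.sqrt (2 * q.σ) := by
        have h4 : Real.sqrt (2 * q.σ) ≤ 4 * Real.sqrt (q.σ + 1) := by
          rw [Real.sqrt_le_left (by positivity), mul_pow, Real.sq_sqrt (by positivity)]
          linarith
        have h5 : 0 < Real.sqrt (2 * q.σ) := Real.sqrt_pos.2 (by positivity)
        calc ε / 4 * (Real.sqrt q.β₀ / Real.sqrt (q.σ + 1))
            = ε * Real.sqrt q.β₀ / (4 * Real.sqrt (q.σ + 1)) := by field_simp
          _ ≤ _ := div_le_div_of_nonneg_left (by positivity) h5 h4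
      calc Real.sqrt (Lsum C * (ε / 4 * Real.sqrt (q.β₀ * q.σ ^ k / (q.σ + 1))) / q.ρ)
          = Real.sqrt (Lsum C * (ε / 4 * (Real.sqrt q.β₀ / Real.sqrt (q.σ + 1))) / q.ρ
              * (a ^ k) ^ 2) := by rw [e1]; congr 1; ring
        _ ≤ Real.sqrt (Lsum C * (ε * Real.sqrt q.β₀ / Real.sqrt (2 * q.σ)) / q.ρ
              * (a ^ k) ^ 2) := by gcongr
        _ = _ := by
          rw [Real.sqrt_mul (by positivity), Real.sqrt_div (by positivity),
            Real.sqrt_sq (by positivity)]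
    rw [e]
    refine (sqrt_add_three_le T.kappa_nonneg (by positivity) (by positivity)).trans ?_
    rw [h2]
    linarith
  refine (Finset.sum_le_sum fun k _ => hterm k).trans ?_
  rw [Finset.sum_add_distrib, Finset.sum_add_distrib, ← Finset.mul_sum, ← Finset.mul_sum,
    Finset.sum_const, Finset.card_range, nsmul_eq_mul, T.Kialm_eq hC]
  have hpow := T.pow_ialmSteps_le hC
  have g1 : s ^ (K + 1) ≤ Real.sqrt (q.σ ^ 2 * Ce) := by
    rw [hs, ← sqrt_pow_eq hσ0.le]
    exact Real.sqrt_le_sqrt hpow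
  have g2 : a ^ (K + 1) ≤ s * b := by
    refine le_of_pow_le_pow_left₀ (n := 4) (by norm_num) (by positivity) ?_
    calc (a ^ (K + 1)) ^ 4 = ((a ^ 2) ^ 2) ^ (K + 1) := by ring
      _ = q.σ ^ (K + 1) := by rw [ha2, hs2]
      _ ≤ q.σ ^ 2 * Ce := hpow
      _ = (s * b) ^ 4 := by rw [mul_pow, hb4, ← hs2]; ring
  have d1 : 0 < s - 1 := by linarith
  have d2 : 0 < a - 1 := by linarith
  have hsρ : 0 < Real.sqrt q.ρ := Real.sqrt_pos.2 hρ
  have c1 : Real.sqrt (q.β₀ * Lc P C) / Real.sqrt q.ρ * ∑ i ∈ Finset.range (K + 1), s ^ i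
      ≤ Real.sqrt (q.β₀ * Lc P C * q.σ ^ 2 * Ce) / (Real.sqrt q.ρ * (s - 1)) := by
    calc _ ≤ Real.sqrt (q.β₀ * Lc P C) / Real.sqrt q.ρ * (Real.sqrt (q.σ ^ 2 * Ce) / (s - 1)) := by
          gcongr
          exact (sum_pow_le hs1 _).trans (by gcongr)
      _ = Real.sqrt (q.β₀ * Lc P C) * Real.sqrt (q.σ ^ 2 * Ce) / (Real.sqrt q.ρ * (s - 1)) := by
          field_simp
      _ = _ := by rw [← Real.sqrt_mul (by positivity)]; congr 2; ring
  have c2 : t / Real.sqrt q.ρ * ∑ i ∈ Finset.range (K + 1), a ^ i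
      ≤ t * (s * b / (Real.sqrt q.ρ * (a - 1))) := by
    calc _ ≤ t / Real.sqrt q.ρ * (s * b / (a - 1)) := by
          gcongr
          exact (sum_pow_le ha1 _).trans (by gcongr)
      _ = _ := by field_simp
  unfold CtilEps
  push_cast
  linarith

lemma sum_ialmCost_le (T : Setting P C q) {ε : ℝ} (hε : 0 < ε) (hC : 1 ≤ ChatEps P C q ε) :
    ∑ k ∈ Finset.range (ialmSteps P C q ε + 1), ialmCost P C q ε k ≤ Tialm P C q ε := by
  have h1 := T.sum_sqrt_augLip_le hε hC
  have hγ := T.one_lt_γ₁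
  have h2 : ∀ k, ialmCost P C q ε k
      = 6 * trials q * Real.sqrt q.γ₁ * logTerm P q (LhatEps P C q ε) (epsBar₁ q ε)
        * Real.sqrt (augLip P C q (q.β₀ * q.σ ^ k) (ialmZeta P C q ε (q.β₀ * q.σ ^ k)) / q.ρ)
        + (3 * ⌈Real.logb q.γ₁ (LhatEps P C q ε / q.ρ)⌉ + 3) := by
    intro k
    unfold ialmCost apgCost
    rw [mul_div_assoc q.γ₁, Real.sqrt_mul (by linarith)]
    ring
  have h3 := T.one_le_trials
  have h4 := one_le_logTerm P q (LhatEps P C q ε) (epsBar₁ q ε)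
  simp only [h2]
  rw [Finset.sum_add_distrib, ← Finset.mul_sum, Finset.sum_const, Finset.card_range,
    nsmul_eq_mul]
  have h5 : 0 ≤ 6 * trials q * Real.sqrt q.γ₁
      * logTerm P q (LhatEps P C q ε) (epsBar₁ q ε) := by positivity
  have h6 := mul_le_mul_of_nonneg_left h1 h5
  have h7 := T.Kialm_eq hC
  unfold Tialm
  rw [h7] at h6 ⊢
  push_cast
  linarith

lemma Tialm_nonneg (T : Setting P C q) {ε : ℝ} (hε : 0 < ε) (hC : 1 ≤ ChatEps P C q ε) :
    0 ≤ Tialm P C q ε :=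
  (Finset.sum_nonneg fun _ _ => T.apgCost_nonneg (T.ρ_le_LhatEps hε) _ _).trans
    (T.sum_ialmCost_le hε hC)

/-- The inexact augmented Lagrangian method can always be run to its end, whatever the choices in its
runs; each finished run meets the output conditions and the bound on the evaluations. -/
lemma ialm_spec (T : Setting P C q) {ε : ℝ} (hε : 0 < ε) (hε2 : ε ≤ 1 / 2)
    (hC : 1 ≤ ChatEps P C q ε) {c x : Vec n} (hc : c ∈ P.X) (hx : x ∈ P.X) :
    (∃ βo xo po cnt, IALM P q (ε / 2) x c βo xo po cnt) ∧
    ∀ βo xo po cnt, IALM P q (ε / 2) x c βo xo po cnt →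
      IALMOut P C q ε c βo xo po ∧ (cnt : ℝ) ≤ Tialm P C q ε := by
  obtain ⟨xs, ps, hS⟩ := T.exists_saddle hc
  have hβ₀ := T.β₀_pos
  have hσ := T.one_lt_σ
  have hI : IALMState P C q ε ps (q.β₀ * q.σ ^ 0) x 0 := by
    refine ⟨hx, fun i => le_rfl, ?_⟩
    have h1 : dualNorm (0 - ps) = dualNorm ps := by rw [dualNorm_sub_rev, sub_zero]
    have h2 := pow_le_pow_left₀ (dualNorm_nonneg ps) hS.norm_le 2
    rw [h1]
    have : 0 ≤ ε ^ 2 / 16 * (q.β₀ * q.σ ^ 0 / (q.σ + 1)) := by positivity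
    linarith
  obtain ⟨h1, h2⟩ := T.ialmLoop_spec hε hε2 hC hc hS (ialmSteps P C q ε) 0 (by omega) x 0 hI
  rw [pow_zero, mul_one] at h1 h2
  refine ⟨h1, fun βo xo po cnt hr => ?_⟩
  obtain ⟨a1, a2⟩ := h2 _ _ _ _ hr
  simp only [zero_add] at a2
  exact ⟨a1, a2.trans (T.sum_ialmCost_le hε hC)⟩

lemma sum_penCost_le (T : Setting P C q) {ε : ℝ} {β : ℝ} (hβ : 0 < β) {N : ℕ}
    (hN : β * q.σ ^ N ≤ q.σ * betaBar P C q ε) (hK : (N : ℝ) + 1 ≤ Kpen P C q ε) :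
    ∑ i ∈ Finset.range (N + 1), penCost P C q ε (β * q.σ ^ i) ≤ Tpen P C q ε := by
  have hσ := T.one_lt_σ
  have hσ0 : 0 < q.σ := by linarith
  have hρ := T.ρ_pos
  have hγ := T.one_lt_γ₁
  have hLc := T.Lc_nonneg
  have hL₀ := T.comp.L₀_nonneg
  have hML := mul_nonneg (Mhat_nonneg P C q) (Lsum_nonneg C)
  have hbb : 0 ≤ betaBar P C q ε := by linarith [eight_le_betaBar P C q ε]
  set s := Real.sqrt q.σ with hs
  have hs1 : 1 < s := by rw [hs, Real.lt_sqrt zero_le_one]; linarith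
  have d1 : 0 < s - 1 := by linarith
  have hterm : ∀ i : ℕ, Real.sqrt (augLip P C q (β * q.σ ^ i) (Mhat P C q))
      ≤ Real.sqrt (2 * q.ρ) + Real.sqrt (C.L₀ + Mhat P C q * Lsum C)
        + Real.sqrt (β * Lc P C) * s ^ i := by
    intro i
    have e : augLip P C q (β * q.σ ^ i) (Mhat P C q)
        = 2 * q.ρ + (C.L₀ + Mhat P C q * Lsum C) + β * Lc P C * q.σ ^ i := by
      unfold augLip; ring
    rw [e]
    refine (sqrt_add_three_le (by positivity) (by positivity) (by positivity)).trans ?_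
    rw [Real.sqrt_mul (by positivity) (q.σ ^ i), sqrt_pow_eq hσ0.le]
  have hsum : ∑ i ∈ Finset.range (N + 1),
      Real.sqrt (augLip P C q (β * q.σ ^ i) (Mhat P C q)) ≤ alphaK P C q ε := by
    refine (Finset.sum_le_sum fun k _ => hterm k).trans ?_
    rw [Finset.sum_add_distrib, Finset.sum_const, Finset.card_range, nsmul_eq_mul,
      ← Finset.mul_sum]
    have h1 : Real.sqrt (β * Lc P C) * ∑ i ∈ Finset.range (N + 1), s ^ i
        ≤ q.σ * Real.sqrt (betaBar P C q ε * Lc P C) / (s - 1) := by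
      calc _ ≤ Real.sqrt (β * Lc P C) * (s ^ (N + 1) / (s - 1)) := by
            gcongr
            exact sum_pow_le hs1 _
        _ = Real.sqrt (β * Lc P C * q.σ ^ (N + 1)) / (s - 1) := by
            rw [Real.sqrt_mul (by positivity) (q.σ ^ (N + 1)), sqrt_pow_eq hσ0.le]; ring
        _ ≤ Real.sqrt (q.σ ^ 2 * (betaBar P C q ε * Lc P C)) / (s - 1) := by
            refine div_le_div_of_nonneg_right (Real.sqrt_le_sqrt ?_) d1.le
            have := mul_le_mul_of_nonneg_left hN (mul_nonneg hσ0.le hLc)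
            calc β * Lc P C * q.σ ^ (N + 1) = q.σ * Lc P C * (β * q.σ ^ N) := by ring
              _ ≤ _ := this
              _ = _ := by ring
        _ = _ := by rw [Real.sqrt_mul (by positivity), Real.sqrt_sq hσ0.le]
    have h2 := mul_le_mul_of_nonneg_right hK
      (add_nonneg (Real.sqrt_nonneg (2 * q.ρ)) (Real.sqrt_nonneg (C.L₀ + Mhat P C q * Lsum C)))
    unfold alphaK
    push_cast
    linarith
  have h2 : ∀ i : ℕ, penCost P C q ε (β * q.σ ^ i)
      = 6 * trials q * Real.sqrt (q.γ₁ / q.ρ) * logTerm P q (Lbar P C q ε) (epsBar₂ q ε)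
        * Real.sqrt (augLip P C q (β * q.σ ^ i) (Mhat P C q))
        + (3 * ⌈Real.logb q.γ₁ (Lbar P C q ε / q.ρ)⌉ + 3) := by
    intro i
    unfold penCost apgCost
    rw [mul_div_right_comm q.γ₁, Real.sqrt_mul (by positivity)]
    ring
  have h3 := T.one_le_trials
  have h4 := one_le_logTerm P q (Lbar P C q ε) (epsBar₂ q ε)
  have h5 := T.ceil_logb_nonneg (T.ρ_le_Lbar ε)
  simp only [h2]
  rw [Finset.sum_add_distrib, ← Finset.mul_sum, Finset.sum_const, Finset.card_range,
    nsmul_eq_mul]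
  have h6 : 0 ≤ 6 * trials q * Real.sqrt (q.γ₁ / q.ρ)
      * logTerm P q (Lbar P C q ε) (epsBar₂ q ε) := by positivity
  have h7 := mul_le_mul_of_nonneg_left hsum h6
  have h8 := mul_le_mul_of_nonneg_right hK
    (by linarith : (0 : ℝ) ≤ 3 * ⌈Real.logb q.γ₁ (Lbar P C q ε / q.ρ)⌉ + 3)
  unfold Tpen
  push_cast
  linarith

/-- The alternative `xo = c` covers a call whose centre satisfies the stopping test at once. -/
lemma penMM_spec (T : Setting P C q) {ε : ℝ} (hε : 0 < ε) (hε2 : ε ≤ 1 / 2)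
    (hC : 1 ≤ ChatEps P C q ε) {c : Vec n} (hc : c ∈ P.X) {pbar : Dual l m}
    (hp0 : ∀ i, 0 ≤ pbar.2 i) (hpn : dualNorm pbar ≤ Mhat P C q) {β : ℝ} (hβ : q.β₀ ≤ β)
    (hβ' : β ≤ q.σ * betaBar P C q ε) :
    (∃ βo xo po cnt, PenMM P q (penTol q ε) β c pbar βo xo po cnt) ∧
    ∀ βo xo po cnt, PenMM P q (penTol q ε) β c pbar βo xo po cnt →
      (P.prox q.ρ c).IsKKTPair (penTol q ε) xo po ∧
      (xo = c ∨ β ≤ βo ∧ PenOut P C q ε c pbar βo xo po) ∧ (cnt : ℝ) ≤ Tpen P C q ε := by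
  obtain ⟨xs, ps, hS⟩ := T.exists_saddle hc
  have hβ₀ := T.β₀_pos
  have hσ := T.one_lt_σ
  have hβ0 : 0 < β := hβ₀.trans_le hβ
  have hbb : 0 < betaBar P C q ε := by linarith [eight_le_betaBar P C q ε]
  have hr0 : 0 < betaBar P C q ε / β := div_pos hbb hβ0
  set N := ⌈Real.logb q.σ (betaBar P C q ε / β)⌉₊ with hNdef
  have h1 : betaBar P C q ε ≤ β * q.σ ^ N := by
    rw [mul_comm]
    exact (div_le_iff₀ hβ0).1 (le_pow_ceil_logb hσ hr0)
  have h2 : β * q.σ ^ N ≤ q.σ * betaBar P C q ε := by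
    calc β * q.σ ^ N ≤ β * max 1 (q.σ * (betaBar P C q ε / β)) :=
          mul_le_mul_of_nonneg_left (pow_ceil_logb_le hσ hr0) hβ0.le
      _ = max β (q.σ * betaBar P C q ε) := by
          rw [mul_max_of_nonneg _ _ hβ0.le, mul_one]; congr 1; field_simp
      _ ≤ _ := max_le hβ' le_rfl
  have hge : q.β₀ ≤ betaBar P C q ε := by
    have := T.β₀_mul_ChatEps_le_betaBar hε
    nlinarith
  have h3 : (N : ℝ) + 1 ≤ Kpen P C q ε := by
    have k1 : Real.logb q.σ (betaBar P C q ε / β) ≤ Real.logb q.σ (betaBar P C q ε / q.β₀) :=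
      Real.logb_le_logb_of_le hσ hr0 (by gcongr)
    have k2 : 0 ≤ Real.logb q.σ (betaBar P C q ε / q.β₀) :=
      Real.logb_nonneg hσ ((one_le_div hβ₀).2 hge)
    have k3 : N ≤ ⌈Real.logb q.σ (betaBar P C q ε / q.β₀)⌉₊ := Nat.ceil_mono k1
    have k4 := Int.natCast_ceil_eq_ceil k2
    unfold Kpen
    rw [← k4]
    push_cast
    have : (N : ℝ) ≤ (⌈Real.logb q.σ (betaBar P C q ε / q.β₀)⌉₊ : ℝ) := by exact_mod_cast k3
    linarith
  obtain ⟨a1, a2⟩ := T.penLoop_spec hε hε2 hS hp0 hpn N c pbar β β hc hβ h1 h2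
  refine ⟨a1, fun βo xo po cnt hr => ?_⟩
  obtain ⟨b1, b2⟩ := a2 _ _ _ _ hr
  have b3 := b2.trans (T.sum_penCost_le hβ0 h2 h3)
  rcases b1 with ⟨rfl, rfl, -, hk⟩ | ⟨hle, hout⟩
  · exact ⟨hk, .inl rfl, b3⟩
  · exact ⟨hout.kkt, .inr ⟨hle, hout⟩, b3⟩

lemma Tpen_nonneg (T : Setting P C q) {ε : ℝ} (hε : 0 < ε) (hC : 1 ≤ ChatEps P C q ε) :
    0 ≤ Tpen P C q ε := by
  have hge : 1 ≤ betaBar P C q ε / q.β₀ := by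
    rw [one_le_div T.β₀_pos]
    have := T.β₀_mul_ChatEps_le_betaBar hε
    nlinarith [T.β₀_pos]
  have hK : (0 : ℝ) ≤ Kpen P C q ε := by
    have : 0 ≤ Kpen P C q ε :=
      add_nonneg (Int.ceil_nonneg (Real.logb_nonneg T.one_lt_σ hge)) zero_le_one
    exact_mod_cast this
  have h3 := T.one_le_trials
  have h4 := one_le_logTerm P q (Lbar P C q ε) (epsBar₂ q ε)
  have h5 := T.ceil_logb_nonneg (T.ρ_le_Lbar ε)
  have hs1 : 1 ≤ Real.sqrt q.σ := Real.one_le_sqrt.2 T.one_lt_σ.le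
  have h6 : 0 ≤ alphaK P C q ε := by
    have : 0 ≤ Real.sqrt q.σ - 1 := by linarith
    have := T.one_lt_σ
    unfold alphaK
    positivity
  unfold Tpen
  positivity

end Setting

end Costs

/-! ### The penalty terms as functions of the penalty parameter -/

section Penalty

variable {n l m : ℕ} (P : NLP n l m)

lemma inv_mul_sq_max_sub_le {β β' z t : ℝ} (hβ : 0 < β) (h : β ≤ β') (hz : 0 ≤ z) :
    1 / (2 * β') * (max (z + β' * t) 0 ^ 2 - z ^ 2) - 1 / (2 * β) * (max (z + β * t) 0 ^ 2 - z ^ 2)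
      ≤ (β' - β) / 2 * max t 0 ^ 2 + z ^ 2 / 2 * (1 / β - 1 / β') := by
  have hβ' : 0 < β' := hβ.trans_le h
  have hinv : 1 / β' ≤ 1 / β := one_div_le_one_div_of_le hβ h
  rcases le_total 0 t with ht | ht
  · rw [max_eq_left ht, max_eq_left (by positivity), max_eq_left (by positivity)]
    have e : 1 / (2 * β') * ((z + β' * t) ^ 2 - z ^ 2) - 1 / (2 * β) * ((z + β * t) ^ 2 - z ^ 2)
        = (β' - β) / 2 * t ^ 2 := by field_simp; ring
    rw [e]
    have : 0 ≤ z ^ 2 / 2 * (1 / β - 1 / β') := mul_nonneg (by positivity) (by linarith)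
    linarith
  · rw [max_eq_right ht]
    have h1 : max (z + β' * t) 0 ≤ max (z + β * t) 0 :=
      max_le_max (by nlinarith) le_rfl
    have h2 : max (z + β' * t) 0 ^ 2 ≤ max (z + β * t) 0 ^ 2 :=
      pow_le_pow_left₀ (le_max_right _ _) h1 2
    have h3 : 1 / β' * max (z + β' * t) 0 ^ 2 ≤ 1 / β * max (z + β * t) 0 ^ 2 :=
      mul_le_mul hinv h2 (sq_nonneg _) (by positivity)
    have e : ∀ b w : ℝ, 1 / (2 * b) * (w - z ^ 2) = (1 / b * w) / 2 - z ^ 2 / 2 * (1 / b) := by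
      intro b w; rw [one_div, mul_inv]; ring
    rw [e, e]
    linarith

namespace NLP

lemma sq_feas (x : Vec n) :
    P.feas x ^ 2 = ‖P.res x‖ ^ 2 + ‖posVec (P.fvec x)‖ ^ 2 := Real.sq_sqrt (by positivity)

lemma penalty_eq_sum (β : ℝ) (p : Dual l m) (x : Vec n) :
    P.penalty β p x = ⟪p.1, P.res x⟫_ℝ + β / 2 * ‖P.res x‖ ^ 2
      + ∑ i, 1 / (2 * β) * (max (p.2 i + β * P.f i x) 0 ^ 2 - p.2 i ^ 2) := by
  unfold penalty
  rw [norm_posVec_sq, EuclideanSpace.real_norm_sq_eq p.2, ← Finset.sum_sub_distrib,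
    Finset.mul_sum]
  rfl

/-- Raising the penalty parameter costs at most a multiple of the squared infeasibility plus a term
that telescopes over consecutive raises. -/
lemma penalty_sub_le {β β' : ℝ} (hβ : 0 < β) (h : β ≤ β') {p : Dual l m}
    (hp : ∀ i, 0 ≤ p.2 i) (x : Vec n) :
    P.penalty β' p x - P.penalty β p x
      ≤ (β' - β) / 2 * P.feas x ^ 2 + dualNorm p ^ 2 / 2 * (1 / β - 1 / β') := by
  have hinv : 1 / β' ≤ 1 / β := one_div_le_one_div_of_le hβ h
  have h1 : ∑ i, 1 / (2 * β') * (max (p.2 i + β' * P.f i x) 0 ^ 2 - p.2 i ^ 2)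
      - ∑ i, 1 / (2 * β) * (max (p.2 i + β * P.f i x) 0 ^ 2 - p.2 i ^ 2)
      ≤ (β' - β) / 2 * ‖posVec (P.fvec x)‖ ^ 2 + ‖p.2‖ ^ 2 / 2 * (1 / β - 1 / β') := by
    rw [← Finset.sum_sub_distrib, norm_posVec_sq, EuclideanSpace.real_norm_sq_eq p.2,
      Finset.mul_sum, Finset.sum_div, Finset.sum_mul, ← Finset.sum_add_distrib]
    exact Finset.sum_le_sum fun i _ => inv_mul_sq_max_sub_le hβ h (hp i)
  have h2 : 0 ≤ ‖p.1‖ ^ 2 / 2 * (1 / β - 1 / β') := mul_nonneg (by positivity) (by linarith)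
  rw [penalty_eq_sum, penalty_eq_sum, sq_feas, dualNorm_sq]
  linarith

lemma neg_le_penalty {β : ℝ} (hβ : 0 < β) (p : Dual l m) (x : Vec n) :
    -(dualNorm p ^ 2 / (2 * β)) ≤ P.penalty β p x := by
  have h1 := abs_le.1 (abs_real_inner_le_norm p.1 (P.res x))
  have h2 : -(‖p.1‖ ^ 2 / (2 * β)) ≤ -(‖p.1‖ * ‖P.res x‖) + β / 2 * ‖P.res x‖ ^ 2 := by
    have e : -(‖p.1‖ * ‖P.res x‖) + β / 2 * ‖P.res x‖ ^ 2 + ‖p.1‖ ^ 2 / (2 * β)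
        = (‖p.1‖ - β * ‖P.res x‖) ^ 2 / (2 * β) := by field_simp; ring
    have : 0 ≤ (‖p.1‖ - β * ‖P.res x‖) ^ 2 / (2 * β) := by positivity
    linarith
  have h3 : -(‖p.2‖ ^ 2 / (2 * β))
      ≤ 1 / (2 * β) * (‖posVec (p.2 + β • P.fvec x)‖ ^ 2 - ‖p.2‖ ^ 2) := by
    have : 0 ≤ 1 / (2 * β) * ‖posVec (p.2 + β • P.fvec x)‖ ^ 2 := by positivity
    rw [mul_sub, one_div_mul_eq_div (2 * β) (‖p.2‖ ^ 2)]
    linarith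
  rw [dualNorm_sq, add_div]
  unfold penalty
  linarith [h1.1]

lemma penalty_le {β : ℝ} (hβ : 0 < β) {p : Dual l m} (hp : ∀ i, 0 ≤ p.2 i) (x : Vec n) :
    P.penalty β p x ≤ dualNorm p * P.feas x + β / 2 * P.feas x ^ 2 := by
  have h1 : ∑ i, 1 / (2 * β) * (max (p.2 i + β * P.f i x) 0 ^ 2 - p.2 i ^ 2)
      ≤ ⟪p.2, posVec (P.fvec x)⟫_ℝ + β / 2 * ‖posVec (P.fvec x)‖ ^ 2 := by
    rw [inner_vec_eq_sum, norm_posVec_sq, Finset.mul_sum, ← Finset.sum_add_distrib]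
    refine Finset.sum_le_sum fun i _ => ?_
    have hz := hp i
    have ht : 0 ≤ max (P.f i x) 0 := le_max_right _ _
    have h2 : max (p.2 i + β * P.f i x) 0 ≤ p.2 i + β * max (P.f i x) 0 :=
      max_le (by gcongr; exact le_max_left _ _) (by positivity)
    have h3 : max (p.2 i + β * P.f i x) 0 ^ 2 ≤ (p.2 i + β * max (P.f i x) 0) ^ 2 :=
      pow_le_pow_left₀ (le_max_right _ _) h2 2
    calc 1 / (2 * β) * (max (p.2 i + β * P.f i x) 0 ^ 2 - p.2 i ^ 2)
        ≤ 1 / (2 * β) * ((p.2 i + β * max (P.f i x) 0) ^ 2 - p.2 i ^ 2) := by gcongr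
      _ = p.2 i * max (P.f i x) 0 + β / 2 * max (P.f i x) 0 ^ 2 := by field_simp; ring
      _ = _ := rfl
  have h2 := (le_abs_self _).trans (abs_dual_inner_le p (P.res x, posVec (P.fvec x)))
  have h3 : dualNorm ((P.res x, posVec (P.fvec x)) : Dual l m) = P.feas x := rfl
  rw [h3] at h2
  rw [penalty_eq_sum, sq_feas]
  linarith

end NLP

end Penalty

/-! ### The number of stages -/

section Stages

variable {n l m : ℕ}

lemma mul_log_le_of_two_mul_log_le {a t : ℝ} (ha : 0 < a) (ht : 0 < t)
    (h : 2 * a * Real.log a ≤ t) : a * Real.log t ≤ t := by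
  have h1 : Real.log t = Real.log (t / (2 * a)) + Real.log 2 + Real.log a := by
    rw [Real.log_div ht.ne' (by positivity), Real.log_mul two_ne_zero ha.ne']; ring
  have h2 := Real.log_le_sub_one_of_pos (show 0 < t / (2 * a) by positivity)
  have h3 := Real.log_two_lt_d9
  have h4 : a * Real.log t ≤ a * (t / (2 * a) + Real.log a) := by
    rw [h1]; gcongr; linarith
  have h5 : a * (t / (2 * a) + Real.log a) = t / 2 + a * Real.log a := by field_simp
  linarith

lemma stageEnd_succ (q : Params) (s : ℕ) :
    stageEnd q (s + 1) = stageEnd q s + ⌈q.γ ^ s * q.N₁⌉₊ := by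
  unfold stageEnd; rw [Finset.sum_range_succ, add_assoc]

lemma stageEnd_zero (q : Params) : stageEnd q 0 = q.N₀ := by simp [stageEnd]

lemma stageEnd_one (q : Params) : stageEnd q 1 = q.N₀ + q.N₁ := by simp [stageEnd]

namespace Setting

variable {P : NLP n l m} {C : Consts n m} {q : Params}

lemma stageEnd_add_two_le (T : Setting P C q) (s : ℕ) :
    stageEnd q s + 2 ≤ stageEnd q (s + 1) := by
  rw [stageEnd_succ]
  have h1 : (2 : ℝ) ≤ q.N₁ := by exact_mod_cast T.two_le_N₁
  have h2 : (1 : ℝ) ≤ q.γ ^ s := one_le_pow₀ T.one_lt_γ.le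
  have h3 : (2 : ℝ) ≤ ⌈q.γ ^ s * q.N₁⌉₊ := by
    refine le_trans ?_ (Nat.le_ceil _)
    nlinarith
  have : 2 ≤ ⌈q.γ ^ s * q.N₁⌉₊ := by exact_mod_cast h3
  omega

lemma stageEnd_add_le (T : Setting P C q) {s t : ℕ} (h : s ≤ t) :
    stageEnd q s + (t - s) ≤ stageEnd q t := by
  induction t, h using Nat.le_induction with
  | base => omega
  | succ t hst ih =>
    have := T.stageEnd_add_two_le t
    omega

lemma stageEnd_ge (T : Setting P C q) (S : ℕ) :
    (q.N₀ + q.N₁ * ((q.γ ^ S - 1) / (q.γ - 1)) : ℝ) ≤ stageEnd q S := by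
  unfold stageEnd
  rw [← geom_sum_eq T.one_lt_γ.ne', Finset.mul_sum]
  push_cast
  gcongr with i
  rw [mul_comm]
  exact Nat.le_ceil _

lemma stageCond_nonempty (T : Setting P C q) (ε : ℝ) : {S : ℕ | StageCond P C q ε S}.Nonempty := by
  have hγ : 0 < q.γ - 1 := by linarith [T.one_lt_γ]
  have hN : (0 : ℝ) < q.N₁ := by exact_mod_cast (by linarith [T.two_le_N₁] : 0 < q.N₁)
  set A := 96 * q.ρ * C.B₀ / ε ^ 2 + 48 * q.ρ * q.N₀ * (diamD P / 2 + Mhat P C q) / ε with hA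
  obtain ⟨S, hS⟩ := pow_unbounded_of_one_lt
    (max (A / q.N₁ * (q.γ - 1) + 1) (2 * (Ctil P C q ε / ε) * Real.log (Ctil P C q ε / ε)))
    T.one_lt_γ
  obtain ⟨h1, h2⟩ := max_lt_iff.1 hS
  refine ⟨S, T.stageEnd_ge S, ?_, h2.le⟩
  have h3 : A / q.N₁ ≤ (q.γ ^ S - 1) / (q.γ - 1) := by
    rw [le_div_iff₀ hγ]; linarith
  have h4 : A ≤ q.N₁ * ((q.γ ^ S - 1) / (q.γ - 1)) := by
    rw [div_le_iff₀ hN] at h3; linarith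
  have : (0 : ℝ) ≤ q.N₀ := Nat.cast_nonneg _
  linarith

lemma stageCond_stageNum (T : Setting P C q) (ε : ℝ) : StageCond P C q ε (stageNum P C q ε) :=
  Nat.sInf_mem (T.stageCond_nonempty ε)

lemma exp_le_Ctil_div (P : NLP n l m) (C : Consts n m) (q : Params) {ε : ℝ} (hε : 0 < ε) :
    Real.exp 1 ≤ Ctil P C q ε / ε := by
  rw [le_div_iff₀ hε, mul_comm]
  exact le_max_right _ _

lemma one_le_stageNum (T : Setting P C q) {ε : ℝ} (hε : 0 < ε) : 1 ≤ stageNum P C q ε := by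
  rw [Nat.one_le_iff_ne_zero]
  intro h
  have h1 := (T.stageCond_stageNum ε).2.2
  rw [h, pow_zero] at h1
  have h2 := exp_le_Ctil_div P C q hε
  have h3 : 1 ≤ Real.log (Ctil P C q ε / ε) := by
    rw [Real.le_log_iff_exp_le ((Real.exp_pos 1).trans_le h2)]; exact h2
  have h4 := Real.add_one_le_exp 1
  nlinarith

/-- The loss of objective value in a stage. -/
noncomputable def stageLoss (P : NLP n l m) (C : Consts n m) (q : Params) : ℝ :=
  diamD P / 4 + 7 / 4 * Mhat P C q + q.σ * Chat P C q / 8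

lemma Chat_nonneg (P : NLP n l m) (C : Consts n m) (q : Params) : 0 ≤ Chat P C q :=
  (by norm_num : (0 : ℝ) ≤ 4).trans ((le_max_right _ _).trans (le_max_right _ _))

/-- After `S` stages the guaranteed decrease exceeds the variation of the objective plus all
losses. -/
lemma budget_lt (T : Setting P C q) {ε : ℝ} (hε : 0 < ε) :
    2 * C.B₀ + q.N₀ * (ε * (diamD P / 2 + Mhat P C q))
        + stageNum P C q ε * (ε * stageLoss P C q)
      < ((stageEnd q (stageNum P C q ε) : ℝ) - 1) * (3 * ε ^ 2 / (64 * q.ρ)) := by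
  have hρ := T.ρ_pos
  have hγ := T.one_lt_γ
  have hγ' : 0 < q.γ - 1 := by linarith
  have hlogγ : 0 < Real.log q.γ := Real.log_pos hγ
  have hS1 := T.one_le_stageNum hε
  obtain ⟨c1, c2, c3⟩ := T.stageCond_stageNum ε
  have hK3 := T.stageEnd_add_le hS1
  set S := stageNum P C q ε with hS
  have hN1 : (0 : ℝ) < q.N₁ := by exact_mod_cast (by linarith [T.two_le_N₁] : 0 < q.N₁)
  have hN0 : (1 : ℝ) ≤ q.N₀ := by
    have h : (0 : ℝ) < q.N₀ := (div_pos hN1 hγ').trans_le T.le_N₀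
    exact_mod_cast (show 0 < q.N₀ by exact_mod_cast h)
  have hK3' : (3 : ℝ) ≤ stageEnd q S := by
    rw [stageEnd_one] at hK3
    have := T.two_le_N₁
    have : 1 ≤ q.N₀ := by exact_mod_cast hN0
    exact_mod_cast (by omega : 3 ≤ stageEnd q S)
  have hSR : (1 : ℝ) ≤ S := by exact_mod_cast hS1
  set K := (q.N₀ + q.N₁ * ((q.γ ^ S - 1) / (q.γ - 1)) : ℝ) with hK
  set Q := 1 / 2 + diamD P / 2 + 9 * Mhat P C q / 4 + Chat P C q * q.σ / 4 with hQ
  have hQpos : 0 ≤ Q := by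
    have h1 := diamD_nonneg P
    have h2 := Mhat_nonneg P C q
    have h3 := mul_nonneg (Chat_nonneg P C q) (by linarith [T.one_lt_σ] : 0 ≤ q.σ)
    rw [hQ]; linarith
  -- the exponential growth of the stages pays for the losses of the stages
  have hQK : 96 * q.ρ * (S * Q) / ε ≤ K := by
    have ha := exp_le_Ctil_div P C q hε
    have ha0 : 0 < Ctil P C q ε / ε := (Real.exp_pos 1).trans_le ha
    have h1 := mul_log_le_of_two_mul_log_le ha0 (pow_pos (by linarith) S : 0 < q.γ ^ S) c3
    rw [Real.log_pow] at h1
    have h2 : 96 * q.ρ * (q.γ - 1) / (q.N₁ * Real.log q.γ) * Q ≤ Ctil P C q ε := le_max_left _ _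
    have h3 : 96 * q.ρ * (q.γ - 1) / (q.N₁ * Real.log q.γ) * Q / ε * (S * Real.log q.γ)
        ≤ q.γ ^ S := le_trans (by gcongr) h1
    have h4 : q.N₁ / (q.γ - 1) * q.γ ^ S ≤ K := by
      have e : K = q.N₀ - q.N₁ / (q.γ - 1) + q.N₁ / (q.γ - 1) * q.γ ^ S := by
        rw [hK]; field_simp; ring
      linarith [T.le_N₀]
    refine le_trans (le_of_eq ?_) ((mul_le_mul_of_nonneg_left h3
      (div_nonneg hN1.le hγ'.le)).trans h4)
    field_simp
  have k1 : 2 * C.B₀ + q.N₀ * (ε * (diamD P / 2 + Mhat P C q)) ≤ K * (ε ^ 2 / (48 * q.ρ)) := by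
    refine le_trans (le_of_eq ?_) (mul_le_mul_of_nonneg_right c2 (by positivity))
    field_simp
    ring
  have k2 : S * (ε * Q) ≤ K * (ε ^ 2 / (96 * q.ρ)) := by
    refine le_trans (le_of_eq ?_) (mul_le_mul_of_nonneg_right hQK (by positivity))
    field_simp
  have k3 : S * (ε * stageLoss P C q) < S * (ε * Q) := by
    have : stageLoss P C q < Q := by
      have h1 := diamD_nonneg P
      have h2 := Mhat_nonneg P C q
      have h3 := mul_nonneg (Chat_nonneg P C q) (by linarith [T.one_lt_σ] : 0 ≤ q.σ)
      rw [hQ]; unfold stageLoss; linarith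
    gcongr
  have k4 : K * (ε ^ 2 / (48 * q.ρ)) + K * (ε ^ 2 / (96 * q.ρ))
      = 2 * K * (ε ^ 2 / (64 * q.ρ)) := by field_simp; ring
  have k5 : 2 * K * (ε ^ 2 / (64 * q.ρ)) ≤ 3 * ((stageEnd q S : ℝ) - 1) * (ε ^ 2 / (64 * q.ρ)) := by
    exact mul_le_mul_of_nonneg_right (by linarith) (by positivity)
  have k6 : 3 * ((stageEnd q S : ℝ) - 1) * (ε ^ 2 / (64 * q.ρ))
      = ((stageEnd q S : ℝ) - 1) * (3 * ε ^ 2 / (64 * q.ρ)) := by ring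
  linarith

end Setting

end Stages

/-! ### The stages of the hybrid method -/

section Outer

variable {n l m : ℕ}

namespace Setting

variable {P : NLP n l m} {C : Consts n m} {q : Params}

/-- Decrease of the potential in an outer iteration that does not stop. -/
noncomputable def outerGain (q : Params) (ε : ℝ) : ℝ := 3 * ε ^ 2 / (64 * q.ρ)

/-- Upper bound for the objective after the initial stage and `s` further stages, up to the
decrease gained. -/
noncomputable def stageBase (P : NLP n l m) (C : Consts n m) (q : Params) (ε : ℝ) (s : ℕ) : ℝ :=
  C.B₀ + q.N₀ * (ε * (diamD P / 2 + Mhat P C q)) + s * (ε * stageLoss P C q)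

/-- The situation when the stage `s + 1` is entered in iteration `k`. -/
structure StageEntry (P : NLP n l m) (C : Consts n m) (q : Params) (ε : ℝ) (s k : ℕ) (x : Vec n)
    (β : ℝ) (p : Dual l m) : Prop where
  mem : x ∈ P.X
  nonneg : ∀ i, 0 ≤ p.2 i
  norm_le : dualNorm p ≤ Mhat P C q
  norm_le_mul : dualNorm p ≤ β * (ε / 2)
  le_β : q.β₀ ≤ β
  β_le : β ≤ q.σ * betaBar P C q ε
  feas_le : P.feas x ≤ ε / 2
  energy : P.g x + P.h x + ((k : ℝ) - 1) * outerGain q ε ≤ stageBase P C q ε s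

/-- The invariant of the stage `s + 1` with estimated multipliers `p`.  The energy bound is asked
for all penalty parameters from the current one on, because the next call of the penalty method
may raise the parameter. -/
structure StageInv (P : NLP n l m) (C : Consts n m) (q : Params) (ε : ℝ) (s k : ℕ) (x : Vec n)
    (β : ℝ) (p : Dual l m) : Prop where
  mem : x ∈ P.X
  nonneg : ∀ i, 0 ≤ p.2 i
  norm_le : dualNorm p ≤ Mhat P C q
  le_β : q.β₀ ≤ β
  β_le : β ≤ q.σ * betaBar P C q ε
  feas_le : P.feas x ≤ ε / 2
  energy : ∀ β', β ≤ β' → P.g x + P.h x + P.penalty β' p x + ((k : ℝ) - 1) * outerGain q ε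
    ≤ stageBase P C q ε s + 3 / 4 * Mhat P C q * ε + β' * ε ^ 2 / 8 - dualNorm p ^ 2 / (2 * β')

lemma StageEntry.inv (T : Setting P C q) {ε : ℝ} (hε : 0 < ε) {s k : ℕ} {x : Vec n} {β : ℝ}
    {p : Dual l m} (H : StageEntry P C q ε s k x β p) : StageInv P C q ε s k x β p := by
  refine ⟨H.mem, H.nonneg, H.norm_le, H.le_β, H.β_le, H.feas_le, fun β' hβ' => ?_⟩
  have hβ : 0 < β := T.β₀_pos.trans_le H.le_β
  have hβ'0 : 0 < β' := hβ.trans_le hβ'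
  have h1 := P.penalty_le hβ'0 H.nonneg x
  have hf := P.feas_nonneg x
  have h2 : dualNorm p * P.feas x ≤ Mhat P C q * (ε / 2) :=
    mul_le_mul H.norm_le H.feas_le hf (Mhat_nonneg P C q)
  have h3 : β' / 2 * P.feas x ^ 2 ≤ β' / 2 * (ε / 2) ^ 2 := by
    gcongr
    exact H.feas_le
  have h4 : dualNorm p ^ 2 / (2 * β') ≤ Mhat P C q * (ε / 4) := by
    rw [div_le_iff₀ (by positivity)]
    have h5 : dualNorm p ≤ β' * (ε / 2) := H.norm_le_mul.trans (by gcongr)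
    have h6 := mul_le_mul H.norm_le h5 (dualNorm_nonneg p) (Mhat_nonneg P C q)
    nlinarith
  linarith [H.energy]

lemma outerGain_le_pen (T : Setting P C q) {ε t δ : ℝ} (hε : 0 < ε)
    (ht : ¬ t ≤ ε / (4 * q.ρ)) (hδ : δ ≤ ε / (4 * Real.sqrt 2)) :
    outerGain q ε ≤ 3 / 2 * q.ρ * t ^ 2 - δ * t := by
  have hρ := T.ρ_pos
  rw [not_le, div_lt_iff₀ (by positivity)] at ht
  have ht0 : 0 < t := by
    by_contra h
    have := mul_nonneg (by linarith : 0 ≤ -t) (by positivity : 0 ≤ 4 * q.ρ)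
    linarith
  have hs : 4 / 3 ≤ Real.sqrt 2 := Real.le_sqrt_of_sq_le (by norm_num)
  have h1 : ε / (4 * Real.sqrt 2) ≤ 3 / 16 * ε := by
    rw [div_le_iff₀ (by positivity)]
    nlinarith
  have h2 : δ * t ≤ 3 / 4 * q.ρ * t ^ 2 := by
    have : δ * t ≤ 3 / 16 * (t * (4 * q.ρ)) * t := by gcongr; linarith
    linarith
  have h3 : outerGain q ε ≤ 3 / 4 * q.ρ * t ^ 2 := by
    unfold outerGain
    rw [div_le_iff₀ (by positivity)]
    have : ε ^ 2 ≤ (t * (4 * q.ρ)) ^ 2 := by gcongr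
    linarith
  linarith

lemma outerGain_nonneg (T : Setting P C q) (ε : ℝ) : 0 ≤ outerGain q ε := by
  have := T.ρ_pos
  unfold outerGain; positivity

lemma outerGain_le_ialm (T : Setting P C q) {ε t : ℝ} (hε : 0 < ε)
    (ht : ¬ t ≤ ε / (4 * q.ρ)) : outerGain q ε ≤ 3 / 2 * q.ρ * t ^ 2 := by
  have := T.outerGain_le_pen (δ := 0) hε ht (by positivity)
  linarith

lemma StageInv.pen (T : Setting P C q) {ε : ℝ} (hε : 0 < ε) {s k : ℕ} {x u : Vec n}
    {β βu : ℝ} {p pu : Dual l m} (H : StageInv P C q ε s k x β p) (hβ : β ≤ βu)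
    (ho : PenOut P C q ε x p βu u pu) (hs : ¬ ‖u - x‖ ≤ ε / (4 * q.ρ)) :
    StageInv P C q ε s (k + 1) u βu p := by
  have hβ0 : 0 < β := T.β₀_pos.trans_le H.le_β
  have hβu : 0 < βu := hβ0.trans_le hβ
  obtain ⟨k1, -, k3, -⟩ := (T.isKKTPair_prox_iff x _ u pu).1 ho.kkt
  have hfeas : P.feas u ≤ ε / 2 := k3.trans ((T.penTol_le' hε).trans (by linarith))
  refine ⟨k1, H.nonneg, H.norm_le, H.le_β.trans hβ, ho.β_le, hfeas, fun β' hβ' => ?_⟩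
  have h1 := T.penalty_descent H.mem hβu ho.stationary
  have h2 := T.outerGain_le_pen hε hs ((T.epsBar₂_le hε).trans (T.penTol_le hε))
  have h3 := H.energy βu hβ
  have h4 := P.penalty_sub_le hβu hβ' H.nonneg u
  have h5 : (β' - βu) / 2 * P.feas u ^ 2 ≤ (β' - βu) / 2 * (ε / 2) ^ 2 := by
    have : 0 ≤ (β' - βu) / 2 := by linarith
    have := P.feas_nonneg u
    gcongr
  have h6 : dualNorm p ^ 2 / 2 * (1 / βu - 1 / β')
      = dualNorm p ^ 2 / (2 * βu) - dualNorm p ^ 2 / (2 * β') := by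
    have : 0 < β' := hβu.trans_le hβ'
    field_simp
  push_cast
  linarith

lemma betaBar_le_Chat_div (P : NLP n l m) (C : Consts n m) (q : Params) {ε : ℝ} (hε : 0 < ε)
    (hε2 : ε ≤ 1 / 2) : betaBar P C q ε ≤ Chat P C q / ε := by
  rw [le_div_iff₀ hε]
  unfold betaBar Chat
  rw [max_mul_of_nonneg _ _ hε.le, max_mul_of_nonneg _ _ hε.le]
  refine max_le_max (le_of_eq ?_) (max_le_max (le_of_eq ?_) (by linarith)) <;>
  · rw [mul_comm ε, ← div_div, div_mul_cancel₀ _ hε.ne']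

/-- The decrease of the objective in a call of the augmented Lagrangian method from a nearly
feasible centre. -/
lemma ialm_energy (T : Setting P C q) {ε : ℝ} (hε : 0 < ε) {x w : Vec n} {β : ℝ} {p : Dual l m}
    (ho : IALMOut P C q ε x β w p) (hx : P.feas x ≤ ε / 2)
    (hs : ¬ ‖w - x‖ ≤ ε / (4 * q.ρ)) :
    P.g w + P.h w + outerGain q ε ≤ P.g x + P.h x + ε * (diamD P / 4 + Mhat P C q) := by
  have h1 := ho.descent
  have h2 := T.outerGain_le_ialm hε hs
  have h3 := mul_le_mul_of_nonneg_left hx (Mhat_nonneg P C q)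
  linarith

lemma IALMOut.mem_nonneg_feas (T : Setting P C q) {ε : ℝ} {x w : Vec n} {β : ℝ} {p : Dual l m}
    (ho : IALMOut P C q ε x β w p) : w ∈ P.X ∧ (∀ i, 0 ≤ p.2 i) ∧ P.feas w ≤ ε / 2 := by
  obtain ⟨k1, k2, k3, -⟩ := (T.isKKTPair_prox_iff x _ w p).1 ho.kkt
  exact ⟨k1, k2, k3⟩

lemma IALMOut.entry (T : Setting P C q) {ε : ℝ} (hε : 0 < ε) {s k : ℕ} {x w : Vec n} {β : ℝ}
    {p : Dual l m} (ho : IALMOut P C q ε x β w p)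
    (he : P.g w + P.h w + ((k : ℝ) - 1) * outerGain q ε ≤ stageBase P C q ε s) :
    StageEntry P C q ε s k w β p := by
  obtain ⟨k1, k2, k3⟩ := IALMOut.mem_nonneg_feas T ho
  exact ⟨k1, k2, ho.norm_le, ho.norm_le_mul, ho.le_β, ho.β_le.trans (mul_le_mul_of_nonneg_left
    (T.β₀_mul_ChatEps_le_betaBar hε) (by linarith [T.one_lt_σ])), k3, he⟩

/-- The call of the augmented Lagrangian method that ends a stage. -/
lemma StageInv.ialm (T : Setting P C q) {ε : ℝ} (hε : 0 < ε) (hε2 : ε ≤ 1 / 2) {s k : ℕ}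
    {x w : Vec n} {β βw : ℝ} {p pw : Dual l m} (H : StageInv P C q ε s k x β p)
    (ho : IALMOut P C q ε x βw w pw) (hs : ¬ ‖w - x‖ ≤ ε / (4 * q.ρ)) :
    StageEntry P C q ε (s + 1) (k + 1) w βw pw := by
  have hβ0 : 0 < β := T.β₀_pos.trans_le H.le_β
  have h1 := T.ialm_energy hε ho H.feas_le hs
  have h2 := H.energy β le_rfl
  have h3 := P.neg_le_penalty hβ0 p x
  have h4 : β * ε ^ 2 / 8 ≤ ε * (q.σ * Chat P C q / 8) := by
    have h5 : β ≤ q.σ * (Chat P C q / ε) := H.β_le.trans (mul_le_mul_of_nonneg_left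
      (betaBar_le_Chat_div P C q hε hε2) (by linarith [T.one_lt_σ]))
    calc β * ε ^ 2 / 8 ≤ q.σ * (Chat P C q / ε) * ε ^ 2 / 8 := by gcongr
      _ = _ := by field_simp
  refine IALMOut.entry T hε ho ?_
  unfold stageBase stageLoss at *
  push_cast
  linarith

/-- The last stage of the bound is never left. -/
lemma StageEntry.false (T : Setting P C q) {ε : ℝ} (hε : 0 < ε) {x : Vec n} {β : ℝ}
    {p : Dual l m} (H : StageEntry P C q ε (stageNum P C q ε) (stageEnd q (stageNum P C q ε))
      x β p) : False := by
  have h1 := T.budget_lt hε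
  have h2 := H.energy
  have h3 := (abs_le.1 (T.abs_obj_le H.mem)).1
  unfold stageBase outerGain at h2
  linarith

lemma natCast_le_ceil {c : ℕ} {t : ℝ} (h : (c : ℝ) ≤ t) : (c : ℤ) ≤ ⌈t⌉ := by
  have := h.trans (Int.le_ceil t)
  exact_mod_cast this

/-- A stage, entered or continued with at least one call of the penalty method left.  Here `s`
counts the finished stages, so that the loop is in the stage `s + 1`. -/
lemma stageLoop_spec (T : Setting P C q) {ε : ℝ} (hε : 0 < ε) (hε2 : ε ≤ 1 / 2)
    (hC : 1 ≤ ChatEps P C q ε) {init : ℕ → Vec n} (hinit : ∀ k, init k ∈ P.X) :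
    ∀ (N s k : ℕ) (x : Vec n) (p : Dual l m) (β : ℝ) (pbar : Dual l m),
      s + 1 ≤ stageNum P C q ε → k + 2 ≤ stageEnd q (s + 1) →
      stageEnd q (stageNum P C q ε) ≤ k + N → StageInv P C q ε s k x β pbar →
      (∃ xo po c, StageLoop P q ε ε (2 * penTol q ε) init (s + 1) (stageEnd q (s + 1)) k x p β pbar
        xo po c) ∧
      ∀ xo po c, StageLoop P q ε ε (2 * penTol q ε) init (s + 1) (stageEnd q (s + 1)) k x p β pbar
        xo po c → P.IsKKTPair ε xo po ∧
        (c : ℤ) ≤ ((stageNum P C q ε : ℤ) - s) * ⌈Tialm P C q ε⌉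
          + ((stageEnd q (stageNum P C q ε) : ℤ) - k - (stageNum P C q ε - s))
            * ⌈Tpen P C q ε⌉ := by
  have hρ := T.ρ_pos
  have etol : 2 * penTol q ε / 2 = penTol q ε := by ring
  have hTi : 0 ≤ ⌈Tialm P C q ε⌉ := Int.ceil_nonneg (T.Tialm_nonneg hε hC)
  have hTp : 0 ≤ ⌈Tpen P C q ε⌉ := Int.ceil_nonneg (T.Tpen_nonneg hε hC)
  set Ti := ⌈Tialm P C q ε⌉ with hTidef
  set Tp := ⌈Tpen P C q ε⌉ with hTpdef
  intro N
  induction N with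
  | zero =>
    intro s k x p β pbar hs hk hN
    have := T.stageEnd_add_le hs
    omega
  | succ N ih =>
    intro s k x p β pbar hs hk hN H
    have hmono := T.stageEnd_add_le hs
    set S := stageNum P C q ε with hSdef
    have hnum : (1 : ℤ) ≤ (stageEnd q S : ℤ) - k - (S - s) := by omega
    have hnum' : (1 : ℤ) ≤ (S : ℤ) - s := by omega
    obtain ⟨⟨βu, u, pu, cu, hu⟩, hall⟩ :=
      T.penMM_spec hε hε2 hC H.mem H.nonneg H.norm_le H.le_β H.β_le
    have hzero : (0 : ℝ) ≤ ε / (4 * q.ρ) := by positivity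
    -- the state after a call of the penalty method that does not stop
    have hnext : ∀ βu u pu cu, PenMM P q (penTol q ε) β x pbar βu u pu cu →
        ¬ ‖u - x‖ ≤ ε / (4 * q.ρ) → StageInv P C q ε s (k + 1) u βu pbar := by
      intro βu u pu cu hu hfar
      rcases (hall _ _ _ _ hu).2.1 with rfl | ⟨hle, ho⟩
      · rw [sub_self, norm_zero] at hfar; exact absurd hzero hfar
      · exact StageInv.pen T hε H hle ho hfar
    have hend : ∀ u βu, StageInv P C q ε s (k + 1) u βu pbar → k + 2 = stageEnd q (s + 1) →
        ∀ βw w pw c, IALM P q (ε / 2) (init (k + 1)) u βw w pw c →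
        ¬ ‖w - u‖ ≤ ε / (4 * q.ρ) → s + 1 < S ∧ StageEntry P C q ε (s + 1)
          (stageEnd q (s + 1)) w βw pw := by
      intro u βu Hu he βw w pw c hi ht
      have h1 := ((T.ialm_spec hε hε2 hC Hu.mem (hinit (k + 1))).2 _ _ _ _ hi).1
      have h2 := StageInv.ialm T hε hε2 Hu h1 ht
      rw [add_assoc, one_add_one_eq_two, he] at h2
      refine ⟨lt_of_le_of_ne hs fun h => ?_, h2⟩
      rw [h] at h2
      exact StageEntry.false T hε h2
    constructor
    · by_cases hk' : P.IsKKTPair ε x p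
      · exact ⟨_, _, _, .done hk'⟩
      rw [← etol] at hu
      by_cases hst : ‖u - x‖ ≤ ε / (4 * q.ρ)
      · exact ⟨_, _, _, .penStop hk' hu hst⟩
      have hu' := hu
      rw [etol] at hu'
      have Hu := hnext _ _ _ _ hu' hst
      by_cases he : k + 2 = stageEnd q (s + 1)
      · obtain ⟨βw, w, pw, cw, hw⟩ := (T.ialm_spec hε hε2 hC Hu.mem (hinit (k + 1))).1
        by_cases ht : ‖w - u‖ ≤ ε / (4 * q.ρ)
        · exact ⟨_, _, _, .ialmStop hk' hu hst he hw ht⟩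
        obtain ⟨h1, h2⟩ := hend _ _ Hu he _ _ _ _ hw ht
        obtain ⟨xo, po, c, hr⟩ := (ih (s + 1) (stageEnd q (s + 1)) w pw βw pw (by omega)
          (T.stageEnd_add_two_le _) (by omega) (StageEntry.inv T hε h2)).1
        rw [stageEnd_succ q (s + 1)] at hr
        exact ⟨_, _, _, .ialmNext hk' hu hst he hw ht hr⟩
      · obtain ⟨xo, po, c, hr⟩ := (ih s (k + 1) u pu βu pbar hs (by omega) (by omega) Hu).1
        exact ⟨_, _, _, .penNext hk' hu hst he hr⟩
    · intro xo po c hr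
      cases hr with
      | done hk' =>
        refine ⟨hk', ?_⟩
        push_cast
        nlinarith
      | penStop hk' hp hst =>
        rw [etol] at hp
        obtain ⟨a1, -, a3⟩ := hall _ _ _ _ hp
        refine ⟨T.isKKTPair_of_prox a1 ((T.penTol_le' hε).trans (by linarith)) hε.le hst, ?_⟩
        have := natCast_le_ceil a3
        nlinarith
      | penNext hk' hp hst he hr =>
        rw [etol] at hp
        have Hu := hnext _ _ _ _ hp hst
        have a3 := natCast_le_ceil (hall _ _ _ _ hp).2.2
        obtain ⟨b1, b2⟩ := (ih s (k + 1) _ _ _ _ hs (by omega) (by omega) Hu).2 _ _ _ hr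
        refine ⟨b1, ?_⟩
        push_cast at b2 ⊢
        linarith
      | ialmStop hk' hp hst he hi ht =>
        rw [etol] at hp
        have Hu := hnext _ _ _ _ hp hst
        have a3 := natCast_le_ceil (hall _ _ _ _ hp).2.2
        obtain ⟨b1, b2⟩ := (T.ialm_spec hε hε2 hC Hu.mem (hinit (k + 1))).2 _ _ _ _ hi
        refine ⟨T.isKKTPair_of_prox b1.kkt le_rfl hε.le ht, ?_⟩
        have b3 := natCast_le_ceil b2
        push_cast
        nlinarith
      | ialmNext hk' hp hst he hi ht hr =>
        rw [etol] at hp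
        have Hu := hnext _ _ _ _ hp hst
        have a3 := natCast_le_ceil (hall _ _ _ _ hp).2.2
        have b3 := natCast_le_ceil
          ((T.ialm_spec hε hε2 hC Hu.mem (hinit (k + 1))).2 _ _ _ _ hi).2
        obtain ⟨h1, h2⟩ := hend _ _ Hu he _ _ _ _ hi ht
        rw [← stageEnd_succ q (s + 1)] at hr
        obtain ⟨d1, d2⟩ := (ih (s + 1) (stageEnd q (s + 1)) _ _ _ _ (by omega)
          (T.stageEnd_add_two_le _) (by omega) (StageEntry.inv T hε h2)).2 _ _ _ hr
        refine ⟨d1, ?_⟩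
        have he' : (stageEnd q (s + 1) : ℤ) = k + 2 := by exact_mod_cast he.symm
        rw [he'] at d2
        push_cast at d2 ⊢
        linarith

/-- The initial stage.  Nothing is known about the feasibility of the starting point, and the
first iteration is not counted as a decrease. -/
lemma initStage_spec (T : Setting P C q) {ε : ℝ} (hε : 0 < ε) (hε2 : ε ≤ 1 / 2)
    (hC : 1 ≤ ChatEps P C q ε) {init : ℕ → Vec n} (hinit : ∀ k, init k ∈ P.X) :
    ∀ (N k : ℕ) (x : Vec n), k + N + 1 = q.N₀ → x ∈ P.X →
      (k = 0 ∨ P.feas x ≤ ε / 2 ∧ P.g x + P.h x + ((k : ℝ) - 1) * outerGain q ε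
        ≤ C.B₀ + k * (ε * (diamD P / 2 + Mhat P C q))) →
      (∃ xo po c, InitStage P q ε ε (2 * penTol q ε) init k x xo po c) ∧
      ∀ xo po c, InitStage P q ε ε (2 * penTol q ε) init k x xo po c → P.IsKKTPair ε xo po ∧
        (c : ℤ) ≤ ((q.N₀ : ℤ) - k + stageNum P C q ε) * ⌈Tialm P C q ε⌉
          + ((stageEnd q (stageNum P C q ε) : ℤ) - q.N₀ - stageNum P C q ε)
            * ⌈Tpen P C q ε⌉ := by
  have hTi : 0 ≤ ⌈Tialm P C q ε⌉ := Int.ceil_nonneg (T.Tialm_nonneg hε hC)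
  have hTp : 0 ≤ ⌈Tpen P C q ε⌉ := Int.ceil_nonneg (T.Tpen_nonneg hε hC)
  have hS := T.one_le_stageNum hε
  have hM := Mhat_nonneg P C q
  have hD := diamD_nonneg P
  have hg := T.outerGain_nonneg ε
  have hKS : q.N₀ + stageNum P C q ε ≤ stageEnd q (stageNum P C q ε) := by
    have := T.stageEnd_add_le (Nat.zero_le (stageNum P C q ε))
    rwa [stageEnd_zero, Nat.sub_zero] at this
  have hnum : (0 : ℤ) ≤ (stageEnd q (stageNum P C q ε) : ℤ) - q.N₀ - stageNum P C q ε := by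
    omega
  have hpen := mul_nonneg hnum hTp
  have hSTi : 0 ≤ (stageNum P C q ε : ℤ) * ⌈Tialm P C q ε⌉ :=
    mul_nonneg (Int.natCast_nonneg _) hTi
  have hnext : ∀ (k : ℕ) (x : Vec n), x ∈ P.X →
      (k = 0 ∨ P.feas x ≤ ε / 2 ∧ P.g x + P.h x + ((k : ℝ) - 1) * outerGain q ε
        ≤ C.B₀ + k * (ε * (diamD P / 2 + Mhat P C q))) →
      ∀ βu u pu, IALMOut P C q ε x βu u pu → ¬ ‖u - x‖ ≤ ε / (4 * q.ρ) →
      P.g u + P.h u + (((k + 1 : ℕ) : ℝ) - 1) * outerGain q ε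
        ≤ C.B₀ + ((k + 1 : ℕ) : ℝ) * (ε * (diamD P / 2 + Mhat P C q)) := by
    intro k x hx hinv βu u pu ho hst
    push_cast
    rcases hinv with rfl | ⟨hf, he⟩
    · have h1 := (abs_le.1 (T.abs_obj_le (IALMOut.mem_nonneg_feas T ho).1)).2
      have : 0 ≤ ε * (diamD P / 2 + Mhat P C q) := by positivity
      push_cast
      linarith
    · have h1 := T.ialm_energy hε ho hf hst
      have h2 : ε * (diamD P / 4) ≤ ε * (diamD P / 2) := by gcongr; linarith
      linarith
  -- entering the first stage
  have hstage : ∀ (x u : Vec n) (βu : ℝ) (pu : Dual l m), IALMOut P C q ε x βu u pu →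
      P.g u + P.h u + ((q.N₀ : ℝ) - 1) * outerGain q ε
        ≤ C.B₀ + (q.N₀ : ℝ) * (ε * (diamD P / 2 + Mhat P C q)) →
      StageInv P C q ε 0 q.N₀ u βu pu := by
    intro x u βu pu ho he
    refine StageEntry.inv T hε (IALMOut.entry T hε ho ?_)
    unfold stageBase
    push_cast
    linarith
  have hloop := fun (u : Vec n) (βu : ℝ) (pu : Dual l m) (H : StageInv P C q ε 0 q.N₀ u βu pu) =>
    T.stageLoop_spec hε hε2 hC hinit (stageEnd q (stageNum P C q ε)) 0 q.N₀ u pu βu pu (by omega)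
      (by rw [← stageEnd_zero]; exact T.stageEnd_add_two_le 0) (by omega) H
  simp only [zero_add, stageEnd_one] at hloop
  intro N
  induction N with
  | zero =>
    intro k x hk hx hinv
    have hk' : k + 1 = q.N₀ := by omega
    obtain ⟨⟨βu, u, pu, cu, hu⟩, hall⟩ := T.ialm_spec hε hε2 hC hx (hinit k)
    have henergy := hnext k x hx hinv
    rw [hk'] at henergy
    have hkz : (q.N₀ : ℤ) = k + 1 := by exact_mod_cast hk'.symm
    constructor
    · by_cases hst : ‖u - x‖ ≤ ε / (4 * q.ρ)
      · exact ⟨_, _, _, .halt hu hst⟩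
      have ho := (hall _ _ _ _ hu).1
      obtain ⟨xo, po, c, hr⟩ := (hloop u βu pu (hstage _ _ _ _ ho (henergy _ _ _ ho hst))).1
      exact ⟨_, _, _, .stages hu hst hk' hr⟩
    · intro xo po c hr
      cases hr with
      | halt hi hst =>
        obtain ⟨a1, a2⟩ := hall _ _ _ _ hi
        refine ⟨T.isKKTPair_of_prox a1.kkt le_rfl hε.le hst, ?_⟩
        have := natCast_le_ceil a2
        have e : (q.N₀ : ℤ) - k + stageNum P C q ε = 1 + stageNum P C q ε := by omega
        rw [e]
        linarith
      | next hi hst he hr => omega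
      | stages hi hst he hr =>
        obtain ⟨a1, a2⟩ := hall _ _ _ _ hi
        have := natCast_le_ceil a2
        obtain ⟨b1, b2⟩ := (hloop _ _ _ (hstage _ _ _ _ a1 (henergy _ _ _ a1 hst))).2 _ _ _ hr
        refine ⟨b1, ?_⟩
        have e : (q.N₀ : ℤ) - k + stageNum P C q ε = 1 + stageNum P C q ε := by omega
        rw [e]
        push_cast at b2 ⊢
        linarith
  | succ N ih =>
    intro k x hk hx hinv
    obtain ⟨⟨βu, u, pu, cu, hu⟩, hall⟩ := T.ialm_spec hε hε2 hC hx (hinit k)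
    have henergy := hnext k x hx hinv
    have hstep : ∀ βu u pu, IALMOut P C q ε x βu u pu → ¬ ‖u - x‖ ≤ ε / (4 * q.ρ) → _ :=
      fun βu u pu ho hst => ih (k + 1) u (by omega) (IALMOut.mem_nonneg_feas T ho).1
        (.inr ⟨(IALMOut.mem_nonneg_feas T ho).2.2, henergy _ _ _ ho hst⟩)
    have hlt : (0 : ℤ) ≤ (q.N₀ : ℤ) - k - 1 := by omega
    have hrest := mul_nonneg hlt hTi
    constructor
    · by_cases hst : ‖u - x‖ ≤ ε / (4 * q.ρ)
      · exact ⟨_, _, _, .halt hu hst⟩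
      obtain ⟨xo, po, c, hr⟩ := (hstep _ _ _ (hall _ _ _ _ hu).1 hst).1
      exact ⟨_, _, _, .next hu hst (by omega) hr⟩
    · intro xo po c hr
      cases hr with
      | halt hi hst =>
        obtain ⟨a1, a2⟩ := hall _ _ _ _ hi
        refine ⟨T.isKKTPair_of_prox a1.kkt le_rfl hε.le hst, ?_⟩
        have := natCast_le_ceil a2
        linarith
      | next hi hst he hr =>
        obtain ⟨a1, a2⟩ := hall _ _ _ _ hi
        have := natCast_le_ceil a2
        obtain ⟨b1, b2⟩ := (hstep _ _ _ a1 hst).2 _ _ _ hr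
        refine ⟨b1, ?_⟩
        push_cast at b2 ⊢
        linarith
      | stages hi hst he hr => omega

lemma run_spec (T : Setting P C q) {ε : ℝ} (hε : 0 < ε) (hε2 : ε ≤ 1 / 2)
    (hC : 1 ≤ ChatEps P C q ε) {init : ℕ → Vec n} (hinit : ∀ k, init k ∈ P.X) {x₀ : Vec n}
    (hx₀ : x₀ ∈ P.X) :
    (∃ xo po c, Run P q ε ε (2 * penTol q ε) init x₀ xo po c) ∧
    ∀ xo po c, Run P q ε ε (2 * penTol q ε) init x₀ xo po c →
      P.IsKKTPair ε xo po ∧ (c : ℤ) ≤ Ttotal P C q ε := by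
  have hN0 : 0 < q.N₀ := by
    have h1 : (0 : ℝ) < q.N₁ := by exact_mod_cast (by linarith [T.two_le_N₁] : 0 < q.N₁)
    exact_mod_cast (div_pos h1 (by linarith [T.one_lt_γ])).trans_le T.le_N₀
  obtain ⟨h1, h2⟩ := T.initStage_spec hε hε2 hC hinit (q.N₀ - 1) 0 x₀ (by omega) hx₀ (.inl rfl)
  refine ⟨h1, fun xo po c hr => ?_⟩
  obtain ⟨a1, a2⟩ := h2 _ _ _ hr
  refine ⟨a1, ?_⟩
  unfold Ttotal
  simpa using a2

end Setting

end Outer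

/-! ### The order of the bound as the tolerance tends to zero -/

section Asymptotics

open Asymptotics Filter

lemma eventually_small {δ : ℝ} (hδ : 0 < δ) : ∀ᶠ ε : ℝ in 𝓝[>] 0, 0 < ε ∧ ε < δ :=
  Ioo_mem_nhdsGT hδ

lemma rpow_isBigO_rpow {a b : ℝ} (h : b ≤ a) :
    (fun ε : ℝ => ε ^ a) =O[𝓝[>] 0] fun ε : ℝ => ε ^ b := by
  refine IsBigO.of_bound 1 ?_
  filter_upwards [eventually_small one_pos] with ε hε
  rw [one_mul, Real.norm_of_nonneg (Real.rpow_nonneg hε.1.le _),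
    Real.norm_of_nonneg (Real.rpow_nonneg hε.1.le _)]
  exact Real.rpow_le_rpow_of_exponent_ge hε.1 hε.2.le h

lemma const_isBigO_rpow (c : ℝ) {b : ℝ} (h : b ≤ 0) :
    (fun _ : ℝ => c) =O[𝓝[>] 0] fun ε : ℝ => ε ^ b := by
  refine (isBigO_const_const c one_ne_zero _).trans ((rpow_isBigO_rpow h).congr_left ?_)
  intro ε
  exact Real.rpow_zero ε

lemma const_isBigO_log (c : ℝ) :
    (fun _ : ℝ => c) =O[𝓝[>] 0] fun ε : ℝ => |Real.log ε| := by
  refine (isBigO_const_const c one_ne_zero _).trans (IsBigO.of_bound 1 ?_ : (fun _ : ℝ => (1 : ℝ))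
    =O[𝓝[>] 0] fun ε : ℝ => |Real.log ε|)
  filter_upwards [eventually_small (Real.exp_pos (-1))] with ε hε
  have h1 : Real.log ε ≤ -1 := by
    rw [← Real.log_exp (-1)]
    exact Real.log_le_log hε.1 hε.2.le
  rw [norm_one, one_mul, Real.norm_of_nonneg (abs_nonneg _)]
  exact (by linarith : (1 : ℝ) ≤ -Real.log ε).trans (neg_le_abs _)

lemma log_isBigO_rpow {b : ℝ} (h : b < 0) :
    (fun ε : ℝ => |Real.log ε|) =O[𝓝[>] 0] fun ε : ℝ => ε ^ b :=
  (isLittleO_abs_log_rpow_rpow_nhdsGT_zero 1 h).isBigO.congr_left fun _ => Real.rpow_one _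

lemma const_div_isBigO (c : ℝ) : (fun ε : ℝ => c / ε) =O[𝓝[>] 0] fun ε : ℝ => ε ^ (-1 : ℝ) := by
  simp only [Real.rpow_neg_one, div_eq_mul_inv]
  exact (isBigO_refl _ _).const_mul_left c

lemma id_isBigO_rpow {b : ℝ} (h : b ≤ 1) :
    (fun ε : ℝ => ε) =O[𝓝[>] 0] fun ε : ℝ => ε ^ b :=
  (rpow_isBigO_rpow h).congr_left fun ε => Real.rpow_one ε

lemma IsBigO.mul_rpow {f g : ℝ → ℝ} {a b c : ℝ} (hf : f =O[𝓝[>] 0] fun ε : ℝ => ε ^ a)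
    (hg : g =O[𝓝[>] 0] fun ε : ℝ => ε ^ b) (h : a + b = c) :
    (fun ε => f ε * g ε) =O[𝓝[>] 0] fun ε : ℝ => ε ^ c := by
  refine (hf.mul hg).trans_eventuallyEq ?_
  filter_upwards [eventually_small one_pos] with ε hε
  rw [← Real.rpow_add hε.1, h]

lemma IsBigO.rpow_rpow {f : ℝ → ℝ} {a r c : ℝ} (hf : f =O[𝓝[>] 0] fun ε : ℝ => ε ^ a)
    (hr : 0 ≤ r) (h : a * r = c) : (fun ε => f ε ^ r) =O[𝓝[>] 0] fun ε : ℝ => ε ^ c := by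
  have h1 : 0 ≤ᶠ[𝓝[>] 0] fun ε : ℝ => ε ^ a := by
    filter_upwards [eventually_small one_pos] with ε hε
    exact Real.rpow_nonneg hε.1.le _
  refine (hf.rpow hr h1).trans_eventuallyEq ?_
  filter_upwards [eventually_small one_pos] with ε hε
  rw [← Real.rpow_mul hε.1.le, h]

lemma IsBigO.sqrt_rpow {f : ℝ → ℝ} {a c : ℝ} (hf : f =O[𝓝[>] 0] fun ε : ℝ => ε ^ a)
    (h : a / 2 = c) : (fun ε => Real.sqrt (f ε)) =O[𝓝[>] 0] fun ε : ℝ => ε ^ c := by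
  simp only [Real.sqrt_eq_rpow]
  exact IsBigO.rpow_rpow hf (by norm_num) (by linarith)

lemma IsBigO.max {f g k : ℝ → ℝ} {F : Filter ℝ} (hf : f =O[F] k) (hg : g =O[F] k) :
    (fun ε => max (f ε) (g ε)) =O[F] k := by
  refine IsBigO.trans (IsBigO.of_bound 1 (Eventually.of_forall fun ε => ?_))
    (hf.norm_left.add hg.norm_left)
  rw [one_mul, Real.norm_eq_abs, Real.norm_eq_abs, Real.norm_eq_abs, Real.norm_eq_abs]
  refine (abs_max_le_max_abs_abs).trans ((max_le ?_ ?_).trans (le_abs_self _)) <;>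
  linarith [abs_nonneg (f ε), abs_nonneg (g ε)]

lemma IsBigO.ceil {f k : ℝ → ℝ} {F : Filter ℝ} (hf : f =O[F] k)
    (h1 : (fun _ => (1 : ℝ)) =O[F] k) : (fun ε => (⌈f ε⌉ : ℝ)) =O[F] k := by
  refine IsBigO.trans (IsBigO.of_bound 1 (Eventually.of_forall fun ε => ?_))
    (hf.norm_left.add h1)
  have h2 := Int.le_ceil (f ε)
  have h3 := Int.ceil_lt_add_one (f ε)
  rw [one_mul, Real.norm_eq_abs, Real.norm_eq_abs, Real.norm_eq_abs,
    abs_of_nonneg (by positivity : 0 ≤ |f ε| + 1)]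
  exact abs_le.2 ⟨by linarith [neg_abs_le (f ε)], by linarith [le_abs_self (f ε)]⟩

/-- The logarithm of a function of polynomial growth that is bounded away from zero. -/
lemma IsBigO.log_rpow {f : ℝ → ℝ} {a c : ℝ} (hf : f =O[𝓝[>] 0] fun ε : ℝ => ε ^ a) (hc : 0 < c)
    (hle : ∀ᶠ ε in 𝓝[>] 0, c ≤ f ε) :
    (fun ε => Real.log (f ε)) =O[𝓝[>] 0] fun ε : ℝ => |Real.log ε| := by
  obtain ⟨K, hK0, hK⟩ := hf.exists_pos
  have h1 : (fun ε : ℝ => |Real.log c| + |Real.log K| + |a| * |Real.log ε|)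
      =O[𝓝[>] 0] fun ε : ℝ => |Real.log ε| :=
    (const_isBigO_log _).add ((isBigO_refl _ _).const_mul_left _)
  refine IsBigO.trans (IsBigO.of_bound 1 ?_) h1
  filter_upwards [hK.bound, hle, eventually_small one_pos] with ε h2 h3 hε
  have hε0 := Real.rpow_pos_of_pos hε.1 a
  have hf0 : 0 < f ε := hc.trans_le h3
  rw [Real.norm_of_nonneg hf0.le, Real.norm_of_nonneg hε0.le] at h2
  have h4 := Real.log_le_log hc h3
  have h5 := Real.log_le_log hf0 h2
  rw [Real.log_mul hK0.ne' hε0.ne', Real.log_rpow hε.1] at h5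
  have h6 : a * Real.log ε ≤ |a| * |Real.log ε| := by
    rw [← abs_mul]; exact le_abs_self _
  have h7 : 0 ≤ |a| * |Real.log ε| := by positivity
  have h8 := neg_abs_le (Real.log c)
  have h9 := le_abs_self (Real.log K)
  rw [one_mul, Real.norm_eq_abs, Real.norm_eq_abs]
  refine (abs_le.2 ⟨?_, ?_⟩).trans (le_abs_self _)
  · linarith [abs_nonneg (Real.log K)]
  · linarith [abs_nonneg (Real.log c)]

lemma IsBigO.max_one_log {f : ℝ → ℝ} {a : ℝ} (hf : f =O[𝓝[>] 0] fun ε : ℝ => ε ^ a) (ha : a ≤ 0)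
    (h0 : ∀ᶠ ε in 𝓝[>] 0, 0 ≤ f ε) :
    (fun ε => Max.max 1 (Real.log (f ε))) =O[𝓝[>] 0] fun ε : ℝ => |Real.log ε| := by
  have h1 := IsBigO.max (const_isBigO_log 1) (IsBigO.log_rpow
    (IsBigO.max (const_isBigO_rpow 1 ha) hf) one_pos
    (Eventually.of_forall fun ε => le_max_left _ _))
  refine EventuallyEq.trans_isBigO ?_ h1
  filter_upwards [h0] with ε hε
  rcases le_total 1 (f ε) with h | h
  · rw [max_eq_right h]
  · rw [max_eq_left h, Real.log_one, max_eq_left zero_le_one,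
      max_eq_left ((Real.log_nonpos hε h).trans zero_le_one)]

namespace Setting

variable {n l m : ℕ} {P : NLP n l m} {C : Consts n m} {q : Params}

lemma ChatEps_isBigO (P : NLP n l m) (C : Consts n m) (q : Params) :
    (fun ε => ChatEps P C q ε) =O[𝓝[>] 0] fun ε : ℝ => ε ^ (-1 : ℝ) := by
  unfold ChatEps
  refine IsBigO.max ?_ (IsBigO.max ?_ (const_isBigO_rpow _ (by norm_num))) <;>
  · simp only [← div_div]
    exact const_div_isBigO _

lemma betaBar_isBigO (P : NLP n l m) (C : Consts n m) (q : Params) :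
    (fun ε => betaBar P C q ε) =O[𝓝[>] 0] fun ε : ℝ => ε ^ (-1 : ℝ) := by
  unfold betaBar
  refine IsBigO.max ?_ (IsBigO.max ?_ (const_isBigO_rpow _ (by norm_num))) <;>
  · simp only [mul_comm _ (min 1 (1 / Real.sqrt q.ρ)), ← div_div]
    exact const_div_isBigO _

lemma logb_isBigO {s : ℝ} {f : ℝ → ℝ} {a c : ℝ} (hf : f =O[𝓝[>] 0] fun ε : ℝ => ε ^ a)
    (hc : 0 < c) (hle : ∀ᶠ ε in 𝓝[>] 0, c ≤ f ε) :
    (fun ε => (⌈Real.logb s (f ε)⌉ : ℝ)) =O[𝓝[>] 0] fun ε : ℝ => |Real.log ε| := by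
  refine IsBigO.ceil ?_ (const_isBigO_log 1)
  simp only [Real.logb, div_eq_inv_mul]
  exact (IsBigO.log_rpow hf hc hle).const_mul_left _

lemma Kialm_isBigO (T : Setting P C q) :
    (fun ε => (Kialm P C q ε : ℝ)) =O[𝓝[>] 0] fun ε : ℝ => |Real.log ε| := by
  unfold Kialm
  push_cast
  exact (logb_isBigO (ChatEps_isBigO P C q) (div_pos (by norm_num) T.β₀_pos)
    (Eventually.of_forall fun ε => (le_max_right _ _).trans (le_max_right _ _))).add
    (const_isBigO_log 1)

lemma Kpen_isBigO (T : Setting P C q) :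
    (fun ε => (Kpen P C q ε : ℝ)) =O[𝓝[>] 0] fun ε : ℝ => |Real.log ε| := by
  have h := T.β₀_pos
  unfold Kpen
  push_cast
  refine (logb_isBigO (a := -1) (c := 8 / q.β₀) ?_ (by positivity)
    (Eventually.of_forall fun ε => ?_)).add (const_isBigO_log 1)
  · simp only [div_eq_inv_mul]
    exact (betaBar_isBigO P C q).const_mul_left _
  · have := eight_le_betaBar P C q ε
    gcongr

lemma LhatEps_isBigO (P : NLP n l m) (C : Consts n m) (q : Params) :
    (fun ε => LhatEps P C q ε) =O[𝓝[>] 0] fun ε : ℝ => ε ^ (-1 : ℝ) := by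
  have h1 := ChatEps_isBigO P C q
  have h2 : (fun ε : ℝ => ε / (2 * Real.sqrt 2) * Real.sqrt (q.β₀ * ChatEps P C q ε))
      =O[𝓝[>] 0] fun ε : ℝ => ε ^ (-1 : ℝ) := by
    refine IsBigO.mul_rpow (a := -1 / 2) (b := -1 / 2) ?_ ?_ (by norm_num)
    · simp only [div_eq_inv_mul]
      exact (id_isBigO_rpow (by norm_num)).const_mul_left _
    · exact IsBigO.sqrt_rpow (h1.const_mul_left _) (by norm_num)
  unfold LhatEps
  exact ((const_isBigO_rpow _ (by norm_num)).add (h1.const_mul_left _)).add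
    (((const_isBigO_rpow _ (by norm_num)).add h2).const_mul_left _)

lemma Lbar_isBigO (P : NLP n l m) (C : Consts n m) (q : Params) :
    (fun ε => Lbar P C q ε) =O[𝓝[>] 0] fun ε : ℝ => ε ^ (-1 : ℝ) := by
  unfold Lbar
  exact ((const_isBigO_rpow _ (by norm_num)).add ((betaBar_isBigO P C q).const_mul_left _)).add
    (const_isBigO_rpow _ (by norm_num))

lemma CtilEps_isBigO (P : NLP n l m) (C : Consts n m) (q : Params) :
    (fun ε => CtilEps P C q ε) =O[𝓝[>] 0] fun ε : ℝ => ε ^ (-1 / 2 : ℝ) := by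
  have h1 := ChatEps_isBigO P C q
  unfold CtilEps
  simp only [div_eq_mul_inv _ (Real.sqrt q.ρ * _)]
  refine IsBigO.add ?_ (IsBigO.mul_rpow (a := 0) (b := -1 / 2) ?_ ?_ (by norm_num))
  · simp only [mul_comm _ (Real.sqrt q.ρ * (Real.sqrt q.σ - 1))⁻¹]
    exact (IsBigO.sqrt_rpow (h1.const_mul_left _) (by norm_num)).const_mul_left _
  · refine IsBigO.sqrt_rpow (a := 0) (IsBigO.const_mul_left ?_ _) (by norm_num)
    simp only [mul_div_assoc, mul_comm _ (Real.sqrt q.β₀ / Real.sqrt (2 * q.σ))]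
    exact (id_isBigO_rpow (by norm_num)).const_mul_left _
  · simp only [mul_comm _ (Real.sqrt q.ρ * _)⁻¹]
    refine ((IsBigO.trans (IsBigO.rpow_rpow (c := -1 / 4) h1 (by norm_num) (by norm_num))
      (rpow_isBigO_rpow (by norm_num))).const_mul_left _).const_mul_left _

lemma alphaK_isBigO (T : Setting P C q) :
    (fun ε => alphaK P C q ε) =O[𝓝[>] 0] fun ε : ℝ => ε ^ (-1 / 2 : ℝ) := by
  have h1 := T.Kpen_isBigO.trans (log_isBigO_rpow (b := -1 / 2) (by norm_num))
  unfold alphaK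
  simp only [mul_comm (Kpen P C q _ : ℝ), div_eq_inv_mul _ (Real.sqrt q.σ - 1),
    mul_comm (betaBar P C q _)]
  refine ((h1.const_mul_left _).add (h1.const_mul_left _)).add
    (IsBigO.const_mul_left (IsBigO.const_mul_left ?_ _) _)
  exact IsBigO.sqrt_rpow ((betaBar_isBigO P C q).const_mul_left _) (by norm_num)

lemma logTerm_isBigO (T : Setting P C q) {Λ : ℝ → ℝ}
    (hΛ : Λ =O[𝓝[>] 0] fun ε : ℝ => ε ^ (-1 : ℝ)) (hρ : ∀ᶠ ε in 𝓝[>] 0, q.ρ ≤ Λ ε)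
    {c : ℝ} (hc : 0 < c) :
    (fun ε => logTerm P q (Λ ε) (c * ε)) =O[𝓝[>] 0] fun ε : ℝ => |Real.log ε| := by
  unfold logTerm
  refine IsBigO.max_one_log (a := -3) ?_ (by norm_num) ?_
  · have e : ∀ ε : ℝ, 2 * (1 + q.γ₁) * Λ ε * diamD P * Real.sqrt (q.γ₁ * Λ ε / q.ρ + 1) / (c * ε)
        = Λ ε * (Real.sqrt (q.γ₁ / q.ρ * Λ ε + 1) * ((2 * (1 + q.γ₁) * diamD P / c) / ε)) := by
      intro ε
      rw [mul_div_right_comm q.γ₁, ← div_div]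
      ring
    simp only [e]
    refine IsBigO.mul_rpow (b := -2) hΛ (IsBigO.mul_rpow (a := -1) ?_ (const_div_isBigO _)
      (by norm_num)) (by norm_num)
    exact (IsBigO.sqrt_rpow ((hΛ.const_mul_left _).add (const_isBigO_rpow 1 (by norm_num)))
      rfl).trans (rpow_isBigO_rpow (by norm_num))
  · have h1 := T.one_lt_γ₁
    have h2 := T.ρ_pos
    have h3 := diamD_nonneg P
    filter_upwards [hρ, eventually_small one_pos] with ε h4 hε
    have h5 : 0 < Λ ε := h2.trans_le h4
    have h6 := hε.1
    positivity

lemma isBigO_rpow_mul_log {f g : ℝ → ℝ} (hf : f =O[𝓝[>] 0] fun ε : ℝ => ε ^ (-1 / 2 : ℝ))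
    (hg : g =O[𝓝[>] 0] fun ε : ℝ => |Real.log ε|) :
    (fun ε => f ε * g ε) =O[𝓝[>] 0] fun ε : ℝ => ε ^ (-1 / 2 : ℝ) * |Real.log ε| :=
  hf.mul hg

lemma one_isBigO_rpow_mul_log :
    (fun _ => (1 : ℝ)) =O[𝓝[>] 0] fun ε : ℝ => ε ^ (-1 / 2 : ℝ) * |Real.log ε| :=
  (isBigO_rpow_mul_log (const_isBigO_rpow 1 (by norm_num)) (const_isBigO_log 1)).congr_left
    fun _ => one_mul 1

lemma Tialm_isBigO (T : Setting P C q) :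
    (fun ε => (⌈Tialm P C q ε⌉ : ℝ))
      =O[𝓝[>] 0] fun ε : ℝ => ε ^ (-1 / 2 : ℝ) * |Real.log ε| := by
  refine IsBigO.ceil ?_ one_isBigO_rpow_mul_log
  have hK := T.Kialm_isBigO
  have hρ := T.ρ_pos
  have hL := LhatEps_isBigO P C q
  have hLρ : ∀ᶠ ε in 𝓝[>] 0, q.ρ ≤ LhatEps P C q ε := by
    filter_upwards [eventually_small one_pos] with ε hε using T.ρ_le_LhatEps hε.1
  have hlog := T.logTerm_isBigO hL hLρ
    (c := Real.sqrt ((q.σ - 1) / (q.σ + 1)) * (1 / 4) * min 1 (Real.sqrt q.ρ)) (by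
      have := T.epsBar₁_pos one_pos
      exact this)
  have e : ∀ ε, Real.sqrt ((q.σ - 1) / (q.σ + 1)) * (1 / 4) * min 1 (Real.sqrt q.ρ) * ε
      = epsBar₁ q ε := fun ε => by unfold epsBar₁; ring
  simp only [e] at hlog
  have hlog' := log_isBigO_rpow (b := -1 / 2) (by norm_num)
  have hceil : (fun ε => (⌈Real.logb q.γ₁ (LhatEps P C q ε / q.ρ)⌉ : ℝ))
      =O[𝓝[>] 0] fun ε : ℝ => |Real.log ε| := by
    refine logb_isBigO (a := -1) (c := 1) ?_ one_pos ?_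
    · simp only [div_eq_inv_mul]
      exact hL.const_mul_left _
    · filter_upwards [hLρ] with ε hε using (one_le_div hρ).2 hε
  unfold Tialm
  refine (isBigO_rpow_mul_log (IsBigO.const_mul_left ?_ _) hlog).add
    (isBigO_rpow_mul_log ?_ hK)
  · exact ((hK.trans hlog').const_mul_left _).add (CtilEps_isBigO P C q)
  · exact (((hceil.trans hlog').const_mul_left _).add (const_isBigO_rpow _ (by norm_num)))

lemma Tpen_isBigO (T : Setting P C q) :
    (fun ε => (⌈Tpen P C q ε⌉ : ℝ))
      =O[𝓝[>] 0] fun ε : ℝ => ε ^ (-1 / 2 : ℝ) * |Real.log ε| := by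
  refine IsBigO.ceil ?_ one_isBigO_rpow_mul_log
  have hK := T.Kpen_isBigO
  have hρ := T.ρ_pos
  have hL := Lbar_isBigO P C q
  have hlog := T.logTerm_isBigO hL (Eventually.of_forall fun ε => T.ρ_le_Lbar ε)
    (c := epsBar₂ q 1) (T.epsBar₂_pos one_pos)
  have e : ∀ ε, epsBar₂ q 1 * ε = epsBar₂ q ε := fun ε => by unfold epsBar₂; ring
  simp only [e] at hlog
  have hlog' := log_isBigO_rpow (b := -1 / 2) (by norm_num)
  have hceil : (fun ε => (⌈Real.logb q.γ₁ (Lbar P C q ε / q.ρ)⌉ : ℝ))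
      =O[𝓝[>] 0] fun ε : ℝ => |Real.log ε| := by
    refine logb_isBigO (a := -1) (c := 1) ?_ one_pos ?_
    · simp only [div_eq_inv_mul]
      exact hL.const_mul_left _
    · exact Eventually.of_forall fun ε => (one_le_div hρ).2 (T.ρ_le_Lbar ε)
  unfold Tpen
  refine (isBigO_rpow_mul_log ?_ hlog).add (isBigO_rpow_mul_log ?_ hK)
  · simp only [mul_comm _ (Real.sqrt (q.γ₁ / q.ρ))]
    exact (T.alphaK_isBigO.const_mul_left _).const_mul_left _
  · exact (((hceil.trans hlog').const_mul_left _).add (const_isBigO_rpow _ (by norm_num)))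

lemma stageEnd_le (T : Setting P C q) (S : ℕ) :
    (stageEnd q S : ℝ) ≤ q.N₀ + 2 * q.N₁ / (q.γ - 1) * q.γ ^ S := by
  have hγ := T.one_lt_γ
  have hγ' : 0 < q.γ - 1 := by linarith
  have hN1 : (2 : ℝ) ≤ q.N₁ := by exact_mod_cast T.two_le_N₁
  have h1 : ∀ j : ℕ, (⌈q.γ ^ j * q.N₁⌉₊ : ℝ) ≤ 2 * q.N₁ * q.γ ^ j := by
    intro j
    have h2 := Nat.ceil_lt_add_one (show 0 ≤ q.γ ^ j * q.N₁ by positivity)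
    have h3 : 1 ≤ q.γ ^ j := one_le_pow₀ hγ.le
    nlinarith
  unfold stageEnd
  push_cast
  calc (q.N₀ : ℝ) + ∑ j ∈ Finset.range S, (⌈q.γ ^ j * q.N₁⌉₊ : ℝ)
      ≤ q.N₀ + ∑ j ∈ Finset.range S, 2 * q.N₁ * q.γ ^ j := by gcongr; exact h1 _
    _ = q.N₀ + 2 * q.N₁ * ∑ j ∈ Finset.range S, q.γ ^ j := by rw [Finset.mul_sum]
    _ ≤ q.N₀ + 2 * q.N₁ * (q.γ ^ S / (q.γ - 1)) := by
        gcongr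
        exact sum_pow_le hγ S
    _ = _ := by ring

/-- The stage before the last one violates one of the two lower bounds that define the number of
stages. -/
lemma pow_stageNum_isBigO (T : Setting P C q) :
    (fun ε => q.γ ^ stageNum P C q ε) =O[𝓝[>] 0] fun ε : ℝ => ε ^ (-2 : ℝ) := by
  have hγ := T.one_lt_γ
  have hγ' : 0 < q.γ - 1 := by linarith
  have hN1 : (0 : ℝ) < q.N₁ := by exact_mod_cast (by linarith [T.two_le_N₁] : 0 < q.N₁)
  have hsq : ∀ c : ℝ, (fun ε : ℝ => c / ε ^ 2) =O[𝓝[>] 0] fun ε : ℝ => ε ^ (-2 : ℝ) := by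
    intro c
    have e : ∀ ε : ℝ, c / ε ^ 2 = c / ε * (1 / ε) := fun ε => by rw [sq, ← div_div]; ring
    simp only [e]
    exact IsBigO.mul_rpow (const_div_isBigO c) (const_div_isBigO 1) (by norm_num)
  set A : ℝ → ℝ := fun ε => 96 * q.ρ * C.B₀ / ε ^ 2
    + 48 * q.ρ * q.N₀ * (diamD P / 2 + Mhat P C q) / ε with hA
  have hAO : A =O[𝓝[>] 0] fun ε : ℝ => ε ^ (-2 : ℝ) :=
    (hsq _).add ((const_div_isBigO _).trans (rpow_isBigO_rpow (by norm_num)))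
  have hC : (fun ε => Ctil P C q ε / ε) =O[𝓝[>] 0] fun ε : ℝ => ε ^ (-1 : ℝ) := by
    simp only [div_eq_mul_inv (Ctil P C q _), ← Real.rpow_neg_one]
    refine IsBigO.mul_rpow (a := 0) ?_ (isBigO_refl _ _) (by norm_num)
    unfold Ctil
    refine IsBigO.max (const_isBigO_rpow _ le_rfl) ?_
    simp only [mul_comm _ (Real.exp 1)]
    exact (id_isBigO_rpow (by norm_num)).const_mul_left _
  set D : ℝ → ℝ := fun ε => 2 * ((Ctil P C q ε / ε) * (Ctil P C q ε / ε)) with hD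
  have hDO : D =O[𝓝[>] 0] fun ε : ℝ => ε ^ (-2 : ℝ) :=
    (IsBigO.mul_rpow hC hC (by norm_num)).const_mul_left _
  have hsum : (fun ε => q.γ * (A ε * ((q.γ - 1) / q.N₁) + 1 + D ε))
      =O[𝓝[>] 0] fun ε : ℝ => ε ^ (-2 : ℝ) := by
    refine IsBigO.const_mul_left ((IsBigO.add ?_ (const_isBigO_rpow _ (by norm_num))).add hDO) _
    simp only [mul_comm (A _)]
    exact hAO.const_mul_left _
  refine IsBigO.trans (IsBigO.of_bound 1 ?_) hsum
  filter_upwards [eventually_small one_pos] with ε hε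
  have hε0 := hε.1
  obtain ⟨k, hk⟩ := Nat.exists_eq_succ_of_ne_zero
    (Nat.one_le_iff_ne_zero.1 (T.one_le_stageNum hε0))
  have hnot : ¬ StageCond P C q ε k := Nat.notMem_of_lt_sInf (s := {S | StageCond P C q ε S})
    (by change k < stageNum P C q ε; omega)
  have hA0 : 0 ≤ A ε := by
    have h1 := T.ρ_pos
    have h2 := T.B₀_nonneg
    have h3 := diamD_nonneg P
    have h4 := Mhat_nonneg P C q
    rw [hA]; positivity
  have hC0 : 0 < Ctil P C q ε / ε := (Real.exp_pos 1).trans_le (exp_le_Ctil_div P C q hε0)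
  have hD0 : 0 ≤ D ε := by rw [hD]; positivity
  have hpow : q.γ ^ k ≤ A ε * ((q.γ - 1) / q.N₁) + 1 + D ε := by
    unfold StageCond at hnot
    rw [not_and_or, not_and_or, not_le, not_le, not_le] at hnot
    have hAp : 0 ≤ A ε * ((q.γ - 1) / q.N₁) := by positivity
    rcases hnot with h | h | h
    · exact absurd (T.stageEnd_ge k) (not_le.2 h)
    · have h1 : q.N₁ * ((q.γ ^ k - 1) / (q.γ - 1)) ≤ A ε := by
        have : (0 : ℝ) ≤ q.N₀ := Nat.cast_nonneg _
        have h' := h.le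
        change _ ≤ A ε at h'
        linarith
      have h2 : q.γ ^ k - 1 ≤ A ε * ((q.γ - 1) / q.N₁) := by
        calc q.γ ^ k - 1 = q.N₁ * ((q.γ ^ k - 1) / (q.γ - 1)) * ((q.γ - 1) / q.N₁) := by
              field_simp
          _ ≤ _ := by gcongr
      linarith
    · have h1 := Real.log_le_sub_one_of_pos hC0
      have h2 : 2 * (Ctil P C q ε / ε) * Real.log (Ctil P C q ε / ε) ≤ D ε := by
        rw [hD]
        have : Real.log (Ctil P C q ε / ε) ≤ Ctil P C q ε / ε := by linarith
        calc 2 * (Ctil P C q ε / ε) * Real.log (Ctil P C q ε / ε)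
            ≤ 2 * (Ctil P C q ε / ε) * (Ctil P C q ε / ε) := by gcongr
          _ = _ := by ring
      linarith
  rw [one_mul, Real.norm_of_nonneg (by positivity), Real.norm_eq_abs]
  refine le_trans ?_ (le_abs_self _)
  rw [hk, Nat.succ_eq_add_one, pow_succ, mul_comm]
  gcongr

lemma Ttotal_isBigO (T : Setting P C q) : (fun ε : ℝ => (Ttotal P C q ε : ℝ))
    =O[𝓝[>] 0] fun ε : ℝ => ε ^ (-(5 / 2) : ℝ) * |Real.log ε| := by
  have hK : (fun ε => (stageEnd q (stageNum P C q ε) : ℝ))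
      =O[𝓝[>] 0] fun ε : ℝ => ε ^ (-2 : ℝ) := by
    have h1 : (fun ε => (q.N₀ : ℝ) + 2 * q.N₁ / (q.γ - 1) * q.γ ^ stageNum P C q ε)
        =O[𝓝[>] 0] fun ε : ℝ => ε ^ (-2 : ℝ) :=
      (const_isBigO_rpow _ (by norm_num)).add (T.pow_stageNum_isBigO.const_mul_left _)
    refine IsBigO.trans (IsBigO.of_bound 1 (Eventually.of_forall fun ε => ?_)) h1
    rw [one_mul, Real.norm_of_nonneg (Nat.cast_nonneg _)]
    exact (T.stageEnd_le _).trans (le_abs_self _)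
  have hS : (fun ε => (stageNum P C q ε : ℝ)) =O[𝓝[>] 0] fun ε : ℝ => ε ^ (-2 : ℝ) := by
    refine IsBigO.trans (IsBigO.of_bound 1 (Eventually.of_forall fun ε => ?_)) hK
    rw [one_mul, Real.norm_of_nonneg (Nat.cast_nonneg _), Real.norm_of_nonneg (Nat.cast_nonneg _)]
    have := T.stageEnd_add_le (Nat.zero_le (stageNum P C q ε))
    exact_mod_cast (by omega : stageNum P C q ε ≤ stageEnd q (stageNum P C q ε))
  have hN : (fun _ : ℝ => (q.N₀ : ℝ)) =O[𝓝[>] 0] fun ε : ℝ => ε ^ (-2 : ℝ) :=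
    const_isBigO_rpow _ (by norm_num)
  unfold Ttotal
  push_cast
  refine IsBigO.trans_eventuallyEq (((hN.add hS).mul T.Tialm_isBigO).add
    (((hK.sub hN).sub hS).mul T.Tpen_isBigO)) ?_
  filter_upwards [eventually_small one_pos] with ε hε
  rw [← mul_assoc, ← Real.rpow_add hε.1]
  norm_num

end Setting

end Asymptotics

end HiAPeM

theorem mainTheorem1 {n l m : ℕ} (P : HiAPeM.NLP n l m) (C : HiAPeM.Consts n m)
    (q : HiAPeM.Params)
    (hA1 : HiAPeM.IsComposite P C q)
    (hA2 : HiAPeM.IsSlater P C.xfeas)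
    (hρ : 0 < q.ρ) (hA3 : HiAPeM.IsWeaklyConvex P q.ρ)
    (hA4 : HiAPeM.IsUniformlyBounded P C)
    (hβ₀ : 0 < q.β₀) (hσ : 1 < q.σ) (hγ : 1 < q.γ) (hγ₁ : 1 < q.γ₁) (hγ₂ : 1 ≤ q.γ₂)
    (hLmin : q.ρ ≤ q.Lmin)
    (hLmin' : q.Lmin ≤ C.L₀ + 2 * q.ρ + q.β₀ * HiAPeM.Lc P C)
    (hN₁ : 2 ≤ q.N₁) (hN₀ : (q.N₁ : ℝ) / (q.γ - 1) ≤ q.N₀) :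
    (∀ ε : ℝ, 0 < ε → ε ≤ 1 / 2 → 1 ≤ HiAPeM.ChatEps P C q ε →
      ∀ ε₁ ε₂ : ℝ, ε₁ = ε →
        ε₂ = ε / (2 * Real.sqrt 2) * min 1 (1 / Real.sqrt q.ρ) →
      ∀ x₀ ∈ P.X, ∀ init : ℕ → HiAPeM.Vec n, (∀ k, init k ∈ P.X) →
        (∃ (x : HiAPeM.Vec n) (p : HiAPeM.Dual l m) (c : ℕ),
          HiAPeM.Run P q ε ε₁ ε₂ init x₀ x p c) ∧
        ∀ (x : HiAPeM.Vec n) (p : HiAPeM.Dual l m) (c : ℕ),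
          HiAPeM.Run P q ε ε₁ ε₂ init x₀ x p c →
          P.IsKKTPair ε x p ∧ P.IsKKTPoint ε x ∧ (c : ℤ) ≤ HiAPeM.Ttotal P C q ε) ∧
    (fun ε : ℝ => (HiAPeM.Ttotal P C q ε : ℝ)) =O[nhdsWithin 0 (Set.Ioi 0)]
      (fun ε : ℝ => ε ^ (-(5 / 2) : ℝ) * |Real.log ε|) := by
  have T : HiAPeM.Setting P C q :=
    ⟨hA1, hA2, hρ, hA3, hA4, hβ₀, hσ, hγ, hγ₁, hγ₂, hLmin, hLmin', hN₁, hN₀⟩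
  refine ⟨?_, T.Ttotal_isBigO⟩
  rintro ε hε hε2 hC ε₁ ε₂ rfl rfl x₀ hx₀ init hinit
  have e : ε₁ / (2 * Real.sqrt 2) * min 1 (1 / Real.sqrt q.ρ)
      = 2 * HiAPeM.Setting.penTol q ε₁ := by
    unfold HiAPeM.Setting.penTol; ring
  rw [e]
  obtain ⟨h1, h2⟩ := T.run_spec hε hε2 hC hinit hx₀
  refine ⟨h1, fun x p c hr => ?_⟩
  obtain ⟨a1, a2⟩ := h2 x p c hr
  exact ⟨a1, ⟨p, a1⟩, a2⟩
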